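/- Let $k$ be an algebraically closed field of characteristic $0$. A superspace is a $\mathbb Z/2$-graded $k$-vector space. Let $\mathbb G_a^{(1|1)}$ be the unipotent algebraic supergroup with underlying group $\mathbb G_a$ whose Lie superalgebra has basis $x$ (odd) and $\tfrac12[x,x]=x^2$ (even), and let $OSp(1|2)$ be the algebraic supergroup with underlying group $SL_2$ and Lie superalgebra $\mathfrak{osp}(1|2)$; the latter is generated by an even element $h$ and odd elements $X,Y$ with $$[h,X]=-2X,\qquad [h,Y]=2Y,\qquad [Y,X]=h .$$ For $G$ one of these supergroups, $\mathrm{Rep}(G)$ denotes the $k$-linear rigid symmetric monoidal category of finite-dimensional algebraic representations of $G$ in superspaces, with parity-preserving morphisms. Let $S^*:\mathrm{Rep}(OSp(1|2))\to\mathrm{Rep}(\mathbb G_a^{(1|1)})$ be the restriction functor along the embedding $\mathbb G_a^{(1|1)}\to OSp(1|2)$ given by $x\mapsto X$. For $\mathcal U=\mathrm{Rep}(\mathbb G_a^{(1|1)})$ let $S:\mathcal U\to\overline{\mathcal U}$ be its semisimplification, that is, the quotient by the tensor ideal of negligible morphisms (those $f:M\to N$ with $\operatorname{tr}(g\circ f)=0$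 for all $g:N\to M$, where $\operatorname{tr}$ is the categorical trace). For every $M\in\mathrm{Rep}(\mathbb G_a^{(1|1)})$ there is exactly one finite increasing filtration $(\mathcal F^i(M))_{i\in\mathbb Z}$ of $M$ by subsuperspaces such that $x\,\mathcal F^i(M)\subset\mathcal F^{i-2}(M)$ for all $i$ and, with $Gr^i(M)=\mathcal F^i(M)/\mathcal F^{i-1}(M)$, the map $x^i:Gr^i(M)\to\Pi^i Gr^{-i}(M)$ is an isomorphism for all $i\ge 0$ ($\Pi$ denotes the change of parity); it is called the Deligne filtration of $x$. Put $Gr^{ev}(M)=\bigoplus_{i\in\mathbb Z}Gr^{2i}(M)$, a superspace on which $x$ induces an odd operator $Gr(x)$ that maps $Gr^{2i}(M)$ to $Gr^{2i-2}(M)$. Then: 1. $Gr^{ev}(M)$ has a unique structure of $\mathfrak{osp}(1|2)$-module such that $h$ acts on $Gr^{2i}(M)$ as multiplication by $2i$ for every $i$ and $X$ acts as $Gr(x)$. 2. There is a $k$-linear symmetric monoidal functor $T:\mathrm{Rep}(\mathbb G_a^{(1|1)})\to\mathrm{Rep}(OSp(1|2))$ such that $T(M)$ is $Gr^{ev}(M)$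 with the $\mathfrak{osp}(1|2)$-module structure of 1, such that $T(f)$, for a morphism $f$, is the map of associated graded spaces induced by $f$, and such that the tensor structure $T(M)\otimes T(N)\cong T(M\otimes N)$ sends $[m]\otimes[n]$, where $m\in\mathcal F^{2i}(M)$ and $n\in\mathcal F^{2j}(N)$, to the class of $m\otimes n\in\mathcal F^{2i+2j}(M\otimes N)$ in $Gr^{2i+2j}(M\otimes N)$. 3. The functor $S\circ S^*:\mathrm{Rep}(OSp(1|2))\to\overline{\mathcal U}$ is an equivalence of categories, and if its source and target are identified through it, $T$ is isomorphic to the semisimplification functor $S$ as a symmetric monoidal functor: there is an isomorphism of symmetric monoidal functors $S\circ S^*\circ T\cong S$. -/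

import Mathlib

open CategoryTheory MonoidalCategory TensorProduct DirectSum

universe u

noncomputable section

section Semisimplification

variable {C : Type*} [Category C] [MonoidalCategory C] [SymmetricCategory C]
  [RightRigidCategory C]

/-- The categorical trace `𝟙 ⟶ X ⊗ X* ⟶ X ⊗ X* ≅ X* ⊗ X ⟶ 𝟙` of an endomorphism of an object of
a rigid symmetric monoidal category. -/
def catTrace {X : C} (f : X ⟶ X) : 𝟙_ C ⟶ 𝟙_ C :=
  η_ X Xᘁ ≫ f ▷ Xᘁ ≫ (β_ X Xᘁ).hom ≫ ε_ X Xᘁ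

variable [Preadditive C]

/-- A morphism `f : X ⟶ Y` is negligible if `tr (g ∘ f) = 0` for all `g : Y ⟶ X`. -/
def Negligible {X Y : C} (f : X ⟶ Y) : Prop :=
  ∀ g : Y ⟶ X, catTrace (f ≫ g) = 0

theorem Negligible.eval_eq_zero {X Y : C} {f : X ⟶ Y} (hf : Negligible f) (W : C)
    (a : 𝟙_ C ⟶ X ⊗ W) (b : Y ⊗ W ⟶ 𝟙_ C) : a ≫ f ▷ W ≫ b = 0 := by
  obtain ⟨c, rfl⟩ : ∃ c : Xᘁ ⟶ W, a = η_ X Xᘁ ≫ X ◁ c := by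
    obtain ⟨d, rfl⟩ := (tensorLeftHomEquiv (𝟙_ C) X Xᘁ W).surjective a
    exact ⟨(ρ_ _).inv ≫ d, by simp [tensorLeftHomEquiv, ← unitors_equal]⟩
  let _ : ExactPairing Xᘁ X := BraidedCategory.exactPairing_swap X Xᘁ
  have hev : ε_ Xᘁ X = (β_ X Xᘁ).hom ≫ ε_ X Xᘁ := rfl
  obtain ⟨g, hg⟩ : ∃ g : Y ⟶ X, g ▷ Xᘁ ≫ ε_ Xᘁ X = Y ◁ c ≫ b := by
    obtain ⟨d, hd⟩ := (tensorRightHomEquiv Y Xᘁ X (𝟙_ C)).symm.surjective (Y ◁ c ≫ b)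
    exact ⟨d ≫ (λ_ X).hom, by rw [← hd]; simp [tensorRightHomEquiv, ← unitors_equal]⟩
  have h := hf g
  rw [catTrace, ← hev, comp_whiskerRight, Category.assoc, hg] at h
  rw [← h]
  simp only [Category.assoc, whisker_exchange_assoc]

theorem negligible_iff {X Y : C} (f : X ⟶ Y) :
    Negligible f ↔ ∀ (W : C) (a : 𝟙_ C ⟶ X ⊗ W) (b : Y ⊗ W ⟶ 𝟙_ C), a ≫ f ▷ W ≫ b = 0 := by
  refine ⟨fun hf => hf.eval_eq_zero, fun h g => ?_⟩
  have := h Xᘁ (η_ X Xᘁ) (g ▷ Xᘁ ≫ (β_ X Xᘁ).hom ≫ ε_ X Xᘁ)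
  simpa [catTrace] using this

theorem Negligible.comp_left {X Y Z : C} (h : X ⟶ Y) {f : Y ⟶ Z} (hf : Negligible f) :
    Negligible (h ≫ f) := by
  rw [negligible_iff] at hf ⊢
  intro W a b
  simpa using hf W (a ≫ h ▷ W) b

theorem Negligible.comp_right {X Y Z : C} {f : X ⟶ Y} (hf : Negligible f) (h : Y ⟶ Z) :
    Negligible (f ≫ h) := by
  rw [negligible_iff] at hf ⊢
  intro W a b
  simpa using hf W a (h ▷ W ≫ b)

theorem Negligible.whiskerRight {X Y : C} {f : X ⟶ Y} (hf : Negligible f) (Z : C) :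
    Negligible (f ▷ Z) := by
  rw [negligible_iff] at hf ⊢
  intro W a b
  simpa using hf (Z ⊗ W) (a ≫ (α_ _ _ _).hom) ((α_ _ _ _).inv ≫ b)

theorem Negligible.whiskerLeft {X Y : C} {f : X ⟶ Y} (hf : Negligible f) (Z : C) :
    Negligible (Z ◁ f) := by
  have h : Z ◁ f = (β_ Z X).hom ≫ f ▷ Z ≫ (β_ Y Z).hom := by simp
  rw [h]
  exact ((hf.whiskerRight Z).comp_right _).comp_left _

theorem Negligible.neg {X Y : C} {f : X ⟶ Y} (hf : Negligible f) : Negligible (-f) := by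
  have h : -f = f ≫ (-𝟙 Y) := by simp
  rw [h]
  exact hf.comp_right _

variable (C) in
/-- Two parallel morphisms are identified if their difference is negligible. -/
def negligibleRel : HomRel C := fun _ _ f g => Negligible (f - g)

variable (C) in
/-- The semisimplification of `C`: the objects of `C`, with the morphisms of `C` modulo the
negligible ones. -/
abbrev SemisimpleQuotient := CategoryTheory.Quotient (negligibleRel C)

namespace SemisimpleQuotient

/-- The semisimplification functor. -/
abbrev proj : C ⥤ SemisimpleQuotient C := CategoryTheory.Quotient.functor (negligibleRel C)

theorem sound {X Y : C} {f g : X ⟶ Y} (h : Negligible (f - g)) :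
    (proj (C := C)).map f = proj.map g := CategoryTheory.Quotient.sound _ h

end SemisimpleQuotient

variable [MonoidalPreadditive C]

theorem negligible_zero (X Y : C) : Negligible (0 : X ⟶ Y) := by
  intro g; simp [catTrace]

theorem Negligible.add {X Y : C} {f g : X ⟶ Y} (hf : Negligible f) (hg : Negligible g) :
    Negligible (f + g) := by
  intro h
  have h1 := hf h
  have h2 := hg h
  simp only [catTrace] at h1 h2 ⊢
  rw [Preadditive.add_comp, MonoidalPreadditive.add_whiskerRight, Preadditive.add_comp,
    Preadditive.comp_add, h1, h2, add_zero]

instance : Congruence (negligibleRel C) where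
  equivalence :=
    { refl := fun f => by
        rw [negligibleRel, sub_self]
        exact negligible_zero _ _
      symm := fun {f g} h => by
        have h' : Negligible (f - g) := h
        simpa [negligibleRel] using h'.neg
      trans := fun {f g l} h₁ h₂ => by
        have h' : Negligible ((f - g) + (g - l)) := Negligible.add h₁ h₂
        simpa [negligibleRel] using h' }
  comp_left := fun f g g' h => by
    have h' : Negligible (f ≫ (g - g')) := Negligible.comp_left f h
    simpa [negligibleRel] using h'
  comp_right := fun {_ _ _ f f'} g h => by
    have h' : Negligible ((f - f') ≫ g) := Negligible.comp_right h g
    simpa [negligibleRel] using h'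

namespace SemisimpleQuotient

instance : MonoidalCategoryStruct (SemisimpleQuotient C) where
  tensorObj X Y := ⟨X.as ⊗ Y.as⟩
  whiskerLeft X _ _ f := Quot.lift (fun f => proj.map (X.as ◁ f)) (fun f g h => by
    rw [HomRel.compClosure_iff_self] at h
    have h' := Negligible.whiskerLeft h X.as
    rw [show X.as ◁ (f - g) = X.as ◁ f - X.as ◁ g from (tensorLeft X.as).map_sub] at h'
    exact sound h') f
  whiskerRight f Y := Quot.lift (fun f => proj.map (f ▷ Y.as)) (fun f g h => by
    rw [HomRel.compClosure_iff_self] at h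
    have h' := Negligible.whiskerRight h Y.as
    rw [show (f - g) ▷ Y.as = f ▷ Y.as - g ▷ Y.as from (tensorRight Y.as).map_sub] at h'
    exact sound h') f
  tensorUnit := ⟨𝟙_ C⟩
  associator X Y Z := proj.mapIso (α_ X.as Y.as Z.as)
  leftUnitor X := proj.mapIso (λ_ X.as)
  rightUnitor X := proj.mapIso (ρ_ X.as)

instance : MonoidalCategory (SemisimpleQuotient C) where
  tensorHom_def _ _ := rfl
  id_tensorHom_id X Y := congr_arg proj.map
    (show 𝟙 X.as ▷ Y.as ≫ X.as ◁ 𝟙 Y.as = 𝟙 (X.as ⊗ Y.as) by simp)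
  tensorHom_comp_tensorHom := by
    rintro _ _ _ _ _ _ ⟨f₁⟩ ⟨f₂⟩ ⟨g₁⟩ ⟨g₂⟩
    exact congr_arg proj.map (by
      have h := tensorHom_comp_tensorHom f₁ f₂ g₁ g₂
      simp only [MonoidalCategory.tensorHom_def] at h
      exact h)
  whiskerLeft_id X Y := congr_arg proj.map (whiskerLeft_id X.as Y.as)
  id_whiskerRight X Y := congr_arg proj.map (id_whiskerRight X.as Y.as)
  associator_naturality := by
    rintro _ _ _ _ _ _ ⟨f₁⟩ ⟨f₂⟩ ⟨f₃⟩
    exact congr_arg proj.map (by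
      have h := associator_naturality f₁ f₂ f₃
      simp only [MonoidalCategory.tensorHom_def] at h
      exact h)
  leftUnitor_naturality := by
    rintro _ _ ⟨f⟩
    exact congr_arg proj.map (leftUnitor_naturality f)
  rightUnitor_naturality := by
    rintro _ _ ⟨f⟩
    exact congr_arg proj.map (rightUnitor_naturality f)
  pentagon W X Y Z := congr_arg proj.map (pentagon W.as X.as Y.as Z.as)
  triangle X Y := congr_arg proj.map (triangle X.as Y.as)

instance : SymmetricCategory (SemisimpleQuotient C) where
  braiding X Y := proj.mapIso (β_ X.as Y.as)
  braiding_naturality_right := by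
    rintro X _ _ ⟨f⟩
    exact congr_arg proj.map (BraidedCategory.braiding_naturality_right X.as f)
  braiding_naturality_left := by
    rintro _ _ ⟨f⟩ Z
    exact congr_arg proj.map (BraidedCategory.braiding_naturality_left f Z.as)
  hexagon_forward X Y Z :=
    congr_arg proj.map (BraidedCategory.hexagon_forward X.as Y.as Z.as)
  hexagon_reverse X Y Z :=
    congr_arg proj.map (BraidedCategory.hexagon_reverse X.as Y.as Z.as)
  symmetry X Y := congr_arg proj.map (SymmetricCategory.symmetry X.as Y.as)

/-- The semisimplification functor is strictly symmetric monoidal. -/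
instance : (proj (C := C)).Braided where
  toMonoidal := Functor.CoreMonoidal.toMonoidal
    { εIso := Iso.refl _
      μIso := fun _ _ => Iso.refl _
      μIso_hom_natural_left := fun f Z =>
        (Category.comp_id _).trans (Category.id_comp _).symm
      μIso_hom_natural_right := fun Z f =>
        (Category.comp_id _).trans (Category.id_comp _).symm
      associativity := fun X Y Z => by
        exact congr_arg proj.map (show (𝟙 (X ⊗ Y) ▷ Z) ≫ 𝟙 _ ≫ (α_ X Y Z).hom =
          (α_ X Y Z).hom ≫ X ◁ 𝟙 (Y ⊗ Z) ≫ 𝟙 _ by simp)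
      left_unitality := fun X =>
        congr_arg proj.map (show (λ_ X).hom = 𝟙 _ ▷ X ≫ 𝟙 _ ≫ (λ_ X).hom by simp)
      right_unitality := fun X =>
        congr_arg proj.map (show (ρ_ X).hom = X ◁ 𝟙 _ ≫ 𝟙 _ ≫ (ρ_ X).hom by simp) }
  braided X Y := congr_arg proj.map
    (show 𝟙 _ ≫ (β_ X Y).hom = (β_ X Y).hom ≫ 𝟙 _ by simp)

end SemisimpleQuotient

end Semisimplification

/-- A Lie superalgebra over a field of characteristic zero: a Lie algebra `even`, an
`even`-module `odd` and an equivariant symmetric bracket `odd × odd → even` satisfying the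
remaining Jacobi identity `[[x, x], x] = 0` for odd `x`. -/
structure LieSuperalgebra (k : Type u) [Field k] where
  even : Type u
  odd : Type u
  [lieRing : LieRing even]
  [lieAlgebra : LieAlgebra k even]
  [addCommGroup : AddCommGroup odd]
  [module : Module k odd]
  act : even →ₗ[k] odd →ₗ[k] odd
  bracket : odd →ₗ[k] odd →ₗ[k] even
  act_lie : ∀ a b x, act ⁅a, b⁆ x = act a (act b x) - act b (act a x)
  bracket_symm : ∀ x y, bracket x y = bracket y x
  bracket_equivariant : ∀ a x y, ⁅a, bracket x y⁆ = bracket (act a x) y + bracket x (act a y)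
  jacobi : ∀ x, act (bracket x x) x = 0

attribute [instance] LieSuperalgebra.lieRing LieSuperalgebra.lieAlgebra
  LieSuperalgebra.addCommGroup LieSuperalgebra.module

/-- The structure of a module over a Lie superalgebra `𝔤` on the superspace `V` whose parity
automorphism (`1` on the even part, `-1` on the odd part) is `ε`: a parity preserving linear map
`𝔤 → End V` taking the bracket of `𝔤` to the supercommutator. -/
@[ext]
structure LieSuperalgebra.Action {k : Type u} [Field k] (𝔤 : LieSuperalgebra k)
    (V : Type u) [AddCommGroup V] [Module k V] (ε : Module.End k V) where
  ev : 𝔤.even →ₗ[k] Module.End k V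
  od : 𝔤.odd →ₗ[k] Module.End k V
  ev_parity : ∀ a, ev a * ε = ε * ev a
  od_parity : ∀ x, od x * ε = -(ε * od x)
  ev_lie : ∀ a b, ev ⁅a, b⁆ = ev a * ev b - ev b * ev a
  od_act : ∀ a x, od (𝔤.act a x) = ev a * od x - od x * ev a
  ev_bracket : ∀ x y, ev (𝔤.bracket x y) = od x * od y + od y * od x

/-- The data of a supergroup (given as a Harish-Chandra pair) which enter the definition of its
representations: the Lie superalgebra, the group `G` of points of the underlying algebraic
group, embedded into an affine space by the coordinate functions `coord`, and the
identification `tangent` of the even part of the Lie superalgebra with the tangent space of `G`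
at `1`, as a subspace of that affine space. The inverse of `G` is given by polynomials. -/
structure HarishChandra (k : Type u) [Field k] extends LieSuperalgebra k where
  G : Type u
  [group : Group G]
  index : Type
  coord : G → index → k
  tangent : even →ₗ[k] index → k
  invPoly : index → MvPolynomial index k
  coord_inv : ∀ g i, coord g⁻¹ i = MvPolynomial.eval (coord g) (invPoly i)
  tangent_inv : ∀ a i, MvPolynomial.aeval
    (fun j => TrivSqZeroExt.inl (coord 1 j) + TrivSqZeroExt.inr (tangent a j) : index → DualNumber k)
      (invPoly i) = TrivSqZeroExt.inl (coord 1 i) - TrivSqZeroExt.inr (tangent a i)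

attribute [instance] HarishChandra.group

namespace HarishChandra

variable {k : Type u} [Field k]

/-- The point `1 + ε a` of the group over the dual numbers given by `a ∈ Lie G`. -/
def dualPoint (L : HarishChandra k) (a : L.even) : L.index → DualNumber k :=
  fun j => TrivSqZeroExt.inl (L.coord 1 j) + TrivSqZeroExt.inr (L.tangent a j)

/-- `L.IsRegular f d`: the function `f` on `G` is the restriction of a polynomial in the
coordinates, and its derivative at `1` in the direction `a ∈ Lie G` is `d a`. -/
def IsRegular (L : HarishChandra k) (f : L.G → k) (d : L.even → k) : Prop :=
  ∃ p : MvPolynomial L.index k, (∀ g, MvPolynomial.eval (L.coord g) p = f g) ∧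
    ∀ a, (MvPolynomial.aeval (L.dualPoint a) p).snd = d a

end HarishChandra

/-- Finite-dimensional representations of a supergroup in superspaces, as modules over the
Harish-Chandra pair `(𝔤, G)`: a finite-dimensional superspace `V` with parity automorphism
`parity`, a `𝔤`-module structure on it, and an algebraic action of `G` by even automorphisms
whose differential is the action of the even part of `𝔤`. -/
structure SRep {k : Type u} [Field k] (L : HarishChandra k) where
  V : Type u
  [addCommGroup : AddCommGroup V]
  [module : Module k V]
  [finite : FiniteDimensional k V]
  parity : Module.End k V
  parity_sq : parity * parity = 1
  action : L.Action V parity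
  ρ : L.G →* Module.End k V
  ρ_parity : ∀ g, ρ g * parity = parity * ρ g
  algebraic : ∀ (φ : Module.Dual k V) (v : V),
    L.IsRegular (fun g => φ (ρ g v)) (fun a => φ (action.ev a v))

attribute [instance] SRep.addCommGroup SRep.module SRep.finite

namespace SRep

variable {k : Type u} [Field k] {L : HarishChandra k}

/-- The even part of a representation. -/
def evenPart (M : SRep L) : Submodule k M.V := LinearMap.ker (M.parity - 1)

/-- The odd part of a representation. -/
def oddPart (M : SRep L) : Submodule k M.V := LinearMap.ker (M.parity + 1)

theorem isCompl_evenPart_oddPart [CharZero k] (M : SRep L) : IsCompl M.evenPart M.oddPart := by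
  have h2 : (2 : k) ≠ 0 := two_ne_zero
  have hp : ∀ v, M.parity (M.parity v) = v := fun v => LinearMap.congr_fun M.parity_sq v
  constructor
  · rw [Submodule.disjoint_def]
    intro v h₁ h₂
    have e₁ : M.parity v = v := by simpa [evenPart, sub_eq_zero] using h₁
    have e₂ : M.parity v + v = 0 := by simpa [oddPart] using h₂
    have e₃ : (2 : k) • v = 0 := by rw [two_smul]; nth_rewrite 1 [← e₁]; exact e₂
    exact (smul_eq_zero.1 e₃).resolve_left h2
  · rw [codisjoint_iff, eq_top_iff]
    intro v _
    have : v = (2⁻¹ : k) • (v + M.parity v) + (2⁻¹ : k) • (v - M.parity v) := by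
      rw [← smul_add]
      have : v + M.parity v + (v - M.parity v) = (2 : k) • v := by module
      rw [this, smul_smul, inv_mul_cancel₀ h2, one_smul]
    rw [this]
    refine Submodule.add_mem_sup ?_ ?_
    · simp [evenPart, hp, add_comm]
    · simp [oddPart, hp]

/-- Morphisms are the even equivariant maps. -/
@[ext]
structure Hom (M N : SRep L) where
  toLin : M.V →ₗ[k] N.V
  parity : ∀ v, toLin (M.parity v) = N.parity (toLin v)
  ev : ∀ a v, toLin (M.action.ev a v) = N.action.ev a (toLin v)
  od : ∀ x v, toLin (M.action.od x v) = N.action.od x (toLin v)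
  ρ : ∀ g v, toLin (M.ρ g v) = N.ρ g (toLin v)

instance : Category (SRep L) where
  Hom := Hom
  id M := ⟨LinearMap.id, fun _ => rfl, fun _ _ => rfl, fun _ _ => rfl, fun _ _ => rfl⟩
  comp f g := ⟨g.toLin ∘ₗ f.toLin, fun v => by simp [f.parity, g.parity],
    fun a v => by simp [f.ev, g.ev], fun a v => by simp [f.od, g.od],
    fun a v => by simp [f.ρ, g.ρ]⟩

/-- The linear map underlying a morphism. -/
def lin {M N : SRep L} (f : M ⟶ N) : M.V →ₗ[k] N.V := Hom.toLin f

@[ext]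
theorem hom_ext {M N : SRep L} {f g : M ⟶ N} (h : lin f = lin g) : f = g := Hom.ext h

@[simp] theorem lin_id (M : SRep L) : lin (𝟙 M) = LinearMap.id := rfl

@[simp] theorem lin_comp {M N P : SRep L} (f : M ⟶ N) (g : N ⟶ P) :
    lin (f ≫ g) = lin g ∘ₗ lin f := rfl

theorem lin_injective {M N : SRep L} : Function.Injective (lin : (M ⟶ N) → _) :=
  fun _ _ => hom_ext

variable {M N : SRep L}

instance : Zero (M ⟶ N) := ⟨(⟨0, by simp, by simp, by simp, by simp⟩ : Hom M N)⟩
instance : Add (M ⟶ N) := ⟨fun f g => (⟨lin f + lin g,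
  by simp [lin, Hom.parity], by simp [lin, Hom.ev], by simp [lin, Hom.od],
  by simp [lin, Hom.ρ]⟩ : Hom M N)⟩
instance : SMul k (M ⟶ N) := ⟨fun c f => (⟨c • lin f,
  by simp [lin, Hom.parity], by simp [lin, Hom.ev], by simp [lin, Hom.od],
  by simp [lin, Hom.ρ]⟩ : Hom M N)⟩
instance : Neg (M ⟶ N) := ⟨fun f => (⟨-lin f,
  by simp [lin, Hom.parity], by simp [lin, Hom.ev], by simp [lin, Hom.od],
  by simp [lin, Hom.ρ]⟩ : Hom M N)⟩
instance : Sub (M ⟶ N) := ⟨fun f g => (⟨lin f - lin g,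
  by simp [lin, Hom.parity], by simp [lin, Hom.ev], by simp [lin, Hom.od],
  by simp [lin, Hom.ρ]⟩ : Hom M N)⟩
instance : SMul ℕ (M ⟶ N) := ⟨fun n f => (⟨n • lin f,
  by simp [lin, Hom.parity], by simp [lin, Hom.ev], by simp [lin, Hom.od],
  by simp [lin, Hom.ρ]⟩ : Hom M N)⟩
instance : SMul ℤ (M ⟶ N) := ⟨fun n f => (⟨n • lin f,
  by simp [lin, Hom.parity], by simp [lin, Hom.ev], by simp [lin, Hom.od],
  by simp [lin, Hom.ρ]⟩ : Hom M N)⟩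

@[simp] theorem lin_zero : lin (0 : M ⟶ N) = 0 := rfl
@[simp] theorem lin_add (f g : M ⟶ N) : lin (f + g) = lin f + lin g := rfl
@[simp] theorem lin_smul (c : k) (f : M ⟶ N) : lin (c • f) = c • lin f := rfl

instance : AddCommGroup (M ⟶ N) :=
  lin_injective.addCommGroup lin rfl (fun _ _ => rfl) (fun _ => rfl) (fun _ _ => rfl)
    (fun _ _ => rfl) (fun _ _ => rfl)

/-- Taking the underlying linear map is additive. -/
def linHom (M N : SRep L) : (M ⟶ N) →+ (M.V →ₗ[k] N.V) where
  toFun := lin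
  map_zero' := rfl
  map_add' _ _ := rfl

instance : Module k (M ⟶ N) :=
  lin_injective.module k (linHom M N) (fun _ _ => rfl)

instance : Preadditive (SRep L) where
  add_comp _ _ _ _ _ _ := by ext1; simp [LinearMap.comp_add]
  comp_add _ _ _ _ _ _ := by ext1; simp [LinearMap.add_comp]

instance : Linear k (SRep L) where
  smul_comp _ _ _ _ _ _ := by ext1; simp [LinearMap.comp_smul]
  comp_smul _ _ _ _ _ _ := by ext1; simp [LinearMap.smul_comp]

/-- An equivariant even linear equivalence is an isomorphism. -/
def mkIso (e : M.V ≃ₗ[k] N.V) (h₁ : ∀ v, e (M.parity v) = N.parity (e v))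
    (h₂ : ∀ a v, e (M.action.ev a v) = N.action.ev a (e v))
    (h₃ : ∀ x v, e (M.action.od x v) = N.action.od x (e v))
    (h₄ : ∀ g v, e (M.ρ g v) = N.ρ g (e v)) : M ≅ N where
  hom := (⟨e.toLinearMap, h₁, h₂, h₃, h₄⟩ : Hom M N)
  inv := (⟨e.symm.toLinearMap,
    fun v => e.injective (by simp [h₁]), fun a v => e.injective (by simp [h₂]),
    fun x v => e.injective (by simp [h₃]), fun g v => e.injective (by simp [h₄])⟩ : Hom N M)
  hom_inv_id := by ext v; exact e.symm_apply_apply v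
  inv_hom_id := by ext v; exact e.apply_symm_apply v

end SRep

namespace HarishChandra.IsRegular

variable {k : Type u} [Field k] {L : HarishChandra k}

theorem zero : L.IsRegular (fun _ => 0) (fun _ => 0) := ⟨0, by simp, by simp⟩

theorem const (c : k) : L.IsRegular (fun _ => c) (fun _ => 0) :=
  ⟨MvPolynomial.C c, by simp, fun a => by
    rw [MvPolynomial.aeval_C]; rfl⟩

theorem add {f f' : L.G → k} {d d' : L.even → k} (h : L.IsRegular f d)
    (h' : L.IsRegular f' d') :
    L.IsRegular (fun g => f g + f' g) (fun a => d a + d' a) := by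
  obtain ⟨p, hp, hp'⟩ := h
  obtain ⟨q, hq, hq'⟩ := h'
  exact ⟨p + q, by simp [hp, hq], by simp [hp', hq']⟩

theorem fst_aeval (a : L.even) (p : MvPolynomial L.index k) :
    (MvPolynomial.aeval (L.dualPoint a) p).fst = MvPolynomial.eval (L.coord 1) p := by
  induction p using MvPolynomial.induction_on with
  | C c => rw [MvPolynomial.aeval_C, MvPolynomial.eval_C]; rfl
  | add p q hp hq => simp [hp, hq]
  | mul_X p i hp => simp [hp, dualPoint]

theorem mul {f f' : L.G → k} {d d' : L.even → k} (h : L.IsRegular f d)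
    (h' : L.IsRegular f' d') :
    L.IsRegular (fun g => f g * f' g) (fun a => d a * f' 1 + f 1 * d' a) := by
  obtain ⟨p, hp, hp'⟩ := h
  obtain ⟨q, hq, hq'⟩ := h'
  refine ⟨p * q, by simp [hp, hq], fun a => ?_⟩
  rw [map_mul, TrivSqZeroExt.snd_mul, fst_aeval, fst_aeval, hp, hq, hp', hq']
  simp [mul_comm, add_comm]

theorem inv {f : L.G → k} {d : L.even → k} (h : L.IsRegular f d) :
    L.IsRegular (fun g => f g⁻¹) (fun a => - d a) := by
  obtain ⟨p, hp, hp'⟩ := h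
  refine ⟨MvPolynomial.bind₁ L.invPoly p, fun g => ?_, fun a => ?_⟩
  · change _ = f g⁻¹
    rw [← hp, ← MvPolynomial.coe_aeval_eq_eval, ← MvPolynomial.coe_aeval_eq_eval]
    simp only [RingHom.coe_coe, MvPolynomial.aeval_bind₁]
    congr 2
    funext i
    rw [L.coord_inv, ← MvPolynomial.coe_aeval_eq_eval]
    rfl
  · rw [MvPolynomial.aeval_bind₁]
    have h1 : (fun i => MvPolynomial.aeval (L.dualPoint a) (L.invPoly i)) = L.dualPoint (-a) := by
      funext i
      refine (L.tangent_inv a i).trans ?_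
      simp [dualPoint, sub_eq_add_neg]
    rw [h1, hp']
    have hd : ∀ b, d b = (MvPolynomial.aeval (L.dualPoint b) p).snd := fun b => (hp' b).symm
    clear hp hp'
    simp only [hd]
    clear h1 hd
    induction p using MvPolynomial.induction_on with
    | C c => rw [MvPolynomial.aeval_C, MvPolynomial.aeval_C]; simp [TrivSqZeroExt.algebraMap_eq_inl]
    | add p q hp hq => simp [hp, hq, add_comm]
    | mul_X p i hp =>
      simp only [map_mul, MvPolynomial.aeval_X, TrivSqZeroExt.snd_mul, fst_aeval, hp]
      simp [dualPoint, add_comm]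

end HarishChandra.IsRegular

namespace SRep

variable {k : Type u} [Field k] {L : HarishChandra k}

theorem parity_parity (M : SRep L) (v : M.V) : M.parity (M.parity v) = v :=
  LinearMap.congr_fun M.parity_sq v

theorem ev_parity_apply (M : SRep L) (a : L.even) (v : M.V) :
    M.action.ev a (M.parity v) = M.parity (M.action.ev a v) :=
  LinearMap.congr_fun (M.action.ev_parity a) v

theorem od_parity_apply (M : SRep L) (x : L.odd) (v : M.V) :
    M.action.od x (M.parity v) = -M.parity (M.action.od x v) :=
  LinearMap.congr_fun (M.action.od_parity x) v

theorem ρ_parity_apply (M : SRep L) (g : L.G) (v : M.V) :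
    M.ρ g (M.parity v) = M.parity (M.ρ g v) :=
  LinearMap.congr_fun (M.ρ_parity g) v

theorem ev_lie_apply (M : SRep L) (a b : L.even) (v : M.V) :
    M.action.ev ⁅a, b⁆ v =
      M.action.ev a (M.action.ev b v) - M.action.ev b (M.action.ev a v) :=
  LinearMap.congr_fun (M.action.ev_lie a b) v

theorem od_act_apply (M : SRep L) (a : L.even) (x : L.odd) (v : M.V) :
    M.action.od (L.act a x) v =
      M.action.ev a (M.action.od x v) - M.action.od x (M.action.ev a v) :=
  LinearMap.congr_fun (M.action.od_act a x) v

theorem ev_bracket_apply (M : SRep L) (x y : L.odd) (v : M.V) :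
    M.action.ev (L.bracket x y) v =
      M.action.od x (M.action.od y v) + M.action.od y (M.action.od x v) :=
  LinearMap.congr_fun (M.action.ev_bracket x y) v

/-- The tensor product: `a ∈ 𝔤` acts by `a (v ⊗ w) = a v ⊗ w + (-1)^(|a| |v|) v ⊗ a w` and `G` acts
diagonally. -/
@[simps]
def tensorAction (M N : SRep L) :
    L.Action (M.V ⊗[k] N.V) (TensorProduct.map M.parity N.parity) where
  ev :=
    { toFun := fun a => TensorProduct.map (M.action.ev a) LinearMap.id +
        TensorProduct.map LinearMap.id (N.action.ev a)
      map_add' := fun a b => by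
        simp only [map_add, TensorProduct.map_add_left, TensorProduct.map_add_right]; abel
      map_smul' := fun c a => by
        simp only [map_smul, TensorProduct.map_smul_left, TensorProduct.map_smul_right,
          RingHom.id_apply, smul_add] }
  od :=
    { toFun := fun x => TensorProduct.map (M.action.od x) LinearMap.id +
        TensorProduct.map M.parity (N.action.od x)
      map_add' := fun a b => by
        simp only [map_add, TensorProduct.map_add_left, TensorProduct.map_add_right]; abel
      map_smul' := fun c a => by
        simp only [map_smul, TensorProduct.map_smul_left, TensorProduct.map_smul_right,
          RingHom.id_apply, smul_add] }
  ev_parity a := TensorProduct.ext' fun v w => by simp [ev_parity_apply]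
  od_parity x := TensorProduct.ext' fun v w => by
    simp [od_parity_apply, TensorProduct.neg_tmul, TensorProduct.tmul_neg, add_comm]
  ev_lie a b := TensorProduct.ext' fun v w => by
    simp [ev_lie_apply, TensorProduct.sub_tmul, TensorProduct.tmul_sub]; abel
  od_act a x := TensorProduct.ext' fun v w => by
    simp [od_act_apply, ev_parity_apply, TensorProduct.sub_tmul, TensorProduct.tmul_sub]; abel
  ev_bracket x y := TensorProduct.ext' fun v w => by
    simp [ev_bracket_apply, od_parity_apply, parity_parity, TensorProduct.add_tmul,
      TensorProduct.tmul_add, TensorProduct.neg_tmul]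
    abel

/-- The tensor product of representations. -/
abbrev tensor (M N : SRep L) : SRep L where
  V := M.V ⊗[k] N.V
  parity := TensorProduct.map M.parity N.parity
  parity_sq := TensorProduct.ext' fun v w => by simp [parity_parity]
  action := tensorAction M N
  ρ :=
    { toFun := fun g => TensorProduct.map (M.ρ g) (N.ρ g)
      map_one' := by simp [Module.End.one_eq_id]
      map_mul' := fun g h => by simp [Module.End.mul_eq_comp, TensorProduct.map_comp] }
  ρ_parity g := TensorProduct.ext' fun v w => by simp [ρ_parity_apply]
  algebraic φ v := by
    obtain ⟨ψ, rfl⟩ := (TensorProduct.dualDistribEquiv k M.V N.V).surjective φ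
    induction ψ using TensorProduct.induction_on with
    | zero => simpa using HarishChandra.IsRegular.zero
    | add ψ ψ' h h' => simpa using h.add h'
    | tmul φ ψ =>
      induction v using TensorProduct.induction_on with
      | zero => simpa using HarishChandra.IsRegular.zero
      | add v v' h h' => simpa only [map_add] using h.add h'
      | tmul v w =>
        have h := (M.algebraic φ v).mul (N.algebraic ψ w)
        simpa [TensorProduct.dualDistribEquiv, TensorProduct.dualDistribEquivOfBasis] using h

/-- The trivial representation on the superspace `k` of dimension `(1|0)`. -/
abbrev triv (L : HarishChandra k) : SRep L where
  V := k
  parity := 1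
  parity_sq := by simp
  action :=
    { ev := 0
      od := 0
      ev_parity := by simp
      od_parity := by simp
      ev_lie := by simp
      od_act := by simp
      ev_bracket := by simp }
  ρ := 1
  ρ_parity := by simp
  algebraic φ v := by simpa using HarishChandra.IsRegular.const (φ v)

/-- The action on the dual: `(a φ) (v) = -(-1)^(|a| |φ|) φ (a v)`. -/
@[simps]
def dualAction (M : SRep L) : L.Action (Module.Dual k M.V) (Module.Dual.transpose M.parity) where
  ev :=
    { toFun := fun a => -Module.Dual.transpose (M.action.ev a)
      map_add' := fun a b => by ext φ v; simp [Module.Dual.transpose_apply]; abel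
      map_smul' := fun c a => by ext φ v; simp [Module.Dual.transpose_apply] }
  od :=
    { toFun := fun x => -Module.Dual.transpose (M.parity * M.action.od x)
      map_add' := fun a b => by ext φ v; simp [Module.Dual.transpose_apply]; abel
      map_smul' := fun c a => by ext φ v; simp [Module.Dual.transpose_apply] }
  ev_parity a := by ext φ v; simp [Module.Dual.transpose_apply, ev_parity_apply]
  od_parity x := by ext φ v; simp [Module.Dual.transpose_apply, od_parity_apply]
  ev_lie a b := by ext φ v; simp [Module.Dual.transpose_apply, ev_lie_apply]
  od_act a x := by ext φ v; simp [Module.Dual.transpose_apply, od_act_apply, ev_parity_apply]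
  ev_bracket x y := by
    ext φ v
    simp [Module.Dual.transpose_apply, ev_bracket_apply, od_parity_apply, parity_parity]

/-- The dual representation, with `(g φ) (v) = φ (g⁻¹ v)`. -/
abbrev dual (M : SRep L) : SRep L where
  V := Module.Dual k M.V
  parity := Module.Dual.transpose M.parity
  parity_sq := by ext φ v; simp [Module.Dual.transpose_apply, parity_parity]
  action := dualAction M
  ρ :=
    { toFun := fun g => Module.Dual.transpose (M.ρ g⁻¹)
      map_one' := by ext φ v; simp [Module.Dual.transpose_apply]
      map_mul' := fun g h => by ext φ v; simp [Module.Dual.transpose_apply] }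
  ρ_parity g := by ext φ v; simp [Module.Dual.transpose_apply, ρ_parity_apply]
  algebraic Φ φ := by
    obtain ⟨v, rfl⟩ := (Module.evalEquiv k M.V).surjective Φ
    have h := (M.algebraic φ v).inv
    convert h using 1
    · rfl
    · rfl

end SRep

namespace SRep

variable {k : Type u} [Field k] {L : HarishChandra k}

@[simps tensorObj tensorUnit]
instance : MonoidalCategoryStruct (SRep L) where
  tensorObj := tensor
  whiskerLeft X Y Z f := (⟨(lin f).lTensor X.V,
    fun v => LinearMap.congr_fun (f := (lin f).lTensor X.V ∘ₗ (tensor X Y).parity)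
      (g := (tensor X Z).parity ∘ₗ (lin f).lTensor X.V)
      (TensorProduct.ext' fun v w => by simp [lin, f.parity]) v,
    fun a v => LinearMap.congr_fun (f := (lin f).lTensor X.V ∘ₗ (tensor X Y).action.ev a)
      (g := (tensor X Z).action.ev a ∘ₗ (lin f).lTensor X.V)
      (TensorProduct.ext' fun v w => by simp [lin, f.ev]) v,
    fun a v => LinearMap.congr_fun (f := (lin f).lTensor X.V ∘ₗ (tensor X Y).action.od a)
      (g := (tensor X Z).action.od a ∘ₗ (lin f).lTensor X.V)
      (TensorProduct.ext' fun v w => by simp [lin, f.od]) v,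
    fun a v => LinearMap.congr_fun (f := (lin f).lTensor X.V ∘ₗ (tensor X Y).ρ a)
      (g := (tensor X Z).ρ a ∘ₗ (lin f).lTensor X.V)
      (TensorProduct.ext' fun v w => by simp [lin, f.ρ]) v⟩ :
      Hom (tensor X Y) (tensor X Z))
  whiskerRight {Y Z} f X := (⟨(lin f).rTensor X.V,
    fun v => LinearMap.congr_fun (f := (lin f).rTensor X.V ∘ₗ (tensor Y X).parity)
      (g := (tensor Z X).parity ∘ₗ (lin f).rTensor X.V)
      (TensorProduct.ext' fun v w => by simp [lin, f.parity]) v,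
    fun a v => LinearMap.congr_fun (f := (lin f).rTensor X.V ∘ₗ (tensor Y X).action.ev a)
      (g := (tensor Z X).action.ev a ∘ₗ (lin f).rTensor X.V)
      (TensorProduct.ext' fun v w => by simp [lin, f.ev]) v,
    fun a v => LinearMap.congr_fun (f := (lin f).rTensor X.V ∘ₗ (tensor Y X).action.od a)
      (g := (tensor Z X).action.od a ∘ₗ (lin f).rTensor X.V)
      (TensorProduct.ext' fun v w => by simp [lin, f.od, f.parity]) v,
    fun a v => LinearMap.congr_fun (f := (lin f).rTensor X.V ∘ₗ (tensor Y X).ρ a)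
      (g := (tensor Z X).ρ a ∘ₗ (lin f).rTensor X.V)
      (TensorProduct.ext' fun v w => by simp [lin, f.ρ]) v⟩ :
      Hom (tensor Y X) (tensor Z X))
  tensorUnit := triv L
  associator X Y Z := mkIso (M := tensor (tensor X Y) Z) (N := tensor X (tensor Y Z))
    (TensorProduct.assoc k X.V Y.V Z.V)
    (fun v => LinearMap.congr_fun
      (f := (TensorProduct.assoc k X.V Y.V Z.V).toLinearMap ∘ₗ (tensor (tensor X Y) Z).parity)
      (g := (tensor X (tensor Y Z)).parity ∘ₗ (TensorProduct.assoc k X.V Y.V Z.V).toLinearMap)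
      (TensorProduct.ext_threefold fun u v w => by simp) v)
    (fun a v => LinearMap.congr_fun
      (f := (TensorProduct.assoc k X.V Y.V Z.V).toLinearMap ∘ₗ (tensor (tensor X Y) Z).action.ev a)
      (g := (tensor X (tensor Y Z)).action.ev a ∘ₗ (TensorProduct.assoc k X.V Y.V Z.V).toLinearMap)
      (TensorProduct.ext_threefold fun u v w => by
        change TensorProduct.assoc k X.V Y.V Z.V
          ((X.action.ev a u ⊗ₜ[k] v + u ⊗ₜ[k] Y.action.ev a v) ⊗ₜ[k] w +
            (u ⊗ₜ[k] v) ⊗ₜ[k] Z.action.ev a w) =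
          X.action.ev a u ⊗ₜ[k] (v ⊗ₜ[k] w) +
            u ⊗ₜ[k] (Y.action.ev a v ⊗ₜ[k] w + v ⊗ₜ[k] Z.action.ev a w)
        simp [TensorProduct.add_tmul, TensorProduct.tmul_add, add_assoc]) v)
    (fun a v => LinearMap.congr_fun
      (f := (TensorProduct.assoc k X.V Y.V Z.V).toLinearMap ∘ₗ (tensor (tensor X Y) Z).action.od a)
      (g := (tensor X (tensor Y Z)).action.od a ∘ₗ (TensorProduct.assoc k X.V Y.V Z.V).toLinearMap)
      (TensorProduct.ext_threefold fun u v w => by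
        change TensorProduct.assoc k X.V Y.V Z.V
          ((X.action.od a u ⊗ₜ[k] v + X.parity u ⊗ₜ[k] Y.action.od a v) ⊗ₜ[k] w +
            (X.parity u ⊗ₜ[k] Y.parity v) ⊗ₜ[k] Z.action.od a w) =
          X.action.od a u ⊗ₜ[k] (v ⊗ₜ[k] w) +
            X.parity u ⊗ₜ[k] (Y.action.od a v ⊗ₜ[k] w + Y.parity v ⊗ₜ[k] Z.action.od a w)
        simp [TensorProduct.add_tmul, TensorProduct.tmul_add, add_assoc]) v)
    (fun a v => LinearMap.congr_fun
      (f := (TensorProduct.assoc k X.V Y.V Z.V).toLinearMap ∘ₗ (tensor (tensor X Y) Z).ρ a)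
      (g := (tensor X (tensor Y Z)).ρ a ∘ₗ (TensorProduct.assoc k X.V Y.V Z.V).toLinearMap)
      (TensorProduct.ext_threefold fun u v w => by simp) v)
  leftUnitor X := mkIso (M := tensor (triv L) X) (N := X) (TensorProduct.lid k X.V)
    (fun v => LinearMap.congr_fun
      (f := (TensorProduct.lid k X.V).toLinearMap ∘ₗ (tensor (triv L) X).parity)
      (g := X.parity ∘ₗ (TensorProduct.lid k X.V).toLinearMap)
      (TensorProduct.ext' fun u v => by simp) v)
    (fun a v => LinearMap.congr_fun
      (f := (TensorProduct.lid k X.V).toLinearMap ∘ₗ (tensor (triv L) X).action.ev a)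
      (g := X.action.ev a ∘ₗ (TensorProduct.lid k X.V).toLinearMap)
      (TensorProduct.ext' fun u v => by
        change TensorProduct.lid k X.V
          ((0 : k) ⊗ₜ[k] v + u ⊗ₜ[k] X.action.ev a v) = X.action.ev a (u • v)
        simp [TensorProduct.lid_tmul]) v)
    (fun a v => LinearMap.congr_fun
      (f := (TensorProduct.lid k X.V).toLinearMap ∘ₗ (tensor (triv L) X).action.od a)
      (g := X.action.od a ∘ₗ (TensorProduct.lid k X.V).toLinearMap)
      (TensorProduct.ext' fun u v => by
        change TensorProduct.lid k X.V
          ((0 : k) ⊗ₜ[k] v + u ⊗ₜ[k] X.action.od a v) = X.action.od a (u • v)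
        simp [TensorProduct.lid_tmul]) v)
    (fun a v => LinearMap.congr_fun
      (f := (TensorProduct.lid k X.V).toLinearMap ∘ₗ (tensor (triv L) X).ρ a)
      (g := X.ρ a ∘ₗ (TensorProduct.lid k X.V).toLinearMap)
      (TensorProduct.ext' fun u v => by simp) v)
  rightUnitor X := mkIso (M := tensor X (triv L)) (N := X) (TensorProduct.rid k X.V)
    (fun v => LinearMap.congr_fun
      (f := (TensorProduct.rid k X.V).toLinearMap ∘ₗ (tensor X (triv L)).parity)
      (g := X.parity ∘ₗ (TensorProduct.rid k X.V).toLinearMap)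
      (TensorProduct.ext' fun u v => by simp) v)
    (fun a v => LinearMap.congr_fun
      (f := (TensorProduct.rid k X.V).toLinearMap ∘ₗ (tensor X (triv L)).action.ev a)
      (g := X.action.ev a ∘ₗ (TensorProduct.rid k X.V).toLinearMap)
      (TensorProduct.ext' fun u v => by
        change TensorProduct.rid k X.V
          (X.action.ev a u ⊗ₜ[k] v + u ⊗ₜ[k] (0 : k)) = X.action.ev a (v • u)
        simp [TensorProduct.rid_tmul]) v)
    (fun a v => LinearMap.congr_fun
      (f := (TensorProduct.rid k X.V).toLinearMap ∘ₗ (tensor X (triv L)).action.od a)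
      (g := X.action.od a ∘ₗ (TensorProduct.rid k X.V).toLinearMap)
      (TensorProduct.ext' fun u v => by
        change TensorProduct.rid k X.V
          (X.action.od a u ⊗ₜ[k] v + X.parity u ⊗ₜ[k] (0 : k)) = X.action.od a (v • u)
        simp [TensorProduct.rid_tmul]) v)
    (fun a v => LinearMap.congr_fun
      (f := (TensorProduct.rid k X.V).toLinearMap ∘ₗ (tensor X (triv L)).ρ a)
      (g := X.ρ a ∘ₗ (TensorProduct.rid k X.V).toLinearMap)
      (TensorProduct.ext' fun u v => by simp) v)

theorem lin_whiskerLeft (X : SRep L) {Y Z : SRep L} (f : Y ⟶ Z) :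
    lin (X ◁ f) = (lin f).lTensor X.V := rfl

theorem lin_whiskerRight {Y Z : SRep L} (f : Y ⟶ Z) (X : SRep L) :
    lin (f ▷ X) = (lin f).rTensor X.V := rfl

instance : MonoidalCategory (SRep L) where
  tensorHom_def _ _ := rfl
  id_tensorHom_id _ _ := hom_ext (TensorProduct.ext' fun _ _ => rfl)
  tensorHom_comp_tensorHom _ _ _ _ := hom_ext (TensorProduct.ext' fun _ _ => rfl)
  whiskerLeft_id _ _ := hom_ext (TensorProduct.ext' fun _ _ => rfl)
  id_whiskerRight _ _ := hom_ext (TensorProduct.ext' fun _ _ => rfl)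
  associator_naturality _ _ _ := hom_ext (TensorProduct.ext_threefold fun _ _ _ => rfl)
  leftUnitor_naturality f := hom_ext (TensorProduct.ext' fun (c : k) v =>
    ((lin f).map_smul c v).symm)
  rightUnitor_naturality f := hom_ext (TensorProduct.ext' fun v (c : k) =>
    ((lin f).map_smul c v).symm)
  pentagon _ _ _ _ := hom_ext (TensorProduct.ext_fourfold fun _ _ _ _ => rfl)
  triangle _ _ := hom_ext (TensorProduct.ext_threefold fun v (c : k) w =>
    (TensorProduct.smul_tmul c v w).symm)

instance : MonoidalPreadditive (SRep L) where
  whiskerLeft_zero := hom_ext (LinearMap.lTensor_zero _)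
  zero_whiskerRight := hom_ext (LinearMap.rTensor_zero _)
  whiskerLeft_add f g := hom_ext (LinearMap.lTensor_add _ (lin f) (lin g))
  add_whiskerRight f g := hom_ext (LinearMap.rTensor_add _ (lin f) (lin g))

instance : MonoidalLinear k (SRep L) where
  whiskerLeft_smul X _ _ c f := hom_ext (LinearMap.lTensor_smul X.V c (lin f))
  smul_whiskerRight c _ _ f X := hom_ext (LinearMap.rTensor_smul X.V c (lin f))

/-- The braiding `v ⊗ w ↦ (-1)^(|v| |w|) w ⊗ v`, where the sign is expressed through the parity
automorphisms. -/
def braidLin (M N : SRep L) : M.V ⊗[k] N.V →ₗ[k] N.V ⊗[k] M.V :=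
  (TensorProduct.comm k M.V N.V).toLinearMap ∘ₗ ((2⁻¹ : k) •
    (TensorProduct.map LinearMap.id LinearMap.id + TensorProduct.map M.parity LinearMap.id +
      TensorProduct.map LinearMap.id N.parity - TensorProduct.map M.parity N.parity))

theorem braidLin_tmul (M N : SRep L) (v : M.V) (w : N.V) :
    braidLin M N (v ⊗ₜ w) = (2⁻¹ : k) • (w ⊗ₜ[k] v + w ⊗ₜ[k] M.parity v + N.parity w ⊗ₜ[k] v -
      N.parity w ⊗ₜ[k] M.parity v) := by
  simp [braidLin]

theorem ext_threefold' {U V W P : Type u} [AddCommGroup U] [Module k U] [AddCommGroup V]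
    [Module k V] [AddCommGroup W] [Module k W] [AddCommGroup P] [Module k P]
    {f g : U ⊗[k] (V ⊗[k] W) →ₗ[k] P}
    (h : ∀ u v w, f (u ⊗ₜ (v ⊗ₜ w)) = g (u ⊗ₜ (v ⊗ₜ w))) : f = g := by
  refine TensorProduct.ext' fun u t => ?_
  induction t using TensorProduct.induction_on with
  | zero => simp
  | add t t' ht ht' => rw [TensorProduct.tmul_add, map_add, map_add, ht, ht']
  | tmul v w => exact h u v w

theorem dualTensorHom_injective (M : SRep L) :
    Function.Injective (dualTensorHom k M.V M.V ∘ₗ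
      (TensorProduct.comm k M.V (Module.Dual k M.V)).toLinearMap) :=
  (dualTensorHomEquiv k M.V M.V).injective.comp (TensorProduct.comm k _ _).injective

theorem coevaluation_one (M : SRep L) :
    (dualTensorHom k M.V M.V ∘ₗ (TensorProduct.comm k M.V (Module.Dual k M.V)).toLinearMap)
      (coevaluation k M.V 1) = 1 := by
  rw [coevaluation_apply_one]
  ext v
  simpa using (Module.Basis.ofVectorSpace k M.V).sum_repr v

theorem map_coevaluation (M : SRep L) (A : Module.End k M.V)
    (B : Module.End k (Module.Dual k M.V)) (B' : Module.End k M.V)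
    (hB : B = Module.Dual.transpose B') (t : M.V ⊗[k] Module.Dual k M.V) :
    (dualTensorHom k M.V M.V ∘ₗ (TensorProduct.comm k M.V (Module.Dual k M.V)).toLinearMap)
      (TensorProduct.map A B t) = A * (dualTensorHom k M.V M.V ∘ₗ
        (TensorProduct.comm k M.V (Module.Dual k M.V)).toLinearMap) t * B' := by
  subst hB
  induction t using TensorProduct.induction_on with
  | zero => simp
  | add t t' ht ht' => rw [map_add, map_add, map_add, ht, ht', mul_add, add_mul]
  | tmul v φ => ext w; simp [Module.Dual.transpose_apply]

theorem eq_smul_coevaluation (M : SRep L) (c : k) : coevaluation k M.V c =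
    c • coevaluation k M.V 1 := by rw [← map_smul, smul_eq_mul, mul_one]

theorem coev_parity (M : SRep L) (c : k) : coevaluation k M.V c =
    (tensor M M.dual).parity (coevaluation k M.V c) := by
  rw [eq_smul_coevaluation, map_smul]
  congr 1
  apply M.dualTensorHom_injective
  rw [M.map_coevaluation M.parity _ M.parity rfl, coevaluation_one, mul_one, parity_sq]

theorem coev_ev (M : SRep L) (a : L.even) (c : k) : coevaluation k M.V ((0 : k →ₗ[k] k) c) =
    (tensor M M.dual).action.ev a (coevaluation k M.V c) := by
  rw [eq_smul_coevaluation, eq_smul_coevaluation M c, map_smul, LinearMap.zero_apply, zero_smul]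
  refine (smul_eq_zero_of_right c ?_).symm
  apply M.dualTensorHom_injective
  refine (map_add _ _ _).trans ?_
  rw [M.map_coevaluation _ _ 1 (by ext; rfl), M.map_coevaluation _ _ (-M.action.ev a)
    (by ext; simp [Module.Dual.transpose_apply]), coevaluation_one]
  ext v
  simp

theorem coev_od (M : SRep L) (x : L.odd) (c : k) : coevaluation k M.V ((0 : k →ₗ[k] k) c) =
    (tensor M M.dual).action.od x (coevaluation k M.V c) := by
  rw [eq_smul_coevaluation, eq_smul_coevaluation M c, map_smul, LinearMap.zero_apply, zero_smul]
  refine (smul_eq_zero_of_right c ?_).symm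
  apply M.dualTensorHom_injective
  refine (map_add _ _ _).trans ?_
  rw [M.map_coevaluation _ _ 1 (by ext; rfl), M.map_coevaluation _ _ (-(M.parity * M.action.od x))
    (by ext; simp [Module.Dual.transpose_apply]), coevaluation_one]
  ext v
  simp [parity_parity]

theorem coev_ρ (M : SRep L) (g : L.G) (c : k) : coevaluation k M.V c =
    (tensor M M.dual).ρ g (coevaluation k M.V c) := by
  rw [eq_smul_coevaluation, map_smul]
  congr 1
  apply M.dualTensorHom_injective
  refine Eq.trans ?_ (M.map_coevaluation (M.ρ g) _ (M.ρ g⁻¹) rfl _).symm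
  rw [coevaluation_one, mul_one, ← map_mul, mul_inv_cancel, map_one]

variable [CharZero k]

theorem braidLin_of_even (M N : SRep L) {v : M.V} (hv : M.parity v = v) (w : N.V) :
    braidLin M N (v ⊗ₜ w) = w ⊗ₜ v := by
  rw [braidLin_tmul, hv]
  have h2 : (2 : k) ≠ 0 := two_ne_zero
  rw [show w ⊗ₜ[k] v + w ⊗ₜ[k] v + N.parity w ⊗ₜ[k] v - N.parity w ⊗ₜ[k] v =
    (2 : k) • w ⊗ₜ[k] v by module, smul_smul, inv_mul_cancel₀ h2, one_smul]

theorem braidLin_of_odd (M N : SRep L) {v : M.V} (hv : M.parity v = -v) (w : N.V) :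
    braidLin M N (v ⊗ₜ w) = N.parity w ⊗ₜ v := by
  rw [braidLin_tmul, hv]
  have h2 : (2 : k) ≠ 0 := two_ne_zero
  rw [TensorProduct.tmul_neg, TensorProduct.tmul_neg,
    show w ⊗ₜ[k] v + -(w ⊗ₜ[k] v) + N.parity w ⊗ₜ[k] v - -(N.parity w ⊗ₜ[k] v) =
    (2 : k) • N.parity w ⊗ₜ[k] v by module, smul_smul, inv_mul_cancel₀ h2, one_smul]

theorem exists_even_add_odd (M : SRep L) (v : M.V) :
    ∃ v₀ v₁ : M.V, M.parity v₀ = v₀ ∧ M.parity v₁ = -v₁ ∧ v = v₀ + v₁ := by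
  have h : v ∈ M.evenPart ⊔ M.oddPart := by
    rw [M.isCompl_evenPart_oddPart.sup_eq_top]; trivial
  obtain ⟨v₀, h₀, v₁, h₁, rfl⟩ := Submodule.mem_sup.1 h
  exact ⟨v₀, v₁, by simpa [evenPart, sub_eq_zero] using h₀,
    by simpa [oddPart, ← eq_neg_iff_add_eq_zero] using h₁, rfl⟩

theorem braidLin_braidLin (M N : SRep L) : braidLin N M ∘ₗ braidLin M N = LinearMap.id := by
  have hN := N.parity_parity
  refine TensorProduct.ext' fun v w => ?_
  obtain ⟨w₀, w₁, f₀, f₁, rfl⟩ := N.exists_even_add_odd w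
  obtain ⟨v₀, v₁, e₀, e₁, rfl⟩ := M.exists_even_add_odd v
  simp [TensorProduct.add_tmul, TensorProduct.tmul_add, TensorProduct.neg_tmul,
    braidLin_of_even, braidLin_of_odd, e₀, e₁, f₀, f₁]

/-- The braiding as an isomorphism of representations. -/
def braidIso (M N : SRep L) : M ⊗ N ≅ N ⊗ M :=
  mkIso (M := tensor M N) (N := tensor N M)
    (LinearEquiv.ofLinearMap (braidLin M N) (braidLin N M) (braidLin_braidLin N M)
      (braidLin_braidLin M N))
    (fun t => LinearMap.congr_fun (f := braidLin M N ∘ₗ (tensor M N).parity)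
      (g := (tensor N M).parity ∘ₗ braidLin M N)
      (TensorProduct.ext' fun v w => by simp [braidLin_tmul, parity_parity]) t)
    (fun a t => LinearMap.congr_fun (f := braidLin M N ∘ₗ (tensorAction M N).ev a)
      (g := (tensorAction N M).ev a ∘ₗ braidLin M N)
      (TensorProduct.ext' fun v w => by
        simp [braidLin_tmul, ev_parity_apply]; module) t)
    (fun x t => LinearMap.congr_fun (f := braidLin M N ∘ₗ (tensorAction M N).od x)
      (g := (tensorAction N M).od x ∘ₗ braidLin M N)
      (TensorProduct.ext' fun v w => by
        simp [braidLin_tmul, od_parity_apply, parity_parity, TensorProduct.neg_tmul,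
          TensorProduct.tmul_neg]; module) t)
    (fun g t => LinearMap.congr_fun (f := braidLin M N ∘ₗ (tensor M N).ρ g)
      (g := (tensor N M).ρ g ∘ₗ braidLin M N)
      (TensorProduct.ext' fun v w => by simp [braidLin_tmul, ρ_parity_apply]) t)

theorem lin_braidIso (M N : SRep L) : lin (braidIso M N).hom = braidLin M N := rfl

instance : SymmetricCategory (SRep L) where
  braiding := braidIso
  braiding_naturality_right X Y Z f := hom_ext (TensorProduct.ext' fun v w => by
    change braidLin X Z (v ⊗ₜ lin f w) = (lin f).rTensor X.V (braidLin X Y (v ⊗ₜ w))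
    simp [braidLin_tmul, lin, f.parity])
  braiding_naturality_left {X Y} f Z := hom_ext (TensorProduct.ext' fun v w => by
    change braidLin Y Z (lin f v ⊗ₜ w) = (lin f).lTensor Z.V (braidLin X Z (v ⊗ₜ w))
    simp [braidLin_tmul, lin, f.parity])
  hexagon_forward X Y Z := hom_ext (TensorProduct.ext_threefold fun u v w => by
    change TensorProduct.assoc k Y.V Z.V X.V (braidLin X (tensor Y Z) (u ⊗ₜ (v ⊗ₜ w))) =
      (braidLin X Z).lTensor Y.V (TensorProduct.assoc k Y.V X.V Z.V
        ((braidLin X Y).rTensor Z.V ((u ⊗ₜ v) ⊗ₜ w)))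
    obtain ⟨u₀, u₁, e₀, e₁, rfl⟩ := X.exists_even_add_odd u
    have h₀ : braidLin X (tensor Y Z) (u₀ ⊗ₜ[k] (v ⊗ₜ[k] w)) = (v ⊗ₜ[k] w) ⊗ₜ[k] u₀ :=
      braidLin_of_even X (tensor Y Z) e₀ _
    have h₁ : braidLin X (tensor Y Z) (u₁ ⊗ₜ[k] (v ⊗ₜ[k] w)) =
        (Y.parity v ⊗ₜ[k] Z.parity w) ⊗ₜ[k] u₁ := braidLin_of_odd X (tensor Y Z) e₁ _
    simp only [TensorProduct.add_tmul, map_add, h₀, h₁]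
    simp [braidLin_of_even, braidLin_of_odd, e₀, e₁])
  hexagon_reverse X Y Z := hom_ext (ext_threefold' fun u v w => by
    change (TensorProduct.assoc k Z.V X.V Y.V).symm (braidLin (tensor X Y) Z ((u ⊗ₜ v) ⊗ₜ w)) =
      (braidLin X Z).rTensor Y.V ((TensorProduct.assoc k X.V Z.V Y.V).symm
        ((braidLin Y Z).lTensor X.V (u ⊗ₜ (v ⊗ₜ w))))
    obtain ⟨u₀, u₁, e₀, e₁, rfl⟩ := X.exists_even_add_odd u
    obtain ⟨v₀, v₁, f₀, f₁, rfl⟩ := Y.exists_even_add_odd v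
    have h₀ : braidLin (tensor X Y) Z ((u₀ ⊗ₜ[k] v₀) ⊗ₜ[k] w) = w ⊗ₜ[k] (u₀ ⊗ₜ[k] v₀) :=
      braidLin_of_even (tensor X Y) Z (by simp [e₀, f₀]) _
    have h₁ : braidLin (tensor X Y) Z ((u₁ ⊗ₜ[k] v₁) ⊗ₜ[k] w) = w ⊗ₜ[k] (u₁ ⊗ₜ[k] v₁) :=
      braidLin_of_even (tensor X Y) Z
        (by simp [e₁, f₁, TensorProduct.neg_tmul, TensorProduct.tmul_neg]) _
    have h₂ : braidLin (tensor X Y) Z ((u₀ ⊗ₜ[k] v₁) ⊗ₜ[k] w) =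
        Z.parity w ⊗ₜ[k] (u₀ ⊗ₜ[k] v₁) :=
      braidLin_of_odd (tensor X Y) Z (by simp [e₀, f₁, TensorProduct.tmul_neg]) _
    have h₃ : braidLin (tensor X Y) Z ((u₁ ⊗ₜ[k] v₀) ⊗ₜ[k] w) =
        Z.parity w ⊗ₜ[k] (u₁ ⊗ₜ[k] v₀) :=
      braidLin_of_odd (tensor X Y) Z (by simp [e₁, f₀, TensorProduct.neg_tmul]) _
    simp only [TensorProduct.add_tmul, TensorProduct.tmul_add, map_add, h₀, h₁, h₂, h₃]
    simp [braidLin_of_even, braidLin_of_odd, parity_parity, e₀, e₁, f₀, f₁])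
  symmetry M N := hom_ext (braidLin_braidLin M N)

/-- Evaluation `φ ⊗ v ↦ φ v` and coevaluation `1 ↦ ∑ eᵢ ⊗ eᵢ*` exhibit `M.dual` as the dual. -/
instance (M : SRep L) : ExactPairing M M.dual where
  coevaluation' := (⟨coevaluation k M.V, coev_parity M, coev_ev M, coev_od M, coev_ρ M⟩ :
    Hom (triv L) (tensor M M.dual))
  evaluation' := (⟨contractLeft k M.V,
    fun v => LinearMap.congr_fun (f := contractLeft k M.V ∘ₗ (tensor M.dual M).parity)
      (g := contractLeft k M.V) (TensorProduct.ext' fun φ v => by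
        simp [Module.Dual.transpose_apply, parity_parity]) v,
    fun a v => LinearMap.congr_fun (f := contractLeft k M.V ∘ₗ (tensor M.dual M).action.ev a)
      (g := 0) (TensorProduct.ext' fun (φ : Module.Dual k M.V) v => by
        change contractLeft k M.V (M.dualAction.ev a φ ⊗ₜ v + φ ⊗ₜ M.action.ev a v) = 0
        simp [Module.Dual.transpose_apply]) v,
    fun a v => LinearMap.congr_fun (f := contractLeft k M.V ∘ₗ (tensor M.dual M).action.od a)
      (g := 0) (TensorProduct.ext' fun (φ : Module.Dual k M.V) v => by
        change contractLeft k M.V (M.dualAction.od a φ ⊗ₜ v +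
          Module.Dual.transpose M.parity φ ⊗ₜ M.action.od a v) = 0
        simp [Module.Dual.transpose_apply]) v,
    fun g v => LinearMap.congr_fun (f := contractLeft k M.V ∘ₗ (tensor M.dual M).ρ g)
      (g := contractLeft k M.V) (TensorProduct.ext' fun φ v => by
        simp [Module.Dual.transpose_apply, ← Module.End.mul_apply, ← map_mul]) v⟩ :
    Hom (tensor M.dual M) (triv L))
  coevaluation_evaluation' := hom_ext (contractLeft_assoc_coevaluation k M.V)
  evaluation_coevaluation' := hom_ext (contractLeft_assoc_coevaluation' k M.V)

instance (M : SRep L) : HasRightDual M := ⟨M.dual⟩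

instance : RightRigidCategory (SRep L) where

end SRep

section Supergroups

variable (k : Type u) [Field k]

/-- The Lie superalgebra of `𝔾ₐ^(1|1)`, with basis `[x, x] = 1 ∈ k` (even) and `x = 1 ∈ k` (odd),
where `[x, x]` is central. -/
def ga11Lie : LieSuperalgebra k :=
  let _ : LieRing k :=
    { (inferInstance : AddCommGroup k) with
      bracket := fun _ _ => 0
      add_lie := fun _ _ _ => (add_zero 0).symm
      lie_add := fun _ _ _ => (add_zero 0).symm
      lie_self := fun _ => rfl
      leibniz_lie := fun _ _ _ => (add_zero 0).symm }
  let _ : LieAlgebra k k :=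
    { (inferInstance : Module k k) with
      lie_smul := fun c _ _ => (mul_zero c).symm }
  { even := k
    odd := k
    act := 0
    bracket := LinearMap.mul k k
    act_lie := by simp
    bracket_symm := fun x y => mul_comm x y
    bracket_equivariant := fun a x y => by
      change (0 : k) = 0 * y + x * 0
      simp
    jacobi := by simp }

/-- The supergroup `𝔾ₐ^(1|1)`: its underlying group is the additive group, whose Lie algebra is
spanned by `[x, x]`. -/
def ga11 : HarishChandra k where
  toLieSuperalgebra := ga11Lie k
  G := Multiplicative k
  index := Unit
  coord t _ := t.toAdd
  tangent :=
    { toFun := fun (a : k) _ => a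
      map_add' := fun _ _ => rfl
      map_smul' := fun _ _ => rfl }
  invPoly _ := -MvPolynomial.X ()
  coord_inv t _ := by simp
  tangent_inv a _ := by simp

/-- The odd element `x` of the Lie superalgebra of `𝔾ₐ^(1|1)`. -/
def ga11X : (ga11 k).odd := (1 : k)

/-- The odd bracket of `𝔬𝔰𝔭(1|2)`: for `v, w ∈ k²`, `[v, w]` is the traceless matrix
`u ↦ ω(u, v) w + ω(u, w) v`, where `ω(u, v) = u₀ v₁ - u₁ v₀`. -/
def ospBracket (v w : Fin 2 → k) : LieAlgebra.SpecialLinear.sl (Fin 2) k :=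
  ⟨!![v 0 * w 1 + v 1 * w 0, -(2 * v 0 * w 0); 2 * v 1 * w 1, -(v 0 * w 1 + v 1 * w 0)], by
    change Matrix.traceLinearMap (Fin 2) k k _ = 0
    simp [Matrix.trace_fin_two]⟩

theorem ospBracket_mulVec (v w u : Fin 2 → k) :
    (ospBracket k v w).1.mulVec u =
      (u 0 * v 1 - u 1 * v 0) • w + (u 0 * w 1 - u 1 * w 0) • v := by
  funext i
  fin_cases i <;> simp [ospBracket, Matrix.mulVec, dotProduct, Fin.sum_univ_two] <;> ring

/-- The Lie superalgebra `𝔬𝔰𝔭(1|2)`: its even part is `𝔰𝔩₂` and its odd part is the standard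
representation `k²` of `𝔰𝔩₂`. -/
def osp12Lie : LieSuperalgebra k where
  even := LieAlgebra.SpecialLinear.sl (Fin 2) k
  odd := Fin 2 → k
  act := LinearMap.mk₂ k (fun a v => a.1.mulVec v)
    (fun a b v => Matrix.add_mulVec _ _ _) (fun c a v => Matrix.smul_mulVec _ _ _)
    (fun a v w => Matrix.mulVec_add _ _ _) (fun c a v => Matrix.mulVec_smul _ _ _)
  bracket := LinearMap.mk₂ k (ospBracket k)
    (fun v v' w => by
      ext i j; fin_cases i <;> fin_cases j <;> simp [ospBracket] <;> ring)
    (fun c v w => by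
      ext i j; fin_cases i <;> fin_cases j <;> simp [ospBracket] <;> ring)
    (fun v w w' => by
      ext i j; fin_cases i <;> fin_cases j <;> simp [ospBracket] <;> ring)
    (fun c v w => by
      ext i j; fin_cases i <;> fin_cases j <;> simp [ospBracket] <;> ring)
  act_lie a b v := by
    change (a.1 * b.1 - b.1 * a.1).mulVec v = a.1.mulVec (b.1.mulVec v) - b.1.mulVec (a.1.mulVec v)
    rw [Matrix.sub_mulVec, Matrix.mulVec_mulVec, Matrix.mulVec_mulVec]
  bracket_symm v w := by
    ext i j; fin_cases i <;> fin_cases j <;> simp [ospBracket] <;> ring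
  bracket_equivariant a v w := by
    have ha : a.1 0 0 + a.1 1 1 = 0 := by
      have h : Matrix.trace a.1 = 0 := a.2
      rwa [Matrix.trace_fin_two] at h
    have ha' : a.1 1 1 = -a.1 0 0 := by linear_combination ha
    apply Subtype.ext
    change a.1 * (ospBracket k v w).1 - (ospBracket k v w).1 * a.1 =
      (ospBracket k (a.1.mulVec v) w).1 + (ospBracket k v (a.1.mulVec w)).1
    ext i j
    fin_cases i <;> fin_cases j <;>
      simp [ospBracket, Matrix.mul_apply, Matrix.vecMul, Fin.sum_univ_two,
        Matrix.mulVec, dotProduct, ha'] <;> ring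
  jacobi v := by
    change (ospBracket k v v).1.mulVec v = 0
    rw [ospBracket_mulVec]
    simp [mul_comm]

/-- The supergroup `OSp(1|2)`, whose underlying group is `SL₂`. -/
def osp12 : HarishChandra k where
  toLieSuperalgebra := osp12Lie k
  G := Matrix.SpecialLinearGroup (Fin 2) k
  index := Fin 2 × Fin 2
  coord g p := g.1 p.1 p.2
  tangent :=
    { toFun := fun (a : LieAlgebra.SpecialLinear.sl (Fin 2) k) p => a.1 p.1 p.2
      map_add' := fun _ _ => rfl
      map_smul' := fun _ _ => rfl }
  invPoly p := Matrix.adjugate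
    (Matrix.of fun i j => (MvPolynomial.X (i, j) : MvPolynomial (Fin 2 × Fin 2) k)) p.1 p.2
  coord_inv g p := by
    obtain ⟨i, j⟩ := p
    fin_cases i <;> fin_cases j <;> simp [Matrix.adjugate_fin_two]
  tangent_inv a p := by
    have ha : a.1 0 0 + a.1 1 1 = 0 := by
      have h : Matrix.trace a.1 = 0 := a.2
      rwa [Matrix.trace_fin_two] at h
    have ha' : a.1 1 1 = -a.1 0 0 := by linear_combination ha
    obtain ⟨i, j⟩ := p
    fin_cases i <;> fin_cases j <;> 
      simp [Matrix.adjugate_fin_two, sub_eq_add_neg, -DualNumber.inr_eq_smul_eps]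
    · rw [← TrivSqZeroExt.inr_neg]
      exact congr_arg TrivSqZeroExt.inr ha'
    · rw [← TrivSqZeroExt.inr_neg]
      exact congr_arg TrivSqZeroExt.inr (by linear_combination ha : a.1 0 0 = -a.1 1 1)

/-- The generator `h` of `𝔬𝔰𝔭(1|2)`. -/
def ospH : (osp12 k).even := LieAlgebra.SpecialLinear.singleSubSingle (0 : Fin 2) 1 2

/-- The generator `X` of `𝔬𝔰𝔭(1|2)`. -/
def ospX : (osp12 k).odd := (![0, 1] : Fin 2 → k)

/-- The generator `Y` of `𝔬𝔰𝔭(1|2)`. -/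
def ospY : (osp12 k).odd := (![2, 0] : Fin 2 → k)

theorem osp_relations : (osp12 k).act (ospH k) (ospX k) = (-2 : k) • ospX k ∧
    (osp12 k).act (ospH k) (ospY k) = (2 : k) • ospY k ∧
    (osp12 k).bracket (ospY k) (ospX k) = ospH k := by
  refine ⟨?_, ?_, ?_⟩
  · change (LieAlgebra.SpecialLinear.singleSubSingle (0 : Fin 2) 1 (2 : k)).1.mulVec ![0, 1] =
      fun i => (-2 : k) * (![0, 1] : Fin 2 → k) i
    ext i; fin_cases i <;> simp
  · change (LieAlgebra.SpecialLinear.singleSubSingle (0 : Fin 2) 1 (2 : k)).1.mulVec ![2, 0] =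
      fun i => (2 : k) * (![2, 0] : Fin 2 → k) i
    ext i; fin_cases i <;> simp
  · change ospBracket k ![2, 0] ![0, 1] =
      LieAlgebra.SpecialLinear.singleSubSingle (0 : Fin 2) 1 (2 : k)
    ext i j; fin_cases i <;> fin_cases j <;> simp [ospBracket]

/-- The category of representations of `𝔾ₐ^(1|1)`. -/
abbrev RepGa11 := SRep (ga11 k)

/-- The category of representations of `OSp(1|2)`. -/
abbrev RepOSp12 := SRep (osp12 k)

end Supergroups

section Restriction

variable (k : Type u) [Field k]

/-- The one-parameter subgroup `t ↦ exp (t [X, X]) = !![1, 0; 2 t, 1]` of `SL₂`. -/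
def ospUnipotent : Multiplicative k →* Matrix.SpecialLinearGroup (Fin 2) k where
  toFun t := ⟨!![1, 0; 2 * t.toAdd, 1], by simp⟩
  map_one' := by
    apply Subtype.ext
    ext i j; fin_cases i <;> fin_cases j <;> simp
  map_mul' s t := by
    apply Subtype.ext
    change _ = !![(1 : k), 0; 2 * s.toAdd, 1] * !![(1 : k), 0; 2 * t.toAdd, 1]
    ext i j; fin_cases i <;> fin_cases j <;> simp [mul_add]

variable {k}

/-- The coordinates of `ospUnipotent`. -/
def unipotentPoly (p : Fin 2 × Fin 2) : MvPolynomial Unit k :=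
  (!![1, 0; MvPolynomial.C 2 * MvPolynomial.X (), 1] :
    Matrix (Fin 2) (Fin 2) (MvPolynomial Unit k)) p.1 p.2

theorem aeval_unipotentPoly {A : Type*} [CommRing A] [Algebra k A] (a : A) (p : Fin 2 × Fin 2) :
    MvPolynomial.aeval (fun _ : Unit => a) (unipotentPoly p : MvPolynomial Unit k) =
      (!![1, 0; algebraMap k A 2 * a, 1] : Matrix (Fin 2) (Fin 2) A) p.1 p.2 := by
  obtain ⟨i, j⟩ := p
  fin_cases i <;> fin_cases j <;> simp [unipotentPoly]

theorem unipotent_dualPoint (c : k) (p : Fin 2 × Fin 2) :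
    (!![1, 0; algebraMap k (DualNumber k) 2 * (TrivSqZeroExt.inl 0 + TrivSqZeroExt.inr c), 1] :
      Matrix (Fin 2) (Fin 2) (DualNumber k)) p.1 p.2 =
      TrivSqZeroExt.inl ((1 : Matrix (Fin 2) (Fin 2) k) p.1 p.2) +
        TrivSqZeroExt.inr ((c • (ospBracket k ![0, 1] ![0, 1]).1) p.1 p.2) := by
  obtain ⟨i, j⟩ := p
  fin_cases i <;> fin_cases j <;> ext <;>
    simp [ospBracket, TrivSqZeroExt.algebraMap_eq_inl, mul_comm]

theorem eval_bind₁_unipotentPoly (a : k) (p : MvPolynomial (Fin 2 × Fin 2) k) :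
    MvPolynomial.eval (fun _ : Unit => a) (MvPolynomial.bind₁ unipotentPoly p) =
      MvPolynomial.eval (fun q : Fin 2 × Fin 2 =>
        (!![1, 0; 2 * a, 1] : Matrix (Fin 2) (Fin 2) k) q.1 q.2) p := by
  rw [← MvPolynomial.coe_aeval_eq_eval, ← MvPolynomial.coe_aeval_eq_eval]
  simp only [RingHom.coe_coe, MvPolynomial.aeval_bind₁, aeval_unipotentPoly]
  rfl

theorem aeval_bind₁_unipotentPoly (c : k) (p : MvPolynomial (Fin 2 × Fin 2) k) :
    MvPolynomial.aeval (fun _ : Unit =>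
        (TrivSqZeroExt.inl 0 + TrivSqZeroExt.inr c : DualNumber k))
      (MvPolynomial.bind₁ unipotentPoly p) =
    MvPolynomial.aeval (fun q : Fin 2 × Fin 2 =>
      (TrivSqZeroExt.inl ((1 : Matrix (Fin 2) (Fin 2) k) q.1 q.2) +
        TrivSqZeroExt.inr ((c • (ospBracket k ![0, 1] ![0, 1]).1) q.1 q.2) : DualNumber k)) p := by
  simp only [MvPolynomial.aeval_bind₁, aeval_unipotentPoly, unipotent_dualPoint]

theorem isRegular_unipotent (M : RepOSp12 k) (φ : Module.Dual k M.V) (v : M.V) :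
    (ga11 k).IsRegular (fun t => φ (M.ρ (ospUnipotent k t) v))
      (fun c : k => φ ((c • M.action.ev ((osp12 k).bracket (ospX k) (ospX k))) v)) := by
  obtain ⟨p, hp, hp'⟩ := M.algebraic φ v
  refine ⟨(MvPolynomial.bind₁ unipotentPoly p : MvPolynomial Unit k), fun t => ?_,
    fun (c : k) => ?_⟩
  · exact (eval_bind₁_unipotentPoly _ p).trans (hp (ospUnipotent k t))
  · refine (congr_arg TrivSqZeroExt.snd (aeval_bind₁_unipotentPoly c p)).trans ?_
    refine (hp' (c • (osp12 k).bracket (ospX k) (ospX k))).trans ?_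
    exact congr_arg φ (LinearMap.congr_fun (M.action.ev.map_smul c _) v)

/-- The restriction of a representation of `OSp(1|2)` along the embedding
`𝔾ₐ^(1|1) → OSp(1|2)` taking `x` to `X`. -/
def restrictObj (M : RepOSp12 k) : RepGa11 k where
  V := M.V
  parity := M.parity
  parity_sq := M.parity_sq
  action :=
    { ev := (LinearMap.id : k →ₗ[k] k).smulRight
        (M.action.ev ((osp12 k).bracket (ospX k) (ospX k)))
      od := (LinearMap.id : k →ₗ[k] k).smulRight (M.action.od (ospX k))
      ev_parity := fun (c : k) => by
        change (c • M.action.ev _) * _ = _ * (c • M.action.ev _)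
        rw [smul_mul_assoc, mul_smul_comm, M.action.ev_parity]
      od_parity := fun (c : k) => by
        change (c • M.action.od _) * _ = -(_ * (c • M.action.od _))
        rw [smul_mul_assoc, mul_smul_comm, M.action.od_parity, smul_neg]
      ev_lie := fun (a : k) (b : k) => by
        change (0 : k) • M.action.ev _ =
          (a • M.action.ev _) * (b • M.action.ev _) - (b • M.action.ev _) * (a • M.action.ev _)
        rw [smul_mul_smul_comm, smul_mul_smul_comm, mul_comm a b, sub_self, zero_smul]
      od_act := fun (a : k) (c : k) => by
        change (0 : k) • M.action.od _ =
          (a • M.action.ev _) * (c • M.action.od _) - (c • M.action.od _) * (a • M.action.ev _)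
        rw [smul_mul_smul_comm, smul_mul_smul_comm, mul_comm c a, ← smul_sub,
          ← M.action.od_act, (osp12 k).jacobi, map_zero, smul_zero, zero_smul]
      ev_bracket := fun (c : k) (d : k) => by
        change (c * d) • M.action.ev _ =
          (c • M.action.od _) * (d • M.action.od _) + (d • M.action.od _) * (c • M.action.od _)
        rw [smul_mul_smul_comm, smul_mul_smul_comm, mul_comm d c, ← smul_add,
          ← M.action.ev_bracket] }
  ρ := M.ρ.comp (ospUnipotent k : (ga11 k).G →* (osp12 k).G)
  ρ_parity t := M.ρ_parity _
  algebraic φ v := isRegular_unipotent M φ v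

/-- The restriction functor `Rep(OSp(1|2)) ⥤ Rep(𝔾ₐ^(1|1))`. -/
def restrict : RepOSp12 k ⥤ RepGa11 k where
  obj := restrictObj
  map {M N} f := (⟨(SRep.lin f : M.V →ₗ[k] N.V), f.parity,
    fun (c : k) v => ((SRep.lin f).map_smul c _).trans (congr_arg (c • ·) (f.ev _ v)),
    fun (c : k) v => ((SRep.lin f).map_smul c _).trans (congr_arg (c • ·) (f.od _ v)),
    fun t v => f.ρ _ v⟩ : SRep.Hom (restrictObj M) (restrictObj N))

variable [CharZero k]

/-- The restriction functor is symmetric monoidal, through the identity maps. -/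
instance : (restrict (k := k)).Braided where
  toMonoidal := Functor.CoreMonoidal.toMonoidal
    { εIso := SRep.mkIso (M := SRep.triv (ga11 k)) (N := restrictObj (SRep.triv (osp12 k)))
        (LinearEquiv.refl k k) (fun _ => rfl) (fun (a : k) _ => (smul_zero (A := k) a).symm)
        (fun (a : k) _ => (smul_zero (A := k) a).symm) (fun _ _ => rfl)
      μIso := fun M N => SRep.mkIso (M := SRep.tensor (restrictObj M) (restrictObj N))
        (N := restrictObj (SRep.tensor M N))
        (LinearEquiv.refl k (M.V ⊗[k] N.V)) (fun _ => rfl)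
        (fun (a : k) v => by
          exact LinearMap.congr_fun (show
            TensorProduct.map (a • M.action.ev ((osp12 k).bracket (ospX k) (ospX k))) LinearMap.id +
              TensorProduct.map LinearMap.id (a • N.action.ev ((osp12 k).bracket (ospX k) (ospX k))) =
            a • (TensorProduct.map (M.action.ev ((osp12 k).bracket (ospX k) (ospX k))) LinearMap.id +
              TensorProduct.map LinearMap.id (N.action.ev ((osp12 k).bracket (ospX k) (ospX k)))) by
            rw [TensorProduct.map_smul_left, TensorProduct.map_smul_right, smul_add]) v)
        (fun (a : k) v => by
          exact LinearMap.congr_fun (show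
            TensorProduct.map (a • M.action.od (ospX k)) LinearMap.id +
              TensorProduct.map M.parity (a • N.action.od (ospX k)) =
            a • (TensorProduct.map (M.action.od (ospX k)) LinearMap.id +
              TensorProduct.map M.parity (N.action.od (ospX k))) by
            rw [TensorProduct.map_smul_left, TensorProduct.map_smul_right, smul_add]) v)
        (fun _ _ => rfl)
      μIso_hom_natural_left := fun f Z => rfl
      μIso_hom_natural_right := fun Z f => rfl
      associativity := fun X Y Z => SRep.hom_ext (TensorProduct.ext_threefold fun u v w =>
        Eq.trans (b := (u ⊗ₜ (v ⊗ₜ w) : X.V ⊗[k] (Y.V ⊗[k] Z.V))) rfl rfl)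
      left_unitality := fun X => SRep.hom_ext (TensorProduct.ext' fun _ _ => rfl)
      right_unitality := fun X => SRep.hom_ext (TensorProduct.ext' fun _ _ => rfl) }
  braided X Y := rfl

end Restriction

section DeligneFiltration

variable {k : Type u} [Field k]

/-- The odd nilpotent operator `x` on a representation of `𝔾ₐ^(1|1)`. -/
def xOp (M : RepGa11 k) : Module.End k M.V := M.action.od (ga11X k)

/-- The defining properties of the Deligne filtration of `x`: it is a finite increasing
filtration by subsuperspaces with `x (F i) ⊆ F (i - 2)` such that `x ^ i` induces an isomorphism
`F i / F (i - 1) ≅ F (-i) / F (-i - 1)` for all `i ≥ 0`. -/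
structure IsDeligneFiltration (M : RepGa11 k) (F : ℤ → Submodule k M.V) : Prop where
  monotone : Monotone F
  exists_eq_bot : ∃ i, F i = ⊥
  exists_eq_top : ∃ i, F i = ⊤
  parity_mem : ∀ i, ∀ v ∈ F i, M.parity v ∈ F i
  x_mem : ∀ i, ∀ v ∈ F i, xOp M v ∈ F (i - 2)
  gr_injective : ∀ i : ℕ, ∀ v ∈ F i, (xOp M ^ i) v ∈ F (-i - 1) → v ∈ F (i - 1)
  gr_surjective : ∀ i : ℕ, ∀ w ∈ F (-i), ∃ v ∈ F i, w - (xOp M ^ i) v ∈ F (-i - 1)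

/-- The Deligne filtration of `x`, `F i = ∑ s ≥ 0, ker (x ^ (i + s + 1)) ∩ im (x ^ s)`, where the
terms with `i + s + 1 ≤ 0` are zero. -/
def deligne (M : RepGa11 k) (i : ℤ) : Submodule k M.V :=
  ⨆ s : ℕ, LinearMap.ker (xOp M ^ (i + s + 1).toNat) ⊓ LinearMap.range (xOp M ^ s)

theorem map_mem_deligne {M N : RepGa11 k} (f : M.V →ₗ[k] N.V) {i j : ℤ}
    (h : ∀ s : ℕ, ∀ v, (xOp M ^ (i + s + 1).toNat) v = 0 → v ∈ LinearMap.range (xOp M ^ s) →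
      f v ∈ deligne N j) :
    ∀ v ∈ deligne M i, f v ∈ deligne N j := by
  intro v hv
  have : deligne M i ≤ (deligne N j).comap f :=
    iSup_le fun s v hv => h s v hv.1 hv.2
  exact this hv

theorem mem_deligne {M : RepGa11 k} {i : ℤ} (s : ℕ) {v : M.V}
    (h : (xOp M ^ (i + s + 1).toNat) v = 0) (h' : v ∈ LinearMap.range (xOp M ^ s)) :
    v ∈ deligne M i :=
  Submodule.mem_iSup_of_mem s ⟨h, h'⟩

theorem xOp_mem_deligne (M : RepGa11 k) (i : ℤ) :
    ∀ v ∈ deligne M i, xOp M v ∈ deligne M (i - 2) := by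
  refine map_mem_deligne _ fun s v hv hv' => mem_deligne (s + 1) ?_ ?_
  · rw [show i - 2 + ((s + 1 : ℕ) : ℤ) + 1 = i + s by push_cast; ring, ← Module.End.mul_apply,
      ← pow_succ]
    obtain h | h := le_or_gt 0 (i + s)
    · rw [← hv, show (i + s + 1).toNat = (i + s).toNat + 1 by omega]
    · have : (i + s + 1).toNat = 0 := by omega
      rw [this, pow_zero, Module.End.one_apply] at hv
      rw [hv, map_zero]
  · obtain ⟨w, rfl⟩ := hv'
    exact ⟨w, by rw [pow_succ', Module.End.mul_apply]⟩

theorem pow_xOp_parity (M : RepGa11 k) (n : ℕ) (v : M.V) :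
    (xOp M ^ n) (M.parity v) = (-1 : k) ^ n • M.parity ((xOp M ^ n) v) := by
  induction n with
  | zero => simp
  | succ n ih =>
    rw [pow_succ', Module.End.mul_apply, ih, map_smul, Module.End.mul_apply, xOp,
      SRep.od_parity_apply, pow_succ]
    simp

theorem parity_mem_deligne (M : RepGa11 k) (i : ℤ) :
    ∀ v ∈ deligne M i, M.parity v ∈ deligne M i := by
  refine map_mem_deligne _ fun s v hv hv' => mem_deligne s ?_ ?_
  · rw [pow_xOp_parity, hv, map_zero, smul_zero]
  · obtain ⟨w, rfl⟩ := hv'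
    refine ⟨(-1 : k) ^ s • M.parity w, ?_⟩
    rw [map_smul, pow_xOp_parity, smul_smul, ← mul_pow]
    simp

theorem lin_pow_xOp {M N : RepGa11 k} (f : M ⟶ N) (n : ℕ) (v : M.V) :
    SRep.lin f ((xOp M ^ n) v) = (xOp N ^ n) (SRep.lin f v) := by
  induction n with
  | zero => simp
  | succ n ih =>
    rw [pow_succ', pow_succ', Module.End.mul_apply, Module.End.mul_apply, ← ih]
    exact f.od _ _

theorem lin_mem_deligne {M N : RepGa11 k} (f : M ⟶ N) (i : ℤ) :
    ∀ v ∈ deligne M i, SRep.lin f v ∈ deligne N i := by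
  refine map_mem_deligne _ fun s v hv hv' => mem_deligne s ?_ ?_
  · rw [← lin_pow_xOp, hv, map_zero]
  · obtain ⟨w, rfl⟩ := hv'
    exact ⟨SRep.lin f w, (lin_pow_xOp f s w).symm⟩

/-- The component `F i / F (i - 1)` of the associated graded of the Deligne filtration. -/
abbrev Gr (M : RepGa11 k) (i : ℤ) : Type u :=
  deligne M i ⧸ (deligne M (i - 1)).submoduleOf (deligne M i)

/-- The map `Gr M i → Gr N j` induced by a map taking `F i` to `F j` and `F (i - 1)` to
`F (j - 1)`. -/
def grMap {M N : RepGa11 k} (f : M.V →ₗ[k] N.V) (i j : ℤ)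
    (h : ∀ v ∈ deligne M i, f v ∈ deligne N j)
    (h' : ∀ v ∈ deligne M (i - 1), f v ∈ deligne N (j - 1)) : Gr M i →ₗ[k] Gr N j :=
  Submodule.mapQ _ _ (f.restrict h) fun v hv => h' v.1 hv

/-- The even part `⨁ i, Gr M (2 i)` of the associated graded. -/
abbrev GrEv (M : RepGa11 k) : Type u := ⨁ i : ℤ, Gr M (2 * i)

/-- The class in `Gr M (2 i)` of an element of `F (2 i)`. -/
def GrEv.mk {M : RepGa11 k} (i : ℤ) (v : M.V) (hv : v ∈ deligne M (2 * i)) : GrEv M :=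
  DirectSum.lof k ℤ (fun i => Gr M (2 * i)) i (Submodule.Quotient.mk ⟨v, hv⟩)

/-- The parity automorphism of `GrEv M`, induced by the one of `M`. -/
def grParity (M : RepGa11 k) : Module.End k (GrEv M) :=
  DirectSum.lmap fun i => grMap M.parity (2 * i) (2 * i)
    (parity_mem_deligne M _) (parity_mem_deligne M _)

/-- The grading operator on `GrEv M`: multiplication by `2 i` on `Gr M (2 i)`. -/
def grH (M : RepGa11 k) : Module.End k (GrEv M) :=
  DirectSum.lmap fun i => ((2 * i : ℤ) : k) • (LinearMap.id : Gr M (2 * i) →ₗ[k] Gr M (2 * i))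

/-- The operator `Gr(x)` on `GrEv M`, taking `Gr M (2 i)` to `Gr M (2 (i - 1))`. -/
def grX (M : RepGa11 k) : Module.End k (GrEv M) :=
  DirectSum.toModule k ℤ (GrEv M) fun i =>
    DirectSum.lof k ℤ (fun i => Gr M (2 * i)) (i - 1) ∘ₗ
      grMap (xOp M) (2 * i) (2 * (i - 1))
        (fun v hv => by
          rw [show 2 * (i - 1) = 2 * i - 2 by ring]
          exact xOp_mem_deligne M _ v hv)
        (fun v hv => by
          rw [show 2 * (i - 1) - 1 = 2 * i - 1 - 2 by ring]
          exact xOp_mem_deligne M _ v hv)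

/-- The map `GrEv M → GrEv N` induced by a morphism `M ⟶ N`. -/
def grHom {M N : RepGa11 k} (f : M ⟶ N) : GrEv M →ₗ[k] GrEv N :=
  DirectSum.lmap fun i => grMap (SRep.lin f) (2 * i) (2 * i)
    (lin_mem_deligne f _) (lin_mem_deligne f _)

/-- A structure of an `𝔬𝔰𝔭(1|2)`-module on the superspace `GrEv M` for which `h` acts by the
grading and `X` acts by `Gr(x)`. -/
def IsGrStructure (M : RepGa11 k) (s : (osp12 k).Action (GrEv M) (grParity M)) : Prop :=
  s.ev (ospH k) = grH M ∧ s.od (ospX k) = grX M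

end DeligneFiltration

end

/-!
The category `Rep(𝔾ₐ^(1|1))` is controlled by the operator `x`: the underlying group acts through
polynomial one-parameter groups, so `x` is nilpotent (`isNilpotent_xOp`) and every even linear map
commuting with `x` is a morphism (`homOfCommutes`, via `IsPolyFlow.map_apply`). Indecomposable
objects are Jordan blocks. Likewise a morphism of representations of `OSp(1|2)` is an even linear
map commuting with `X` and `Y` (`ospHomOfCommutes`), and in fact with `h` and `X` only (`ospHom`):
the failure to commute with `Y` would raise weights by `2` while preserving the Deligne filtration
of `X`, and weights are degrees (`eq_zero_of_anticommutes`). The same rigidity gives the uniqueness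
of the `𝔬𝔰𝔭(1|2)`-structure (`action_eq_of_eq`).

*Negligible morphisms.* The categorical trace is the supertrace (`lin_catTrace`). The signs along a
Jordan block alternate, so a block of even size has supertrace `0` and a map through it is
negligible (`negligible_jordanHom`), whereas maps through blocks of odd size detect everything that
is nonzero on `GrEv`: a negligible morphism vanishes on `GrEv` (`Negligible.mem_deligne`).
Conversely, for the restriction of a representation `V` of `OSp(1|2)`, the relation
`[Y, X] = h` forces the filtration to jump in even degrees only, and the weights of `h` split it
(`deligne_restrict_odd`, `isInternal_weightSpace`). Hence `V ≅ GrEv V` canonically (`grRestrict`),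
and a morphism out of `V` which vanishes on `GrEv` is negligible (`negligible_of_grHom_eq_zero`).

*The equivalence.* A morphism between restricted representations therefore agrees, modulo negligible
morphisms, with exactly one morphism of `OSp(1|2)`, namely its associated graded
(`liftRestrict`). So `restrict ⋙ proj` is fully faithful. It is essentially surjective: iterated
tensor products with the standard representation, of dimension `(2|1)`, contain Jordan blocks of
every odd size (`exists_od_pow`); a morphism through such a block factors through a restricted
representation, and splitting off the longest blocks one by one shows that every object is, up to
negligible morphisms, a retract of a restricted one (`exists_summand`), while idempotents split in
`Rep(OSp(1|2))`.

*The functor.* `T` is `proj` followed by an inverse of the equivalence; inverses of braided monoidal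
equivalences are braided monoidal, so `T` is symmetric monoidal and `T ⋙ restrict ⋙ proj ≅ proj`
monoidally (`exists_factorization`). Lifting the components of this isomorphism to morphisms of
`Rep(𝔾ₐ^(1|1))` and passing to `GrEv`, where negligible morphisms vanish, identifies `T M` with
`GrEv M` compatibly with parity, `h` and `X` (`grIso`). The formula for the tensor structure
(`grIso_tensor`) follows from the compatibility of the even steps of the Deligne filtration with
tensor products (`tmul_mem_deligne`), which holds for restricted representations because weights
add, and in general because these steps are spanned by images of restricted representations.
-/

/-! ### Polynomial one-parameter groups and nilpotent operators -/

section OneParameter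

variable {k : Type u} [Field k] {V W : Type u} [AddCommGroup V] [Module k V]
  [AddCommGroup W] [Module k W]

/-- `IsPolyFlow ρ N`: the matrix coefficients of the one-parameter group `ρ` are polynomials, and
the derivative of `ρ` at `0` is `N`. -/
def IsPolyFlow (ρ : k → Module.End k V) (N : Module.End k V) : Prop :=
  ρ 0 = 1 ∧ (∀ s t, ρ (s + t) = ρ s * ρ t) ∧
    ∀ (φ : Module.Dual k V) (v : V), ∃ p : Polynomial k,
      (∀ t, p.eval t = φ (ρ t v)) ∧ p.coeff 1 = φ (N v)

namespace IsPolyFlow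

variable [CharZero k] {ρ : k → Module.End k V} {N : Module.End k V}

/-- All derivatives of a matrix coefficient of a polynomial one-parameter group are again matrix
coefficients. -/
theorem exists_poly (h : IsPolyFlow ρ N) (φ : Module.Dual k V) (v : V) :
    ∃ p : Polynomial k, (∀ t, p.eval t = φ (ρ t v)) ∧
      ∀ i, (Polynomial.derivative^[i] p).eval 0 = φ ((N ^ i) v) := by
  obtain ⟨h0, hadd, hp⟩ := h
  choose p hp hp1 using hp
  have hder : ∀ φ v, Polynomial.derivative (p φ v) = p φ (N v) := by
    intro φ v
    refine Polynomial.funext fun s => ?_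
    have h1 : p (φ ∘ₗ ρ s) v = (p φ v).comp (Polynomial.X + Polynomial.C s) := by
      refine Polynomial.funext fun t => ?_
      rw [hp, Polynomial.eval_comp]
      simp only [Polynomial.eval_add, Polynomial.eval_X, Polynomial.eval_C, hp]
      rw [add_comm, hadd]; rfl
    have h2 : (p (φ ∘ₗ ρ s) v).coeff 1 = (Polynomial.derivative (p φ v)).eval s := by
      have : ∀ q : Polynomial k, q.coeff 1 = (Polynomial.derivative q).eval 0 := fun q => by
        rw [← Polynomial.coeff_zero_eq_eval_zero, Polynomial.coeff_derivative]; simp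
      rw [this, h1, Polynomial.derivative_comp]
      simp [Polynomial.eval_comp]
    rw [← h2, hp1, hp]; rfl
  refine ⟨p φ v, hp φ v, fun i => ?_⟩
  have hit : ∀ i v, Polynomial.derivative^[i] (p φ v) = p φ ((N ^ i) v) := by
    intro i
    induction i with
    | zero => intro v; simp
    | succ i ih =>
      intro v
      rw [Function.iterate_succ, Function.comp_apply, hder, ih, pow_succ, Module.End.mul_apply]
  rw [hit, hp, h0]; rfl

theorem isNilpotent [FiniteDimensional k V] (h : IsPolyFlow ρ N) : IsNilpotent N := by
  have key : ∀ (φ : Module.Dual k V) (v : V), ∀ᶠ i in Filter.atTop, φ ((N ^ i) v) = 0 := by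
    intro φ v
    obtain ⟨p, -, hp⟩ := h.exists_poly φ v
    filter_upwards [Filter.eventually_gt_atTop p.natDegree] with i hi
    rw [← hp, Polynomial.iterate_derivative_eq_zero hi, Polynomial.eval_zero]
  let b := Module.finBasis k V
  have h2 : ∀ᶠ i in Filter.atTop, ∀ a c, b.coord a ((N ^ i) (b c)) = 0 :=
    Filter.eventually_all.2 fun a => Filter.eventually_all.2 fun c => key _ _
  obtain ⟨i, hi⟩ := h2.exists
  exact ⟨i, b.ext fun c => b.ext_elem fun a => by simpa using hi a c⟩

/-- A map intertwining the derivatives intertwines the one-parameter groups: the two matrix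
coefficients are polynomials with the same derivatives at `0`. -/
theorem map_apply {σ : k → Module.End k W} {N' : Module.End k W} (h : IsPolyFlow ρ N)
    (h' : IsPolyFlow σ N') (f : V →ₗ[k] W) (hf : ∀ v, f (N v) = N' (f v)) (t : k) (v : V) :
    f (ρ t v) = σ t (f v) := by
  rw [← sub_eq_zero, ← Module.forall_dual_apply_eq_zero_iff k]
  intro φ
  obtain ⟨p, hp, hp'⟩ := h.exists_poly (φ ∘ₗ f) v
  obtain ⟨q, hq, hq'⟩ := h'.exists_poly φ (f v)
  have hpow : ∀ i, f ((N ^ i) v) = (N' ^ i) (f v) := by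
    intro i
    induction i with
    | zero => rfl
    | succ i ih => rw [pow_succ', pow_succ', Module.End.mul_apply, Module.End.mul_apply, hf, ih]
  have : p = q := by
    ext i
    have h1 := (hp' i).trans ((congr_arg φ (hpow i)).trans (hq' i).symm)
    rw [← Polynomial.coeff_zero_eq_eval_zero, ← Polynomial.coeff_zero_eq_eval_zero,
      Polynomial.coeff_iterate_derivative, Polynomial.coeff_iterate_derivative] at h1
    simp only [zero_add, Nat.descFactorial_self, nsmul_eq_mul] at h1
    exact mul_left_cancel₀ (Nat.cast_ne_zero.2 i.factorial_ne_zero) h1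
  rw [map_sub, ← hq, ← this, hp]
  exact sub_self _

end IsPolyFlow

end OneParameter

/-! ### Regular functions along polynomial curves -/

section Curve

variable {k : Type u} [Field k]

/-- Evaluation at `ε` reads off the value and the derivative at `0`. -/
theorem aeval_eps (q : Polynomial k) : Polynomial.aeval (DualNumber.eps : DualNumber k) q =
    TrivSqZeroExt.inl (q.coeff 0) + TrivSqZeroExt.inr (q.coeff 1) := by
  induction q using Polynomial.induction_on' with
  | add p q hp hq => rw [map_add, hp, hq]; ext <;> simp
  | monomial n a =>
    rw [Polynomial.aeval_monomial, Polynomial.coeff_monomial, Polynomial.coeff_monomial]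
    rcases n with _ | _ | n
    · simp [TrivSqZeroExt.algebraMap_eq_inl]
    · ext <;> simp [TrivSqZeroExt.algebraMap_eq_inl]
    · ext <;> simp [TrivSqZeroExt.algebraMap_eq_inl, pow_succ, mul_assoc]

/-- A regular function on the group restricts to a polynomial along a polynomial curve `g`
through `1`, with the expected derivative. -/
theorem HarishChandra.IsRegular.exists_poly {L : HarishChandra k} {f : L.G → k} {d : L.even → k}
    (h : L.IsRegular f d) (g : k → L.G) (a : L.even) (c : L.index → Polynomial k)
    (hc : ∀ t i, (c i).eval t = L.coord (g t) i) (hc0 : ∀ i, (c i).coeff 0 = L.coord 1 i)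
    (hc1 : ∀ i, (c i).coeff 1 = L.tangent a i) :
    ∃ p : Polynomial k, (∀ t, p.eval t = f (g t)) ∧ p.coeff 1 = d a := by
  obtain ⟨p, hp, hp'⟩ := h
  refine ⟨MvPolynomial.aeval c p, fun t => ?_, ?_⟩
  · rw [← hp, ← MvPolynomial.coe_aeval_eq_eval, ← Polynomial.coe_aeval_eq_eval]
    change ((Polynomial.aeval t).comp (MvPolynomial.aeval c)) p = MvPolynomial.aeval _ p
    refine DFunLike.congr_fun (MvPolynomial.algHom_ext fun i => ?_) p
    simp [hc]
  · rw [← hp']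
    have h1 : Polynomial.aeval (DualNumber.eps : DualNumber k) (MvPolynomial.aeval c p) =
        MvPolynomial.aeval (L.dualPoint a) p := by
      change ((Polynomial.aeval _).comp (MvPolynomial.aeval c)) p = MvPolynomial.aeval _ p
      refine DFunLike.congr_fun (MvPolynomial.algHom_ext fun i => ?_) p
      rw [AlgHom.comp_apply, MvPolynomial.aeval_X, MvPolynomial.aeval_X, aeval_eps, hc0, hc1]
      rfl
    rw [← h1, aeval_eps]
    simp

end Curve

/-! ### Representations of the unipotent supergroup -/

section Ga

variable {k : Type u} [Field k]

/-- The even part of the Lie superalgebra acts through `[x, x] = 2 x ^ 2`. -/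
theorem ev_ga11 (M : RepGa11 k) (a : k) (v : M.V) :
    M.action.ev (a : (ga11 k).even) v = a • (2 : k) • xOp M (xOp M v) := by
  have h1 : (a : (ga11 k).even) = a • (ga11 k).bracket (ga11X k) (ga11X k) := by
    change a = a * (1 * 1); simp
  have h2 := M.ev_bracket_apply (ga11X k) (ga11X k) v
  refine (congr_arg (fun b => M.action.ev b v) h1).trans ?_
  rw [map_smul, LinearMap.smul_apply, h2, two_smul]
  rfl

theorem od_ga11 (M : RepGa11 k) (a : k) (v : M.V) :
    M.action.od (a : (ga11 k).odd) v = a • xOp M v := by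
  have h1 : (a : (ga11 k).odd) = a • ga11X k := by
    change a = a * 1; simp
  refine (congr_arg (fun b => M.action.od b v) h1).trans ?_
  rw [map_smul, LinearMap.smul_apply]
  rfl

theorem isPolyFlow_ga11 (M : RepGa11 k) :
    IsPolyFlow (fun t : k => M.ρ (Multiplicative.ofAdd t : Multiplicative k))
      (M.action.ev (1 : k)) := by
  refine ⟨M.ρ.map_one, fun s t => M.ρ.map_mul _ _, fun φ v => ?_⟩
  exact (M.algebraic φ v).exists_poly (fun t : k => (Multiplicative.ofAdd t : Multiplicative k))
    (1 : k) (fun _ => Polynomial.X) (fun t _ => Polynomial.eval_X)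
    (fun _ => Polynomial.coeff_X_zero) (fun _ => Polynomial.coeff_X_one)

variable [CharZero k]

/-- `2 x ^ 2 = [x, x]` is the derivative of a polynomial one-parameter group, so it is nilpotent. -/
theorem isNilpotent_xOp (M : RepGa11 k) : IsNilpotent (xOp M) := by
  obtain ⟨n, hn⟩ := (isPolyFlow_ga11 M).isNilpotent
  have h : M.action.ev (1 : k) = (2 : k) • (xOp M ^ 2) := by
    ext v
    have := ev_ga11 M 1 v
    rw [one_smul] at this
    rw [this, pow_two]; rfl
  rw [h, smul_pow, smul_eq_zero] at hn
  exact ⟨2 * n, by rw [pow_mul]; exact hn.resolve_left (pow_ne_zero _ two_ne_zero)⟩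

/-- An even linear map commuting with `x` is a morphism of representations of `𝔾ₐ^(1|1)`. -/
def homOfCommutes {M N : RepGa11 k} (f : M.V →ₗ[k] N.V)
    (hp : ∀ v, f (M.parity v) = N.parity (f v)) (hx : ∀ v, f (xOp M v) = xOp N (f v)) :
    M ⟶ N :=
  (⟨f, hp, fun (a : k) v => by rw [ev_ga11, ev_ga11, map_smul, map_smul, hx, hx],
    fun (a : k) v => by rw [od_ga11, od_ga11, map_smul, hx],
    fun (t : Multiplicative k) v => (isPolyFlow_ga11 M).map_apply (isPolyFlow_ga11 N) f
      (fun v => by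
        have h1 := ev_ga11 M 1 v
        have h2 := ev_ga11 N 1 (f v)
        rw [h1, h2, map_smul, map_smul, hx, hx]) t.toAdd v⟩ : SRep.Hom M N)

end Ga

/-! ### The Deligne filtration -/

section Deligne

variable {k : Type u} [Field k]

theorem pow_xOp_mem_deligne (M : RepGa11 k) (n : ℕ) {i j : ℤ} (hij : j = i - 2 * n) {v : M.V}
    (hv : v ∈ deligne M i) : (xOp M ^ n) v ∈ deligne M j := by
  subst hij
  induction n with
  | zero => simpa using hv
  | succ n ih =>
    rw [pow_succ', Module.End.mul_apply]
    have := xOp_mem_deligne M _ _ ih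
    rwa [show i - 2 * (n : ℤ) - 2 = i - 2 * ((n + 1 : ℕ) : ℤ) by push_cast; ring] at this

theorem mem_deligne_of_pow_eq_zero {M : RepGa11 k} {n : ℕ} {v : M.V} (h : (xOp M ^ n) v = 0)
    {i : ℤ} (hi : n = i + 1) : v ∈ deligne M i := by
  refine mem_deligne 0 ?_ ⟨v, by simp⟩
  rwa [show (i + (0 : ℕ) + 1).toNat = n by omega]

theorem pow_xOp_eq_zero_of_le {M : RepGa11 k} {n m : ℕ} (hnm : n ≤ m) {v : M.V}
    (h : (xOp M ^ n) v = 0) : (xOp M ^ m) v = 0 := by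
  rw [← Nat.sub_add_cancel hnm, pow_add, Module.End.mul_apply, h, map_zero]

theorem deligne_mono (M : RepGa11 k) : Monotone (deligne M) := by
  intro i j hij v hv
  refine map_mem_deligne (M := M) (N := M) LinearMap.id (fun s v hv hv' => ?_) v hv
  exact mem_deligne s (pow_xOp_eq_zero_of_le
    (Int.toNat_le_toNat (by linarith : i + s + 1 ≤ j + s + 1)) hv) hv'

/-- The step `i` of the Deligne filtration is spanned by the vectors `x ^ s u`, where `u` is
annihilated by `x ^ (n + 1)`, `i = n - 2 s` and `s ≤ n`. -/
theorem deligne_induction {M : RepGa11 k} {i : ℤ} {P : Submodule k M.V}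
    (h : ∀ (s n : ℕ) (u : M.V), (n : ℤ) = i + 2 * s → s ≤ n →
      (xOp M ^ (n + 1)) u = 0 →
      (xOp M ^ s) u ∈ P) : deligne M i ≤ P := by
  refine iSup_le ?_
  rintro s _ ⟨hv, ⟨u, rfl⟩⟩
  rw [SetLike.mem_coe, LinearMap.mem_ker] at hv
  obtain hs | hs := le_or_gt 0 (i + s)
  · refine h s (i + s + s).toNat u (by omega) (by omega) ?_
    rw [← hv, ← Module.End.mul_apply, ← pow_add]
    congr 2
    omega
  · rw [show (i + s + 1).toNat = 0 by omega, pow_zero, Module.End.one_apply] at hv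
    rw [hv]; exact P.zero_mem

theorem pow_xOp_surjective_deligne (M : RepGa11 k) (i : ℕ) {w : M.V} (hw : w ∈ deligne M (-i)) :
    ∃ v ∈ deligne M i, (xOp M ^ i) v = w := by
  have : deligne M (-i) ≤ (deligne M i).map (xOp M ^ i) := by
    refine deligne_induction fun s n u hn hs hu => ?_
    refine ⟨(xOp M ^ (s - i)) u, ?_, ?_⟩
    · exact pow_xOp_mem_deligne M _ (by omega) (mem_deligne_of_pow_eq_zero (i := n) hu (by omega))
    · rw [← Module.End.mul_apply, ← pow_add]; congr 2; omega
  exact this hw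

/-- For any Deligne filtration `F`, the kernel of `x ^ n` lies in `F (n - 1)`: `x ^ (n + d)` is
injective on the graded piece of degree `n + d`. -/
theorem mem_of_pow_eq_zero_of_filtration {M : RepGa11 k} {F : ℤ → Submodule k M.V}
    (hF : IsDeligneFiltration M F) (n : ℕ) {v : M.V} (hv : (xOp M ^ n) v = 0) :
    v ∈ F (n - 1) := by
  obtain ⟨t, ht⟩ := hF.exists_eq_top
  have key : ∀ d : ℕ, v ∈ F (n - 1 + d) → v ∈ F (n - 1) := by
    intro d
    induction d with
    | zero => simp
    | succ d ih =>
      intro h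
      refine ih ?_
      have h0 : v ∈ F ((n + d : ℕ) : ℤ) := by
        convert h using 2; push_cast; ring
      have := hF.gr_injective (n + d) v h0 (by
        rw [pow_xOp_eq_zero_of_le (Nat.le_add_right n d) hv]; exact Submodule.zero_mem _)
      convert this using 2; push_cast; ring
  refine key (t - n + 1).toNat (hF.monotone (a := t) (by omega) ?_)
  rw [ht]; trivial

/-- For any Deligne filtration `F`, surjectivity of `x ^ i` on the graded pieces lifts to the
steps of `F`, by descending to the step where `F` vanishes. -/
theorem pow_surjective_of_filtration {M : RepGa11 k} {F : ℤ → Submodule k M.V}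
    (hF : IsDeligneFiltration M F) (i : ℕ) {w : M.V} (hw : w ∈ F (-i)) :
    ∃ v ∈ F i, (xOp M ^ i) v = w := by
  obtain ⟨b, hb⟩ := hF.exists_eq_bot
  have key : ∀ (d i : ℕ) (w : M.V), (-i : ℤ) ≤ b + d → w ∈ F (-i) →
      ∃ v ∈ F i, (xOp M ^ i) v = w := by
    intro d
    induction d with
    | zero =>
      intro i w h hw
      have := hF.monotone (a := -i) (b := b) (by simpa using h) hw
      rw [hb, Submodule.mem_bot] at this
      exact ⟨0, Submodule.zero_mem _, by simp [this]⟩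
    | succ d ih =>
      intro i w h hw
      obtain ⟨v, hv, hvw⟩ := hF.gr_surjective i w hw
      obtain ⟨v', hv', hvw'⟩ := ih (i + 1) _ (by push_cast at h ⊢; omega)
        (show w - (xOp M ^ i) v ∈ F (-((i + 1 : ℕ) : ℤ)) by convert hvw using 2; push_cast; ring)
      refine ⟨v + xOp M v', Submodule.add_mem _ hv ?_, ?_⟩
      · exact hF.monotone (by push_cast; omega) (hF.x_mem _ _ hv')
      · rw [map_add, ← Module.End.mul_apply (xOp M ^ i), ← pow_succ, hvw']; abel
  exact key (-i - b).toNat i w (by omega) hw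

/-- Uniqueness of the Deligne filtration. For `i ≥ 0` the inclusion `F i ≤ deligne M i` is shown by
descending induction on `i`: `x ^ (i + 1) v = x ^ (i + 2) u` with `u ∈ F (i + 2)`, so `v` differs
from `x u` by an element of `ker (x ^ (i + 1))`. Negative steps are images of positive ones. -/
theorem eq_deligne_of_filtration {M : RepGa11 k} {F : ℤ → Submodule k M.V}
    (hF : IsDeligneFiltration M F) : F = deligne M := by
  have hpow : ∀ (n : ℕ) (i : ℤ) v, v ∈ F i → (xOp M ^ n) v ∈ F (i - 2 * n) := by
    intro n i v hv
    induction n with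
    | zero => simpa using hv
    | succ n ih =>
      rw [pow_succ', Module.End.mul_apply]
      convert hF.x_mem _ _ ih using 2; push_cast; ring
  obtain ⟨b, hb⟩ := hF.exists_eq_bot
  have hnonneg : ∀ i : ℕ, F i ≤ deligne M i := by
    -- for large `i` this holds since `x ^ (i + 1)` maps `F i` into `F (-i - 2) = ⊥`
    have hbig : ∀ (d i : ℕ), -b ≤ i + d → F i ≤ deligne M i := by
      intro d
      induction d with
      | zero =>
        intro i hi v hv
        refine mem_deligne_of_pow_eq_zero (n := i + 1) ?_ (by push_cast; ring)
        have h1 : (xOp M ^ (i + 1)) v ∈ F (i - 2 * ((i + 1 : ℕ) : ℤ)) := hpow _ _ _ hv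
        have h2 := hF.monotone (b := b) (by push_cast at hi ⊢; omega) h1
        rwa [hb, Submodule.mem_bot] at h2
      | succ d ih =>
        intro i hi v hv
        have h1 : (xOp M ^ (i + 1)) v ∈ F (-((i + 2 : ℕ) : ℤ)) := by
          convert hpow (i + 1) _ _ hv using 2; push_cast; ring
        obtain ⟨u, hu, huv⟩ := pow_surjective_of_filtration hF (i + 2) h1
        have h2 : v - xOp M u ∈ deligne M i := by
          refine mem_deligne_of_pow_eq_zero (n := i + 1) ?_ (by push_cast; ring)
          rw [map_sub, ← huv, pow_succ (xOp M) (i + 1), Module.End.mul_apply, sub_self]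
        have h3 := xOp_mem_deligne M _ _ (ih (i + 2) (by push_cast at hi ⊢; omega) hu)
        have h4 : xOp M u ∈ deligne M i := by convert h3 using 2; push_cast; ring
        simpa using Submodule.add_mem _ h2 h4
    exact fun i => hbig (-b).toNat i (by omega)
  funext i
  apply le_antisymm
  · obtain ⟨n, rfl | rfl⟩ := i.eq_nat_or_neg
    · exact hnonneg n
    · intro w hw
      obtain ⟨v, hv, rfl⟩ := pow_surjective_of_filtration hF n hw
      exact pow_xOp_mem_deligne M n (by ring) (hnonneg n hv)
  · refine deligne_induction fun s n u hn hs hu => ?_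
    have h1 := hpow s _ _ (mem_of_pow_eq_zero_of_filtration hF (n + 1) hu)
    convert h1 using 2; push_cast; linarith

variable [CharZero k]

theorem isDeligneFiltration_deligne (M : RepGa11 k) : IsDeligneFiltration M (deligne M) where
  monotone := deligne_mono M
  exists_eq_bot := by
    obtain ⟨n, hn⟩ := isNilpotent_xOp M
    refine ⟨-n, le_bot_iff.1 (deligne_induction fun s m u hm hs hu => ?_)⟩
    have : (xOp M ^ s) u = 0 := pow_xOp_eq_zero_of_le (n := n) (by omega) (by rw [hn]; rfl)
    rw [this]; exact Submodule.zero_mem _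
  exists_eq_top := by
    obtain ⟨n, hn⟩ := isNilpotent_xOp M
    refine ⟨n - 1, eq_top_iff.2 fun v _ => mem_deligne_of_pow_eq_zero (n := n) ?_ (by ring)⟩
    rw [hn]; rfl
  parity_mem := parity_mem_deligne M
  x_mem := xOp_mem_deligne M
  gr_injective i v hv hxv := by
    obtain ⟨u, hu, hxu⟩ := pow_xOp_surjective_deligne M (i + 1)
      (show (xOp M ^ i) v ∈ deligne M (-((i + 1 : ℕ) : ℤ)) by convert hxv using 2; push_cast; ring)
    have h1 : v - xOp M u ∈ deligne M (i - 1) := by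
      refine mem_deligne_of_pow_eq_zero (n := i) ?_ (by ring)
      rw [map_sub, ← hxu, pow_succ, Module.End.mul_apply, sub_self]
    have h2 : xOp M u ∈ deligne M (i - 1) := by
      convert xOp_mem_deligne M _ _ hu using 2; push_cast; ring
    simpa using Submodule.add_mem _ h1 h2
  gr_surjective i w hw := by
    obtain ⟨v, hv, rfl⟩ := pow_xOp_surjective_deligne M i hw
    exact ⟨v, hv, by simp⟩

theorem isDeligneFiltration_iff (M : RepGa11 k) (F : ℤ → Submodule k M.V) :
    IsDeligneFiltration M F ↔ F = deligne M :=
  ⟨eq_deligne_of_filtration, fun h => h ▸ isDeligneFiltration_deligne M⟩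

end Deligne

/-! ### The even part of the associated graded -/

section GrEv

variable {k : Type u} [Field k]

/-- The map induced by a morphism on the associated graded, on classes. -/
theorem grHom_mk {M N : RepGa11 k} (f : M ⟶ N) (i : ℤ) (v : M.V) (hv : v ∈ deligne M (2 * i)) :
    grHom f (GrEv.mk i v hv) = GrEv.mk i (SRep.lin f v) (lin_mem_deligne f _ v hv) := by
  rw [grHom, GrEv.mk, DirectSum.lmap_lof]
  rfl

theorem GrEv.mk_eq_mk_iff {M : RepGa11 k} {i : ℤ} {v w : M.V} (hv : v ∈ deligne M (2 * i))
    (hw : w ∈ deligne M (2 * i)) :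
    GrEv.mk i v hv = GrEv.mk i w hw ↔ v - w ∈ deligne M (2 * i - 1) := by
  rw [GrEv.mk, GrEv.mk, DirectSum.lof_eq_of, DirectSum.lof_eq_of,
    (DirectSum.of_injective i).eq_iff, Submodule.Quotient.eq]
  rfl

theorem GrEv.induction {M : RepGa11 k} {P : GrEv M → Prop} (h0 : P 0)
    (hadd : ∀ a b, P a → P b → P (a + b)) (hmk : ∀ i v hv, P (GrEv.mk i v hv)) (a : GrEv M) :
    P a := by
  induction a using DirectSum.induction_on with
  | zero => exact h0
  | add a b ha hb => exact hadd a b ha hb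
  | of i a =>
    obtain ⟨⟨v, hv⟩, rfl⟩ := Submodule.Quotient.mk_surjective _ a
    exact hmk i v hv

theorem GrEv.hom_ext {M : RepGa11 k} {W : Type*} [AddCommMonoid W] [Module k W]
    {f g : GrEv M →ₗ[k] W} (h : ∀ i v hv, f (GrEv.mk i v hv) = g (GrEv.mk i v hv)) : f = g := by
  refine LinearMap.ext fun a => ?_
  induction a using GrEv.induction with
  | h0 => simp
  | hadd a b ha hb => simp [ha, hb]
  | hmk i v hv => exact h i v hv

theorem grHom_id (M : RepGa11 k) : grHom (𝟙 M) = LinearMap.id :=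
  GrEv.hom_ext (M := M) fun i v hv => by rw [grHom_mk]; rfl

theorem grHom_comp {M N P : RepGa11 k} (f : M ⟶ N) (g : N ⟶ P) :
    grHom (f ≫ g) = grHom g ∘ₗ grHom f :=
  GrEv.hom_ext (M := M) fun i v hv => by
    rw [LinearMap.comp_apply, grHom_mk, grHom_mk, grHom_mk]; rfl

theorem GrEv.mk_add {M : RepGa11 k} (i : ℤ) (v w : M.V) (hv : v ∈ deligne M (2 * i))
    (hw : w ∈ deligne M (2 * i)) :
    GrEv.mk i (v + w) (Submodule.add_mem _ hv hw) = GrEv.mk i v hv + GrEv.mk i w hw :=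
  map_add (DirectSum.lof k ℤ (fun i => Gr M (2 * i)) i)
    ((((deligne M (2 * i - 1)).submoduleOf (deligne M (2 * i))).mkQ) ⟨v, hv⟩)
    ((((deligne M (2 * i - 1)).submoduleOf (deligne M (2 * i))).mkQ) ⟨w, hw⟩)

theorem GrEv.mk_smul {M : RepGa11 k} (i : ℤ) (c : k) (v : M.V) (hv : v ∈ deligne M (2 * i)) :
    GrEv.mk i (c • v) (Submodule.smul_mem _ c hv) = c • GrEv.mk i v hv :=
  map_smul (DirectSum.lof k ℤ (fun i => Gr M (2 * i)) i) c
    ((((deligne M (2 * i - 1)).submoduleOf (deligne M (2 * i))).mkQ) ⟨v, hv⟩)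

theorem grParity_mk {M : RepGa11 k} (i : ℤ) (v : M.V) (hv : v ∈ deligne M (2 * i)) :
    grParity M (GrEv.mk i v hv) = GrEv.mk i (M.parity v) (parity_mem_deligne M _ v hv) := by
  rw [grParity, GrEv.mk, DirectSum.lmap_lof]
  rfl

theorem grH_mk {M : RepGa11 k} (i : ℤ) (v : M.V) (hv : v ∈ deligne M (2 * i)) :
    grH M (GrEv.mk i v hv) = ((2 * i : ℤ) : k) • GrEv.mk i v hv := by
  rw [grH, GrEv.mk, DirectSum.lmap_lof, LinearMap.smul_apply, map_smul]
  rfl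

theorem xOp_mem_deligne_two_mul {M : RepGa11 k} {i : ℤ} {v : M.V} (hv : v ∈ deligne M (2 * i)) :
    xOp M v ∈ deligne M (2 * (i - 1)) := by
  rw [show 2 * (i - 1) = 2 * i - 2 by ring]
  exact xOp_mem_deligne M _ v hv

theorem grX_mk {M : RepGa11 k} (i : ℤ) (v : M.V) (hv : v ∈ deligne M (2 * i)) :
    grX M (GrEv.mk i v hv) = GrEv.mk (i - 1) (xOp M v) (xOp_mem_deligne_two_mul hv) := by
  rw [grX, GrEv.mk, DirectSum.toModule_lof]
  rfl

end GrEv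

/-! ### The categorical trace is the supertrace -/

section Trace

variable {k : Type u} [Field k] [CharZero k]

/-- The categorical trace is the supertrace, that is, the trace of the composite with the parity. -/
theorem lin_catTrace {L : HarishChandra k} {M : SRep L} (f : M ⟶ M) :
    SRep.lin (catTrace f) (1 : k) = LinearMap.trace k M.V (M.parity ∘ₗ SRep.lin f) := by
  have h1 : ∀ (v : M.V) (φ : Module.Dual k M.V),
      contractLeft k M.V (SRep.braidLin M M.dual (v ⊗ₜ[k] φ)) = φ (M.parity v) := by
    intro v φ
    rw [SRep.braidLin_tmul]
    simp [Module.Dual.transpose_apply, SRep.parity_parity]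
    linear_combination φ (M.parity v) * inv_mul_cancel₀ (two_ne_zero (α := k))
  classical
  change contractLeft k M.V (SRep.braidLin M M.dual
    ((SRep.lin f).rTensor (Module.Dual k M.V) (coevaluation k M.V (1 : k)))) = _
  rw [coevaluation_apply_one, LinearMap.trace_eq_matrix_trace k (Module.Basis.ofVectorSpace k M.V)]
  simp only
  rw [map_sum, map_sum, map_sum]
  simp only [LinearMap.rTensor_tmul, h1, Matrix.trace, Matrix.diag, LinearMap.toMatrix_apply]
  rfl

theorem negligible_iff_trace {L : HarishChandra k} {M N : SRep L} (f : M ⟶ N) :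
    Negligible f ↔ ∀ g : N ⟶ M,
      LinearMap.trace k M.V (M.parity ∘ₗ SRep.lin g ∘ₗ SRep.lin f) = 0 := by
  refine forall_congr' fun g => ?_
  rw [← SRep.lin_comp, ← lin_catTrace]
  refine ⟨fun h => by rw [h]; rfl, fun h => ?_⟩
  refine SRep.hom_ext (LinearMap.ext_ring (R := k) (S := k) (M₃ := k) ?_)
  exact h

end Trace

/-! ### Morphisms through Jordan blocks -/

section Jordan

variable {k : Type u} [Field k]

/-- The map `u ↦ ∑ ξ (x ^ (n - j) u) x ^ j p`, which for `x ^ (n + 1) p = 0` and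
`ξ ∘ x ^ (n + 1) = 0` commutes with `x` and factors through a Jordan block of size `n + 1`. -/
noncomputable def jordanLin {M N : RepGa11 k} (n : ℕ) (p : M.V) (ξ : Module.Dual k N.V) :
    N.V →ₗ[k] M.V :=
  ∑ j ∈ Finset.range (n + 1), (ξ ∘ₗ (xOp N ^ (n - j))).smulRight ((xOp M ^ j) p)

theorem jordanLin_apply {M N : RepGa11 k} (n : ℕ) (p : M.V) (ξ : Module.Dual k N.V) (u : N.V) :
    jordanLin n p ξ u =
      ∑ j ∈ Finset.range (n + 1), ξ ((xOp N ^ (n - j)) u) • (xOp M ^ j) p := by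
  simp [jordanLin]

theorem parity_pow_xOp {M : RepGa11 k} {ε : k} {p : M.V} (hp : M.parity p = ε • p) (j : ℕ) :
    M.parity ((xOp M ^ j) p) = ((-1) ^ j * ε) • (xOp M ^ j) p := by
  have h := pow_xOp_parity M j p
  rw [hp, map_smul] at h
  rw [mul_smul, h, smul_smul, ← mul_pow]
  simp

/-- The map `jordanLin` as a morphism, for `p` homogeneous of sign `ε` with `x ^ (n + 1) p = 0` and
`ξ` homogeneous with `ξ ∘ x ^ (n + 1) = 0`. The sign of `ξ` is that of `x ^ n p`, so that the
morphism is even. -/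
noncomputable def jordanHom [CharZero k] {M N : RepGa11 k} (n : ℕ) (p : M.V)
    (ξ : Module.Dual k N.V) (ε : k)
    (hp : M.parity p = ε • p) (hξ : ∀ u, ξ (N.parity u) = ((-1) ^ n * ε) * ξ u)
    (hxp : (xOp M ^ (n + 1)) p = 0) (hξx : ∀ u, ξ ((xOp N ^ (n + 1)) u) = 0) : N ⟶ M :=
  homOfCommutes (jordanLin n p ξ)
    (fun u => by
      simp only [jordanLin_apply, map_sum, map_smul]
      refine Finset.sum_congr rfl fun j hj => ?_
      rw [Finset.mem_range] at hj
      rw [parity_pow_xOp hp, pow_xOp_parity, map_smul, hξ, smul_smul, smul_eq_mul]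
      congr 1
      have h1 : ((-1 : k)) ^ (n - j) * (-1) ^ n = (-1) ^ j := by
        rw [← pow_add, show n - j + n = 2 * (n - j) + j by omega, pow_add, pow_mul]; simp
      linear_combination (ε * ξ ((xOp N ^ (n - j)) u)) * h1)
    (fun u => by
      simp only [jordanLin_apply, map_sum, map_smul]
      rw [Finset.sum_range_succ', Finset.sum_range_succ (n := n)]
      simp only [← Module.End.mul_apply, ← pow_succ, ← pow_succ']
      rw [hxp, Nat.sub_zero, hξx, zero_smul, smul_zero]
      congr 1
      refine Finset.sum_congr rfl fun j hj => ?_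
      rw [Finset.mem_range] at hj
      rw [show n - (j + 1) + 1 = n - j by omega])

@[simp]
theorem lin_jordanHom [CharZero k] {M N : RepGa11 k} (n : ℕ) (p : M.V) (ξ : Module.Dual k N.V)
    (ε : k) (hp : M.parity p = ε • p) (hξ : ∀ u, ξ (N.parity u) = ((-1) ^ n * ε) * ξ u)
    (hxp : (xOp M ^ (n + 1)) p = 0) (hξx : ∀ u, ξ ((xOp N ^ (n + 1)) u) = 0) :
    SRep.lin (jordanHom n p ξ ε hp hξ hxp hξx) = jordanLin n p ξ := rfl

theorem jordanLin_comp_lin {M N P : RepGa11 k} (n : ℕ) (p : M.V) (ξ : Module.Dual k N.V)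
    (f : P ⟶ N) :
    jordanLin n p ξ ∘ₗ SRep.lin f = jordanLin n p (ξ ∘ₗ SRep.lin f) := by
  ext u
  simp [jordanLin_apply, lin_pow_xOp]

theorem lin_comp_jordanLin {M N P : RepGa11 k} (n : ℕ) (p : M.V) (ξ : Module.Dual k N.V)
    (f : M ⟶ P) :
    SRep.lin f ∘ₗ jordanLin n p ξ = jordanLin n (SRep.lin f p) ξ := by
  ext u
  simp [jordanLin_apply, lin_pow_xOp]

/-- If `η` and `q` are dual to each other, then `jordanLin n p η` maps the generator `q` to `p`. -/
theorem jordanLin_apply_generator {M N : RepGa11 k} (n : ℕ) (p : M.V) (η : Module.Dual k N.V)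
    (q : N.V) (h1 : η ((xOp N ^ n) q) = 1) (h0 : ∀ l < n, η ((xOp N ^ l) q) = 0) :
    jordanLin n p η q = p := by
  rw [jordanLin_apply, Finset.sum_range_succ']
  simp only [Nat.sub_zero, h1, pow_zero, Module.End.one_apply, one_smul]
  rw [Finset.sum_eq_zero, zero_add]
  intro j hj
  rw [Finset.mem_range] at hj
  rw [h0 _ (by omega), zero_smul]

/-- If `η` and `q` are dual to each other, then `jordanLin n p η` and `jordanLin n q ξ` compose
to `jordanLin n p ξ`. -/
theorem jordanLin_comp_jordanLin {M N P : RepGa11 k} (n : ℕ) (p : M.V) (η : Module.Dual k N.V)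
    (q : N.V) (ξ : Module.Dual k P.V) (h1 : η ((xOp N ^ n) q) = 1)
    (h0 : ∀ l < n, η ((xOp N ^ l) q) = 0) (hp : ∀ u, jordanLin n p η (xOp N u) =
      xOp M (jordanLin n p η u)) :
    jordanLin n p η ∘ₗ jordanLin n q ξ = jordanLin n p ξ := by
  have hpow : ∀ (j : ℕ) u, jordanLin n p η ((xOp N ^ j) u) = (xOp M ^ j) (jordanLin n p η u) := by
    intro j u
    induction j with
    | zero => rfl
    | succ j ih => rw [pow_succ', pow_succ', Module.End.mul_apply, Module.End.mul_apply, hp, ih]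
  ext u
  rw [LinearMap.comp_apply, jordanLin_apply n q ξ u, jordanLin_apply n p ξ u, map_sum]
  refine Finset.sum_congr rfl fun j _ => ?_
  rw [map_smul, hpow, jordanLin_apply_generator n p η q h1 h0]

/-- The supertrace of a Jordan block: `1` in even degrees and `-1` in odd degrees cancel. -/
theorem trace_parity_jordanLin {M : RepGa11 k} (n : ℕ) (p : M.V) (ξ : Module.Dual k M.V) (ε : k)
    (hp : M.parity p = ε • p) :
    LinearMap.trace k M.V (M.parity ∘ₗ jordanLin n p ξ) =
      (if Even n then 1 else 0) * (ε * ξ ((xOp M ^ n) p)) := by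
  have h : M.parity ∘ₗ jordanLin n p ξ = ∑ j ∈ Finset.range (n + 1),
      ((-1) ^ j * ε) • (ξ ∘ₗ (xOp M ^ (n - j))).smulRight ((xOp M ^ j) p) := by
    ext u
    simp only [LinearMap.comp_apply, jordanLin_apply, map_sum, map_smul, parity_pow_xOp hp,
      LinearMap.sum_apply, LinearMap.smul_apply, LinearMap.smulRight_apply]
    exact Finset.sum_congr rfl fun j _ => smul_comm _ _ _
  have h2 : ∀ j ∈ Finset.range (n + 1), LinearMap.trace k M.V
      (((-1) ^ j * ε) • (ξ ∘ₗ (xOp M ^ (n - j))).smulRight ((xOp M ^ j) p)) =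
      (-1) ^ j * (ε * ξ ((xOp M ^ n) p)) := by
    intro j hj
    rw [Finset.mem_range] at hj
    rw [map_smul, LinearMap.trace_smulRight, LinearMap.comp_apply, ← Module.End.mul_apply,
      ← pow_add, Nat.sub_add_cancel (by omega), smul_eq_mul, mul_assoc]
  rw [h, map_sum, Finset.sum_congr rfl h2, ← Finset.sum_mul, neg_one_geom_sum]
  simp only [Nat.even_add_one, ite_not]

variable [CharZero k]

/-- Morphisms through a Jordan block of even size `n + 1` are negligible. -/
theorem negligible_jordanHom {M N : RepGa11 k} {n : ℕ} (hn : Odd n) (p : M.V)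
    (ξ : Module.Dual k N.V)
    (ε : k) (hp : M.parity p = ε • p) (hξ : ∀ u, ξ (N.parity u) = ((-1) ^ n * ε) * ξ u)
    (hxp : (xOp M ^ (n + 1)) p = 0) (hξx : ∀ u, ξ ((xOp N ^ (n + 1)) u) = 0) :
    Negligible (jordanHom n p ξ ε hp hξ hxp hξx) := by
  rw [negligible_iff_trace]
  intro g
  rw [lin_jordanHom, lin_comp_jordanLin, trace_parity_jordanLin n _ ξ ε, if_neg, zero_mul]
  · simpa using hn
  · exact (g.parity p).symm.trans (by rw [hp]; exact (SRep.lin g).map_smul _ _)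

/-- The homogeneous part of sign `σ` of a functional. -/
theorem exists_homogeneous_dual {L : HarishChandra k} (M : SRep L) (ξ : Module.Dual k M.V) {σ : k}
    (hσ : σ * σ = 1) : ∃ ξ' : Module.Dual k M.V, (∀ u, ξ' (M.parity u) = σ * ξ' u) ∧
      (∀ u, M.parity u = σ • u → ξ' u = ξ u) ∧
      ∀ u, ξ u = 0 → ξ (M.parity u) = 0 → ξ' u = 0 := by
  have h2 : (2 : k) ≠ 0 := two_ne_zero
  refine ⟨(2⁻¹ : k) • (ξ + σ • ξ ∘ₗ M.parity), fun u => ?_, fun u hu => ?_, fun u hu hu' => ?_⟩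
  · simp only [LinearMap.smul_apply, LinearMap.add_apply, LinearMap.comp_apply, M.parity_parity,
      smul_eq_mul]
    linear_combination (-2⁻¹ * ξ (M.parity u)) * hσ
  · simp only [LinearMap.smul_apply, LinearMap.add_apply, LinearMap.comp_apply, hu, map_smul,
      smul_eq_mul]
    field_simp
    linear_combination ξ u * hσ
  · simp [hu, hu']

/-- The step of the Deligne filtration is spanned by the `x ^ s u` with `u` homogeneous, where
`x ^ (i + 2 s + 1) u = 0`. -/
theorem deligne_homogeneous_induction {M : RepGa11 k} {i : ℤ} {P : Submodule k M.V}
    (h : ∀ (s n : ℕ) (ε : k) (u : M.V), (n : ℤ) = i + 2 * s → s ≤ n → ε * ε = 1 →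
      M.parity u = ε • u → (xOp M ^ (n + 1)) u = 0 → (xOp M ^ s) u ∈ P) : deligne M i ≤ P := by
  refine deligne_induction fun s n u hn hs hu => ?_
  obtain ⟨u₀, u₁, h₀, h₁, rfl⟩ := M.exists_even_add_odd u
  have hpar : (xOp M ^ (n + 1)) (u₀ - u₁) = 0 := by
    have := pow_xOp_parity M (n + 1) (u₀ + u₁)
    rw [hu, map_zero, smul_zero, map_add M.parity, h₀, h₁, ← sub_eq_add_neg] at this
    exact this
  rw [map_add] at hu
  rw [map_sub] at hpar
  have two : (2 : k) ≠ 0 := two_ne_zero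
  have hu₀ : (xOp M ^ (n + 1)) u₀ = 0 := by
    have : (2 : k) • (xOp M ^ (n + 1)) u₀ = 0 := by
      have h : ∀ a b : M.V, (2 : k) • a = (a + b) + (a - b) := fun a b => by
        rw [two_smul]; abel
      rw [h _ ((xOp M ^ (n + 1)) u₁), hu, hpar, add_zero]
    exact (smul_eq_zero.1 this).resolve_left two
  have hu₁ : (xOp M ^ (n + 1)) u₁ = 0 := by rwa [hu₀, zero_add] at hu
  rw [map_add]
  exact Submodule.add_mem _ (h s n 1 u₀ hn hs (by ring) (by rw [h₀, one_smul]) hu₀)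
    (h s n (-1) u₁ hn hs (by ring) (by rw [h₁, neg_one_smul]) hu₁)

/-- The pairing of Jordan blocks of odd size detects morphisms which are nonzero on the even part
of the associated graded: a negligible morphism vanishes there. -/
theorem Negligible.mem_deligne {M N : RepGa11 k} {f : M ⟶ N} (hf : Negligible f) {i : ℤ} {v : M.V}
    (hv : v ∈ deligne M (2 * i)) : SRep.lin f v ∈ deligne N (2 * i - 1) := by
  have hom : ∀ (n : ℕ) (ε : k) (u : M.V), ε * ε = 1 → Even n → M.parity u = ε • u →
      (xOp M ^ (n + 1)) u = 0 → SRep.lin f u ∈ deligne N (n - 1) := by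
    intro n ε u hε hn hu hxu
    have hfu : N.parity (SRep.lin f u) = ε • SRep.lin f u :=
      (f.parity u).symm.trans (by rw [hu]; exact (SRep.lin f).map_smul _ _)
    -- either `f u` lies in a lower step, or it generates a Jordan block of odd size `n + 1`, and a
    -- functional which is nonzero on `x ^ n (f u)` yields a morphism back with nonzero supertrace
    by_cases h : (xOp N ^ n) (SRep.lin f u) ∈ LinearMap.range (xOp N ^ (n + 1))
    · obtain ⟨z, hz⟩ := h
      have h1 : SRep.lin f u - xOp N z ∈ deligne N (n - 1) := by
        refine mem_deligne_of_pow_eq_zero (n := n) ?_ (by ring)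
        rw [map_sub, ← hz, pow_succ, Module.End.mul_apply, sub_self]
      have h2 : z ∈ deligne N (n + 1) := by
        refine mem_deligne_of_pow_eq_zero (n := n + 2) ?_ (by push_cast; ring)
        rw [pow_succ' (xOp N) (n + 1), Module.End.mul_apply, hz, ← Module.End.mul_apply,
          ← pow_succ', ← lin_pow_xOp, hxu, map_zero]
      have h3 : xOp N z ∈ deligne N (n - 1) := by
        convert xOp_mem_deligne N _ _ h2 using 2; ring
      simpa using Submodule.add_mem _ h1 h3
    · exfalso
      obtain ⟨ξ, hξ1, hξ2⟩ := Submodule.exists_dual_map_eq_bot_of_notMem h inferInstance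
      have hξ3 : ∀ w, ξ ((xOp N ^ (n + 1)) w) = 0 := fun w => by
        have : ξ ((xOp N ^ (n + 1)) w) ∈ (LinearMap.range (xOp N ^ (n + 1))).map ξ :=
          ⟨_, ⟨w, rfl⟩, rfl⟩
        rwa [hξ2, Submodule.mem_bot] at this
      have hσ : ((-1) ^ n * ε) * ((-1) ^ n * ε) = 1 := by
        rw [hn.neg_one_pow, one_mul, hε]
      obtain ⟨ξ', h1, h2, h3⟩ := exists_homogeneous_dual N ξ hσ
      have hξ' : ∀ w, ξ' ((xOp N ^ (n + 1)) w) = 0 := fun w => by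
        refine h3 _ (hξ3 w) ?_
        have := pow_xOp_parity N (n + 1) w
        have h4 : N.parity ((xOp N ^ (n + 1)) w) =
            (-1 : k) ^ (n + 1) • (xOp N ^ (n + 1)) (N.parity w) := by
          rw [this, smul_smul, ← mul_pow]; simp
        rw [h4, map_smul, hξ3, smul_zero]
      have h0 := (negligible_iff_trace f).1 hf (jordanHom n u ξ' ε hu h1 hxu hξ')
      rw [lin_jordanHom, jordanLin_comp_lin, trace_parity_jordanLin n u _ ε hu, if_pos hn, one_mul,
        LinearMap.comp_apply, lin_pow_xOp, h2 _ (parity_pow_xOp hfu n), mul_eq_zero] at h0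
      rcases h0 with h0 | h0
      · rw [h0] at hε; simp at hε
      · exact hξ1 h0
  refine deligne_homogeneous_induction (P := (deligne N (2 * i - 1)).comap (SRep.lin f)) ?_ hv
  intro s n ε u hn hs hε hpu hu
  have hne : Even n := by
    have : Even (n : ℤ) := by rw [hn, ← mul_add]; exact even_two_mul _
    exact_mod_cast this
  rw [Submodule.mem_comap, lin_pow_xOp]
  exact pow_xOp_mem_deligne N s (i := n - 1) (by omega) (hom n ε u hε hne hpu hu)

/-- Morphisms which agree modulo negligible ones agree on the associated graded. -/
theorem grHom_eq_of_negligible {M N : RepGa11 k} {f g : M ⟶ N} (h : Negligible (f - g)) :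
    grHom f = grHom g := by
  refine GrEv.hom_ext fun i v hv => ?_
  rw [grHom_mk, grHom_mk, GrEv.mk_eq_mk_iff]
  exact h.mem_deligne hv

end Jordan

/-! ### The generators of `𝔬𝔰𝔭(1|2)` and of `SL₂` -/

section Generators

variable {k : Type u} [Field k]

section Action

variable [CharZero k] {V : Type u} [AddCommGroup V] [Module k V] {ε : Module.End k V}

theorem osp_action_od (s : (osp12 k).Action V ε) (w : Fin 2 → k) :
    s.od (w : (osp12 k).odd) = w 1 • s.od (ospX k) + (w 0 / 2) • s.od (ospY k) := by
  rw [← map_smul, ← map_smul, ← map_add]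
  refine congr_arg s.od (?_ : w = w 1 • ![0, 1] + (w 0 / 2) • ![2, 0])
  ext i
  fin_cases i <;> simp

theorem osp_action_ev (s : (osp12 k).Action V ε) (a : LieAlgebra.SpecialLinear.sl (Fin 2) k) :
    s.ev (a : (osp12 k).even) = (a.1 0 0 / 2) • (s.od (ospY k) * s.od (ospX k) +
      s.od (ospX k) * s.od (ospY k)) + (a.1 1 0 / 2) • (s.od (ospX k) * s.od (ospX k) +
      s.od (ospX k) * s.od (ospX k)) + (-a.1 0 1 / 8) • (s.od (ospY k) * s.od (ospY k) +
      s.od (ospY k) * s.od (ospY k)) := by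
  have ha : a.1 0 0 + a.1 1 1 = 0 := by
    have h : Matrix.trace a.1 = 0 := a.2
    rwa [Matrix.trace_fin_two] at h
  have key : s.ev ((a.1 0 0 / 2) • (osp12 k).bracket (ospY k) (ospX k) +
      (a.1 1 0 / 2) • (osp12 k).bracket (ospX k) (ospX k) +
      (-a.1 0 1 / 8) • (osp12 k).bracket (ospY k) (ospY k)) =
    (a.1 0 0 / 2) • s.ev ((osp12 k).bracket (ospY k) (ospX k)) +
      (a.1 1 0 / 2) • s.ev ((osp12 k).bracket (ospX k) (ospX k)) +
      (-a.1 0 1 / 8) • s.ev ((osp12 k).bracket (ospY k) (ospY k)) := by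
    simp only [map_add, map_smul]
  rw [← s.ev_bracket, ← s.ev_bracket, ← s.ev_bracket]
  refine Eq.trans ?_ key
  refine congr_arg s.ev (?_ : a = (a.1 0 0 / 2) • ospBracket k ![2, 0] ![0, 1] +
    (a.1 1 0 / 2) • ospBracket k ![0, 1] ![0, 1] + (-a.1 0 1 / 8) • ospBracket k ![2, 0] ![2, 0])
  ext i j
  fin_cases i <;> fin_cases j <;> simp [ospBracket]
  · ring
  · linear_combination ha

/-- A module structure over `𝔬𝔰𝔭(1|2)` is determined by the action of `X` and `Y`. -/
theorem osp_action_ext {s s' : (osp12 k).Action V ε} (hX : s.od (ospX k) = s'.od (ospX k))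
    (hY : s.od (ospY k) = s'.od (ospY k)) : s = s' := by
  refine LieSuperalgebra.Action.ext (LinearMap.ext fun a => ?_) (LinearMap.ext fun w => ?_)
  · exact (osp_action_ev s a).trans (by rw [hX, hY]; exact (osp_action_ev s' a).symm)
  · exact (osp_action_od s w).trans (by rw [hX, hY]; exact (osp_action_od s' w).symm)

end Action

/-- The lower unitriangular matrix with entry `t`. -/
def slLower (t : k) : Matrix.SpecialLinearGroup (Fin 2) k := ⟨!![1, 0; t, 1], by simp⟩

/-- The upper unitriangular matrix with entry `t`. -/
def slUpper (t : k) : Matrix.SpecialLinearGroup (Fin 2) k := ⟨!![1, t; 0, 1], by simp⟩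

theorem slLower_mul_of_ne_zero (g : Matrix.SpecialLinearGroup (Fin 2) k) (hg : g.1 1 0 ≠ 0) :
    g = slUpper ((g.1 0 0 - 1) / g.1 1 0) * slLower (g.1 1 0) *
      slUpper ((g.1 1 1 - 1) / g.1 1 0) := by
  have hd : g.1 0 0 * g.1 1 1 - g.1 0 1 * g.1 1 0 = 1 := by
    rw [← Matrix.det_fin_two]; exact g.2
  apply Subtype.ext
  change g.1 = !![1, (g.1 0 0 - 1) / g.1 1 0; 0, 1] * !![1, 0; g.1 1 0, 1] *
    !![1, (g.1 1 1 - 1) / g.1 1 0; 0, 1]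
  ext i j
  fin_cases i <;> fin_cases j <;> simp [Matrix.mul_apply, Fin.sum_univ_two] <;> field_simp
  · ring
  · linear_combination -hd
  · ring

/-- `SL₂` is generated by the two unipotent subgroups. -/
theorem sl_induction {P : Matrix.SpecialLinearGroup (Fin 2) k → Prop}
    (hl : ∀ t, P (slLower t)) (hu : ∀ t, P (slUpper t)) (hm : ∀ g h, P g → P h → P (g * h))
    (g : Matrix.SpecialLinearGroup (Fin 2) k) : P g := by
  have h1 : ∀ g : Matrix.SpecialLinearGroup (Fin 2) k, g.1 1 0 ≠ 0 → P g := fun g hg => by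
    rw [slLower_mul_of_ne_zero g hg]
    exact hm _ _ (hm _ _ (hu _) (hl _)) (hu _)
  by_cases hg : g.1 1 0 = 0
  · have hd : g.1 0 0 * g.1 1 1 - g.1 0 1 * g.1 1 0 = 1 := by
      rw [← Matrix.det_fin_two]; exact g.2
    have ha : g.1 0 0 ≠ 0 := by
      rintro h; rw [h, hg] at hd; simp at hd
    have h2 : g = slLower (-1) * (slLower 1 * g) := by
      apply Subtype.ext
      change g.1 = !![1, 0; -1, 1] * (!![1, 0; 1, 1] * g.1)
      ext i j
      fin_cases i <;> fin_cases j <;>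
        simp [Matrix.mul_apply, Fin.sum_univ_two, Matrix.vecMul, dotProduct]
    rw [h2]
    refine hm _ _ (hl _) (h1 _ ?_)
    change ((!![1, 0; 1, 1] : Matrix (Fin 2) (Fin 2) k) * g.1) 1 0 ≠ 0
    simpa [Matrix.mul_apply, Fin.sum_univ_two, hg] using ha
  · exact h1 g hg

/-- The tangent vector of `slLower`. -/
def slF : LieAlgebra.SpecialLinear.sl (Fin 2) k :=
  ⟨!![0, 0; 1, 0], by
    change Matrix.traceLinearMap (Fin 2) k k _ = 0
    simp [Matrix.trace_fin_two]⟩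

/-- The tangent vector of `slUpper`. -/
def slE : LieAlgebra.SpecialLinear.sl (Fin 2) k :=
  ⟨!![0, 1; 0, 0], by
    change Matrix.traceLinearMap (Fin 2) k k _ = 0
    simp [Matrix.trace_fin_two]⟩

theorem isPolyFlow_slLower (V : RepOSp12 k) :
    IsPolyFlow (fun t : k => V.ρ (slLower t : Matrix.SpecialLinearGroup (Fin 2) k))
      (V.action.ev (slF : LieAlgebra.SpecialLinear.sl (Fin 2) k)) := by
  have h0 : (slLower 0 : Matrix.SpecialLinearGroup (Fin 2) k) = 1 := by
    ext i j; fin_cases i <;> fin_cases j <;> simp [slLower]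
  have hadd : ∀ s t : k, (slLower (s + t) : Matrix.SpecialLinearGroup (Fin 2) k) =
      slLower s * slLower t := fun s t => by
    apply Subtype.ext
    change !![1, 0; s + t, 1] = !![1, 0; s, 1] * !![1, 0; t, 1]
    ext i j
    fin_cases i <;> fin_cases j <;> simp [Matrix.mul_apply, Fin.sum_univ_two, add_comm]
  refine ⟨(congr_arg V.ρ h0).trans V.ρ.map_one,
    fun s t => (congr_arg V.ρ (hadd s t)).trans (V.ρ.map_mul _ _), fun φ v => ?_⟩
  refine (V.algebraic φ v).exists_poly
    (fun t : k => (slLower t : Matrix.SpecialLinearGroup (Fin 2) k))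
    (slF : LieAlgebra.SpecialLinear.sl (Fin 2) k)
    (fun p : Fin 2 × Fin 2 => (!![1, 0; Polynomial.X, 1] : Matrix _ _ (Polynomial k)) p.1 p.2)
    ?_ ?_ ?_
  · rintro t ⟨i, j⟩
    change _ = (slLower t).1 i j
    fin_cases i <;> fin_cases j <;> simp [slLower]
  · rintro ⟨i, j⟩
    change _ = (1 : Matrix (Fin 2) (Fin 2) k) i j
    fin_cases i <;> fin_cases j <;> simp
  · rintro ⟨i, j⟩
    change _ = (!![0, 0; 1, 0] : Matrix (Fin 2) (Fin 2) k) i j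
    fin_cases i <;> fin_cases j <;> simp [Polynomial.coeff_one]

theorem isPolyFlow_slUpper (V : RepOSp12 k) :
    IsPolyFlow (fun t : k => V.ρ (slUpper t : Matrix.SpecialLinearGroup (Fin 2) k))
      (V.action.ev (slE : LieAlgebra.SpecialLinear.sl (Fin 2) k)) := by
  have h0 : (slUpper 0 : Matrix.SpecialLinearGroup (Fin 2) k) = 1 := by
    ext i j; fin_cases i <;> fin_cases j <;> simp [slUpper]
  have hadd : ∀ s t : k, (slUpper (s + t) : Matrix.SpecialLinearGroup (Fin 2) k) =
      slUpper s * slUpper t := fun s t => by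
    apply Subtype.ext
    change !![1, s + t; 0, 1] = !![1, s; 0, 1] * !![1, t; 0, 1]
    ext i j
    fin_cases i <;> fin_cases j <;> simp [Matrix.mul_apply, Fin.sum_univ_two, add_comm]
  refine ⟨(congr_arg V.ρ h0).trans V.ρ.map_one,
    fun s t => (congr_arg V.ρ (hadd s t)).trans (V.ρ.map_mul _ _), fun φ v => ?_⟩
  refine (V.algebraic φ v).exists_poly
    (fun t : k => (slUpper t : Matrix.SpecialLinearGroup (Fin 2) k))
    (slE : LieAlgebra.SpecialLinear.sl (Fin 2) k)
    (fun p : Fin 2 × Fin 2 => (!![1, Polynomial.X; 0, 1] : Matrix _ _ (Polynomial k)) p.1 p.2)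
    ?_ ?_ ?_
  · rintro t ⟨i, j⟩
    change _ = (slUpper t).1 i j
    fin_cases i <;> fin_cases j <;> simp [slUpper]
  · rintro ⟨i, j⟩
    change _ = (1 : Matrix (Fin 2) (Fin 2) k) i j
    fin_cases i <;> fin_cases j <;> simp
  · rintro ⟨i, j⟩
    change _ = (!![0, 1; 0, 0] : Matrix (Fin 2) (Fin 2) k) i j
    fin_cases i <;> fin_cases j <;> simp [Polynomial.coeff_one]

/-- An even linear map commuting with `X` and `Y` is a morphism of representations
of `OSp(1|2)`. -/
def ospHomOfCommutes [CharZero k] {V W : RepOSp12 k} (f : V.V →ₗ[k] W.V)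
    (hp : ∀ v, f (V.parity v) = W.parity (f v))
    (hX : ∀ v, f (V.action.od (ospX k) v) = W.action.od (ospX k) (f v))
    (hY : ∀ v, f (V.action.od (ospY k) v) = W.action.od (ospY k) (f v)) : V ⟶ W :=
  have hev : ∀ (a : LieAlgebra.SpecialLinear.sl (Fin 2) k) v,
      f (V.action.ev (a : (osp12 k).even) v) = W.action.ev (a : (osp12 k).even) (f v) :=
    fun a v => by
      have h1 := LinearMap.congr_fun (osp_action_ev V.action a) v
      have h2 := LinearMap.congr_fun (osp_action_ev W.action a) (f v)
      refine (congr_arg f h1).trans (Eq.trans ?_ h2.symm)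
      simp [hX, hY]
  (⟨f, hp, hev, fun (w : Fin 2 → k) v => by
      have h1 := LinearMap.congr_fun (osp_action_od V.action w) v
      have h2 := LinearMap.congr_fun (osp_action_od W.action w) (f v)
      refine (congr_arg f h1).trans (Eq.trans ?_ h2.symm)
      simp [hX, hY],
    fun g => sl_induction
      (P := fun g : Matrix.SpecialLinearGroup (Fin 2) k => ∀ v, f (V.ρ g v) = W.ρ g (f v))
      (fun t v => (isPolyFlow_slLower V).map_apply (isPolyFlow_slLower W) f (hev _) t v)
      (fun t v => (isPolyFlow_slUpper V).map_apply (isPolyFlow_slUpper W) f (hev _) t v)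
      (fun g h hg hh v => by
        have h1 := LinearMap.congr_fun (V.ρ.map_mul g h) v
        have h2 := LinearMap.congr_fun (W.ρ.map_mul g h) (f v)
        exact (congr_arg f h1).trans (((hg _).trans (congr_arg _ (hh v))).trans h2.symm)) g⟩ :
    SRep.Hom V W)

end Generators

/-! ### The weight decomposition of a representation of `OSp(1|2)` -/

section Weights

variable {k : Type u} [Field k]

/-- The grading operator `h` on the restriction of a representation of `OSp(1|2)`. -/
noncomputable def hOp (V : RepOSp12 k) : Module.End k (restrictObj V).V := V.action.ev (ospH k)

/-- The raising operator `Y` on the restriction of a representation of `OSp(1|2)`. -/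
noncomputable def yOp (V : RepOSp12 k) : Module.End k (restrictObj V).V := V.action.od (ospY k)

theorem xOp_restrict (V : RepOSp12 k) (v : V.V) :
    xOp (restrictObj V) v = V.action.od (ospX k) v :=
  one_smul k (V.action.od (ospX k) v)

theorem hOp_xOp (V : RepOSp12 k) (v : (restrictObj V).V) :
    hOp V (xOp (restrictObj V) v) =
      xOp (restrictObj V) (hOp V v) - (2 : k) • xOp (restrictObj V) v := by
  have h : ∀ w : V.V, V.action.ev (ospH k) (V.action.od (ospX k) w) =
      V.action.od (ospX k) (V.action.ev (ospH k) w) - (2 : k) • V.action.od (ospX k) w := by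
    intro w
    have h := V.od_act_apply (ospH k) (ospX k) w
    rw [(osp_relations k).1, map_smul, LinearMap.smul_apply, neg_smul, eq_sub_iff_add_eq] at h
    rw [eq_sub_iff_add_eq, eq_comm, ← sub_eq_iff_eq_add', ← h]
    abel
  rw [xOp_restrict V v, xOp_restrict V (hOp V v)]
  exact h v

theorem hOp_yOp (V : RepOSp12 k) (v : (restrictObj V).V) :
    hOp V (yOp V v) = yOp V (hOp V v) + (2 : k) • yOp V v := by
  have h : ∀ w : V.V, V.action.ev (ospH k) (V.action.od (ospY k) w) =
      V.action.od (ospY k) (V.action.ev (ospH k) w) + (2 : k) • V.action.od (ospY k) w := by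
    intro w
    have h := V.od_act_apply (ospH k) (ospY k) w
    rw [(osp_relations k).2.1, map_smul, LinearMap.smul_apply] at h
    rw [h]
    abel
  exact h v

theorem xOp_yOp (V : RepOSp12 k) (v : (restrictObj V).V) :
    xOp (restrictObj V) (yOp V v) = hOp V v - yOp V (xOp (restrictObj V) v) := by
  have h : ∀ w : V.V, V.action.od (ospX k) (V.action.od (ospY k) w) =
      V.action.ev (ospH k) w - V.action.od (ospY k) (V.action.od (ospX k) w) := by
    intro w
    have h := V.ev_bracket_apply (ospY k) (ospX k) w
    rw [(osp_relations k).2.2] at h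
    rw [h]
    abel
  rw [xOp_restrict V v, xOp_restrict V (yOp V v)]
  exact h v

theorem hOp_pow_xOp (V : RepOSp12 k) (n : ℕ) (v : (restrictObj V).V) :
    hOp V ((xOp (restrictObj V) ^ n) v) = (xOp (restrictObj V) ^ n) (hOp V v) -
      (2 * n : k) • (xOp (restrictObj V) ^ n) v := by
  induction n with
  | zero => simp
  | succ n ih =>
    rw [pow_succ', Module.End.mul_apply, Module.End.mul_apply, hOp_xOp, ih, map_sub, map_smul]
    push_cast
    module

/-- The commutation of the powers of `X` with `X Y`, from `X Y + Y X = h` and `[h, X] = -2 X`. The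
operator `h` appears for even exponents only, which makes the parity of the degree matter in the
Deligne filtration. -/
theorem pow_xOp_yOp (V : RepOSp12 k) (i : ℕ) (v : (restrictObj V).V) :
    (xOp (restrictObj V) ^ (2 * i)) (xOp (restrictObj V) (yOp V v)) =
      -yOp V ((xOp (restrictObj V) ^ (2 * i + 1)) v) +
        (xOp (restrictObj V) ^ (2 * i)) (hOp V v - (2 * i : k) • v) ∧
    (xOp (restrictObj V) ^ (2 * i + 1)) (xOp (restrictObj V) (yOp V v)) =
      yOp V ((xOp (restrictObj V) ^ (2 * i + 2)) v) +
        (2 * i + 2 : k) • (xOp (restrictObj V) ^ (2 * i + 1)) v := by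
  have step : ∀ i : ℕ, (xOp (restrictObj V) ^ (2 * i)) (xOp (restrictObj V) (yOp V v)) =
      -yOp V ((xOp (restrictObj V) ^ (2 * i + 1)) v) +
        (xOp (restrictObj V) ^ (2 * i)) (hOp V v - (2 * i : k) • v) →
      (xOp (restrictObj V) ^ (2 * i + 1)) (xOp (restrictObj V) (yOp V v)) =
      yOp V ((xOp (restrictObj V) ^ (2 * i + 2)) v) +
        (2 * i + 2 : k) • (xOp (restrictObj V) ^ (2 * i + 1)) v := by
    intro i h
    rw [pow_succ', Module.End.mul_apply, h, map_add, map_neg, xOp_yOp, hOp_pow_xOp,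
      show 2 * i + 2 = (2 * i + 1) + 1 from rfl, pow_succ' _ (2 * i + 1), Module.End.mul_apply,
      ← Module.End.mul_apply (xOp (restrictObj V)) (xOp (restrictObj V) ^ (2 * i)), ← pow_succ',
      map_sub, map_smul]
    push_cast
    module
  have h1 : (xOp (restrictObj V) ^ (2 * i)) (xOp (restrictObj V) (yOp V v)) =
      -yOp V ((xOp (restrictObj V) ^ (2 * i + 1)) v) +
        (xOp (restrictObj V) ^ (2 * i)) (hOp V v - (2 * i : k) • v) := by
    induction i with
    | zero => simp [xOp_yOp]; abel
    | succ i ih =>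
      rw [show 2 * (i + 1) = (2 * i + 1) + 1 by ring, pow_succ', Module.End.mul_apply, step i ih,
        map_add, xOp_yOp, hOp_pow_xOp, pow_succ' _ (2 * i + 1 + 1), Module.End.mul_apply, map_smul,
        ← Module.End.mul_apply (xOp (restrictObj V)) (xOp (restrictObj V) ^ (2 * i + 1)),
        ← pow_succ', map_sub, map_smul]
      push_cast
      module
  exact ⟨h1, step i h1⟩

/-- The weight space of `h` for the weight `2 i`. -/
noncomputable def weightSpace (V : RepOSp12 k) (i : ℤ) : Submodule k (restrictObj V).V :=
  Module.End.eigenspace (hOp V) ((2 * i : ℤ) : k)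

theorem mem_weightSpace {V : RepOSp12 k} {i : ℤ} {v : (restrictObj V).V} :
    v ∈ weightSpace V i ↔ hOp V v = ((2 * i : ℤ) : k) • v := Module.End.mem_eigenspace_iff

theorem parity_mem_weightSpace {V : RepOSp12 k} {i : ℤ} {v : (restrictObj V).V}
    (hv : v ∈ weightSpace V i) : (restrictObj V).parity v ∈ weightSpace V i := by
  rw [mem_weightSpace] at hv ⊢
  have h1 : hOp V ((restrictObj V).parity v) = (restrictObj V).parity (hOp V v) :=
    V.ev_parity_apply (ospH k) v
  rw [h1, hv, map_smul]

theorem xOp_mem_weightSpace {V : RepOSp12 k} {i : ℤ} {v : (restrictObj V).V}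
    (hv : v ∈ weightSpace V i) : xOp (restrictObj V) v ∈ weightSpace V (i - 1) := by
  rw [mem_weightSpace] at hv ⊢
  rw [hOp_xOp, hv, map_smul]
  push_cast
  module

/-- A vector `u` annihilated by `X ^ (n + 1)` with `n` even has weight `n` modulo lower steps:
`h u - n u` differs from `X Y u` by an element of `ker (X ^ n)`. -/
theorem hOp_sub_mem_of_even (V : RepOSp12 k) {n : ℕ} (hn : Even n) {u : (restrictObj V).V}
    (hu : (xOp (restrictObj V) ^ (n + 1)) u = 0) :
    hOp V u - (n : k) • u ∈ deligne (restrictObj V) (n - 1) := by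
  obtain ⟨i, rfl⟩ := hn
  rw [← two_mul] at hu ⊢
  have h1 := (pow_xOp_yOp V i u).1
  rw [hu, map_zero, neg_zero, zero_add] at h1
  have h2 : yOp V u ∈ deligne (restrictObj V) ((2 * i : ℕ) + 1) := by
    refine mem_deligne_of_pow_eq_zero (n := 2 * i + 2) ?_ (by push_cast; ring)
    have h3 := (pow_xOp_yOp V i u).2
    rw [hu, smul_zero, pow_succ' _ (2 * i + 1), Module.End.mul_apply, hu, map_zero, map_zero,
      zero_add, ← Module.End.mul_apply, ← pow_succ] at h3
    exact h3
  have h3 := xOp_mem_deligne _ _ _ h2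
  have h4 : (hOp V u - ((2 * i : ℕ) : k) • u) - xOp (restrictObj V) (yOp V u) ∈
      deligne (restrictObj V) ((2 * i : ℕ) - 1) := by
    refine mem_deligne_of_pow_eq_zero (n := 2 * i) ?_ (by ring)
    rw [map_sub _ _ (xOp (restrictObj V) (yOp V u)), h1]
    push_cast
    exact sub_self _
  rw [show ((2 * i : ℕ) : ℤ) + 1 - 2 = (2 * i : ℕ) - 1 by ring] at h3
  simpa using Submodule.add_mem _ h4 h3

variable [CharZero k]

/-- For `n` odd, a vector `u` annihilated by `X ^ (n + 1)` differs from a multiple of `X Y u` by an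
element of `ker (X ^ n)`, so there are no Jordan blocks of even size `n + 1`. -/
theorem mem_deligne_of_odd (V : RepOSp12 k) {n : ℕ} (hn : Odd n) {u : (restrictObj V).V}
    (hu : (xOp (restrictObj V) ^ (n + 1)) u = 0) : u ∈ deligne (restrictObj V) (n - 1) := by
  obtain ⟨i, rfl⟩ := hn
  have h1 := (pow_xOp_yOp V i u).2
  rw [hu, map_zero, zero_add] at h1
  have hc : (2 * i + 2 : k) ≠ 0 := by
    have : ((2 * i + 2 : ℕ) : k) ≠ 0 := Nat.cast_ne_zero.2 (by omega)
    simpa using this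
  have h2 : yOp V u ∈ deligne (restrictObj V) ((2 * i + 1 : ℕ) + 1) := by
    refine mem_deligne_of_pow_eq_zero (n := 2 * i + 1 + 2) ?_ (by push_cast; ring)
    have h3 := (pow_xOp_yOp V (i + 1) u).1
    rw [pow_succ', Module.End.mul_apply, show 2 * (i + 1) = 2 * i + 1 + 1 by ring, hu, map_zero,
      map_zero, neg_zero, zero_add, map_sub, map_smul, hu, smul_zero, sub_zero] at h3
    have h4 := hOp_pow_xOp V (2 * i + 1 + 1) u
    rw [hu, map_zero, smul_zero, sub_zero] at h4
    rw [← h4, ← Module.End.mul_apply, ← pow_succ] at h3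
    exact h3
  have h3 := xOp_mem_deligne _ _ _ h2
  have h4 : u - (2 * i + 2 : k)⁻¹ • xOp (restrictObj V) (yOp V u) ∈
      deligne (restrictObj V) ((2 * i + 1 : ℕ) - 1) := by
    refine mem_deligne_of_pow_eq_zero (n := 2 * i + 1) ?_ (by ring)
    rw [map_sub, map_smul, h1, smul_smul, inv_mul_cancel₀ hc, one_smul, sub_self]
  rw [show ((2 * i + 1 : ℕ) : ℤ) + 1 - 2 = (2 * i + 1 : ℕ) - 1 by ring] at h3
  simpa using Submodule.add_mem _ h4 (Submodule.smul_mem _ (2 * i + 2 : k)⁻¹ h3)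

/-- The Deligne filtration of the restriction of a representation of `OSp(1|2)` jumps in even
degrees only. -/
theorem deligne_restrict_odd (V : RepOSp12 k) (i : ℤ) :
    deligne (restrictObj V) (2 * i - 1) = deligne (restrictObj V) (2 * (i - 1)) := by
  refine le_antisymm (deligne_induction fun s n u hn hs hu => ?_) (deligne_mono _ (by omega))
  have hodd : Odd n := by
    have : Odd (n : ℤ) := ⟨i - 1 + s, by rw [hn]; ring⟩
    exact_mod_cast this
  exact pow_xOp_mem_deligne _ s (by omega) (mem_deligne_of_odd V hodd hu)

/-- `h` acts on the graded pieces of the Deligne filtration through the degree. -/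
theorem hOp_sub_mem (V : RepOSp12 k) (i : ℤ) {v : (restrictObj V).V}
    (hv : v ∈ deligne (restrictObj V) (2 * i)) :
    hOp V v - ((2 * i : ℤ) : k) • v ∈ deligne (restrictObj V) (2 * (i - 1)) := by
  have : deligne (restrictObj V) (2 * i) ≤ (deligne (restrictObj V) (2 * (i - 1))).comap
      (hOp V - ((2 * i : ℤ) : k) • (LinearMap.id : Module.End k (restrictObj V).V)) := by
    refine deligne_induction fun s n u hn hs hu => ?_
    have heven : Even n := by
      have : Even (n : ℤ) := ⟨i + s, by rw [hn]; ring⟩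
      exact_mod_cast this
    have h1 : (hOp V - ((2 * i : ℤ) : k) • (LinearMap.id : Module.End k (restrictObj V).V))
          ((xOp (restrictObj V) ^ s) u) =
        (xOp (restrictObj V) ^ s) (hOp V u - (n : k) • u) := by
      have hn' : (n : k) = ((2 * i : ℤ) : k) + 2 * s := by
        exact_mod_cast congr_arg (Int.cast : ℤ → k) hn
      rw [LinearMap.sub_apply, hOp_pow_xOp, map_sub, map_smul, hn']
      simp only [LinearMap.smul_apply, LinearMap.id_apply]
      module
    rw [Submodule.mem_comap, h1, ← deligne_restrict_odd]
    exact pow_xOp_mem_deligne _ s (by omega) (hOp_sub_mem_of_even V heven hu)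
  exact this hv

theorem mem_deligne_of_mem_weightSpace {V : RepOSp12 k} {i j : ℤ} (hij : j ≠ i)
    {v : (restrictObj V).V} (hv : v ∈ weightSpace V i)
    (hj : v ∈ deligne (restrictObj V) (2 * j)) : v ∈ deligne (restrictObj V) (2 * (j - 1)) := by
  have h := hOp_sub_mem V j hj
  rw [mem_weightSpace.1 hv, ← sub_smul, ← Int.cast_sub] at h
  have hc : ((2 * i - 2 * j : ℤ) : k) ≠ 0 := Int.cast_ne_zero.2 (by omega)
  exact (Submodule.smul_mem_iff _ hc).1 h

theorem weightSpace_le_deligne (V : RepOSp12 k) (i : ℤ) :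
    weightSpace V i ≤ deligne (restrictObj V) (2 * i) := by
  intro v hv
  obtain ⟨t, ht⟩ := (isDeligneFiltration_deligne (restrictObj V)).exists_eq_top
  have key : ∀ d : ℕ, v ∈ deligne (restrictObj V) (2 * (i + d)) →
      v ∈ deligne (restrictObj V) (2 * i) := by
    intro d
    induction d with
    | zero => simp
    | succ d ih =>
      intro h
      refine ih ?_
      convert mem_deligne_of_mem_weightSpace (by push_cast; omega) hv h using 2
      push_cast; ring
  refine key (t - 2 * i).toNat (deligne_mono _ (a := t) (by omega) ?_)
  rw [ht]; trivial

theorem eq_zero_of_mem_weightSpace {V : RepOSp12 k} {i : ℤ} {v : (restrictObj V).V}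
    (hv : v ∈ weightSpace V i) (h : v ∈ deligne (restrictObj V) (2 * i - 1)) : v = 0 := by
  obtain ⟨b, hb⟩ := (isDeligneFiltration_deligne (restrictObj V)).exists_eq_bot
  rw [deligne_restrict_odd] at h
  have key : ∀ d : ℕ, v ∈ deligne (restrictObj V) (2 * (i - 1 - d)) := by
    intro d
    induction d with
    | zero => simpa using h
    | succ d ih =>
      convert mem_deligne_of_mem_weightSpace (by omega) hv ih using 2
      push_cast; ring
  have h1 := deligne_mono _ (b := b) (by omega) (key (2 * (i - 1) - b).toNat)
  rwa [hb, Submodule.mem_bot] at h1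

/-- `h - 2 i` is surjective on the steps of the filtration below the degree `2 i`, since it acts
by a nonzero scalar on each of the graded pieces. -/
theorem exists_hOp_sub_eq (V : RepOSp12 k) {i j : ℤ} (hij : j < i) {w : (restrictObj V).V}
    (hw : w ∈ deligne (restrictObj V) (2 * j)) :
    ∃ v ∈ deligne (restrictObj V) (2 * j), hOp V v - ((2 * i : ℤ) : k) • v = w := by
  obtain ⟨b, hb⟩ := (isDeligneFiltration_deligne (restrictObj V)).exists_eq_bot
  have key : ∀ (d : ℕ) (j : ℤ) (w : (restrictObj V).V), j < i → 2 * j ≤ b + d →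
      w ∈ deligne (restrictObj V) (2 * j) →
      ∃ v ∈ deligne (restrictObj V) (2 * j), hOp V v - ((2 * i : ℤ) : k) • v = w := by
    intro d
    induction d with
    | zero =>
      intro j w hj hd hw
      have h1 := deligne_mono _ (b := b) (by omega) hw
      rw [hb, Submodule.mem_bot] at h1
      exact ⟨0, Submodule.zero_mem _, by simp [h1]⟩
    | succ d ih =>
      intro j w hj hd hw
      obtain ⟨v, hv, hvw⟩ := ih (j - 1) _ (by omega) (by omega) (hOp_sub_mem V j hw)
      have hc : ((2 * j - 2 * i : ℤ) : k) ≠ 0 := Int.cast_ne_zero.2 (by omega)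
      refine ⟨((2 * j - 2 * i : ℤ) : k)⁻¹ • (w - v), Submodule.smul_mem _ _
        (Submodule.sub_mem _ hw (deligne_mono _ (by omega) hv)), ?_⟩
      rw [map_smul, smul_comm _ _ (w - v), ← smul_sub, inv_smul_eq_iff₀ hc, map_sub, smul_sub]
      have h2 : hOp V w = (hOp V v - ((2 * i : ℤ) : k) • v) + ((2 * j : ℤ) : k) • w := by
        rw [hvw]; abel
      rw [h2]
      push_cast
      module
  exact key (2 * j - b).toNat j w hij (by omega) hw

/-- Elements of the graded pieces lift to weight vectors. -/
theorem exists_mem_weightSpace {V : RepOSp12 k} {i : ℤ} {v : (restrictObj V).V}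
    (hv : v ∈ deligne (restrictObj V) (2 * i)) :
    ∃ w ∈ weightSpace V i, v - w ∈ deligne (restrictObj V) (2 * i - 1) := by
  obtain ⟨r, hr, hrv⟩ := exists_hOp_sub_eq V (show i - 1 < i by omega) (hOp_sub_mem V i hv)
  refine ⟨v - r, mem_weightSpace.2 ?_, ?_⟩
  · rw [map_sub, smul_sub, sub_eq_sub_iff_sub_eq_sub, hrv]
  · rw [deligne_restrict_odd]
    simpa using hr

theorem isInternal_weightSpace (V : RepOSp12 k) : DirectSum.IsInternal (weightSpace V) := by
  refine DirectSum.isInternal_submodule_of_iSupIndep_of_iSup_eq_top ?_ ?_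
  · exact (Module.End.eigenspaces_iSupIndep (hOp V)).comp
      (f := fun i : ℤ => ((2 * i : ℤ) : k)) fun i j hij => by simpa using hij
  · obtain ⟨b, hb⟩ := (isDeligneFiltration_deligne (restrictObj V)).exists_eq_bot
    obtain ⟨t, ht⟩ := (isDeligneFiltration_deligne (restrictObj V)).exists_eq_top
    have key : ∀ (d : ℕ) (i : ℤ), 2 * i ≤ b + d →
        deligne (restrictObj V) (2 * i) ≤ ⨆ j, weightSpace V j := by
      intro d
      induction d with
      | zero =>
        intro i hi
        refine (deligne_mono _ (b := b) (by omega)).trans ?_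
        rw [hb]; exact bot_le
      | succ d ih =>
        intro i hi v hv
        obtain ⟨w, hw, hvw⟩ := exists_mem_weightSpace hv
        rw [deligne_restrict_odd] at hvw
        have := Submodule.add_mem _ (ih (i - 1) (by omega) hvw)
          (Submodule.mem_iSup_of_mem i hw)
        simpa using this
    rw [eq_top_iff, ← ht]
    refine le_trans (deligne_mono _ (b := 2 * t.toNat) (by omega))
      (key (2 * t.toNat - b).toNat _ (by omega))

theorem weightSpace_hom_ext {V : RepOSp12 k} {W : Type*} [AddCommMonoid W] [Module k W]
    {f g : (restrictObj V).V →ₗ[k] W} (h : ∀ i, ∀ v ∈ weightSpace V i, f v = g v) : f = g := by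
  have h1 : ⊤ ≤ LinearMap.eqLocus f g := by
    rw [← (isInternal_weightSpace V).submodule_iSup_eq_top]
    exact iSup_le fun i v hv => h i v hv
  exact LinearMap.ext fun v => h1 (show v ∈ ⊤ from trivial)

/-- The weight space of weight `2 i` is the graded piece of degree `2 i` of the Deligne
filtration. -/
noncomputable def weightEquiv (V : RepOSp12 k) (i : ℤ) :
    weightSpace V i ≃ₗ[k] Gr (restrictObj V) (2 * i) :=
  LinearEquiv.ofBijective ((Submodule.mkQ _) ∘ₗ
      Submodule.inclusion (weightSpace_le_deligne V i)) <| by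
    constructor
    · rw [← LinearMap.ker_eq_bot, LinearMap.ker_eq_bot']
      intro v hv
      rw [LinearMap.comp_apply, Submodule.mkQ_apply, Submodule.Quotient.mk_eq_zero] at hv
      exact Subtype.ext (eq_zero_of_mem_weightSpace v.2 hv)
    · intro a
      obtain ⟨⟨v, hv⟩, rfl⟩ := Submodule.Quotient.mk_surjective _ a
      obtain ⟨w, hw, hvw⟩ := exists_mem_weightSpace hv
      refine ⟨⟨w, hw⟩, ((Submodule.Quotient.eq _).2 ?_).symm⟩
      exact hvw

/-- The restriction of a representation of `OSp(1|2)` is canonically isomorphic to the even part of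
its associated graded. -/
noncomputable def grRestrict (V : RepOSp12 k) : (restrictObj V).V ≃ₗ[k] GrEv (restrictObj V) :=
  (LinearEquiv.ofBijective (DirectSum.coeLinearMap (weightSpace V))
    (isInternal_weightSpace V)).symm ≪≫ₗ DFinsupp.mapRange.linearEquiv (weightEquiv V)

theorem grRestrict_apply {V : RepOSp12 k} {i : ℤ} {v : (restrictObj V).V}
    (hv : v ∈ weightSpace V i) :
    grRestrict V v = GrEv.mk i v (weightSpace_le_deligne V i hv) := by
  have h1 : (LinearEquiv.ofBijective (DirectSum.coeLinearMap (weightSpace V))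
      (isInternal_weightSpace V)).symm v =
      DirectSum.lof k ℤ (fun i => weightSpace V i) i ⟨v, hv⟩ := by
    rw [LinearEquiv.symm_apply_eq]
    exact (DirectSum.coeLinearMap_lof (weightSpace V) i ⟨v, hv⟩).symm
  rw [grRestrict, LinearEquiv.trans_apply, h1]
  exact DFinsupp.mapRange_single
    (hf := fun i => (weightEquiv V i).map_zero)

theorem grRestrict_parity (V : RepOSp12 k) (v : (restrictObj V).V) :
    grRestrict V ((restrictObj V).parity v) = grParity (restrictObj V) (grRestrict V v) := by
  refine LinearMap.congr_fun (f := (grRestrict V).toLinearMap ∘ₗ (restrictObj V).parity)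
    (g := grParity (restrictObj V) ∘ₗ (grRestrict V).toLinearMap) ?_ v
  refine weightSpace_hom_ext fun i v hv => ?_
  simp only [LinearMap.comp_apply, LinearEquiv.coe_coe]
  rw [grRestrict_apply hv, grRestrict_apply (parity_mem_weightSpace hv), grParity_mk]

theorem grRestrict_xOp (V : RepOSp12 k) (v : (restrictObj V).V) :
    grRestrict V (xOp (restrictObj V) v) = grX (restrictObj V) (grRestrict V v) := by
  refine LinearMap.congr_fun (f := (grRestrict V).toLinearMap ∘ₗ xOp (restrictObj V))
    (g := grX (restrictObj V) ∘ₗ (grRestrict V).toLinearMap) ?_ v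
  refine weightSpace_hom_ext fun i v hv => ?_
  simp only [LinearMap.comp_apply, LinearEquiv.coe_coe]
  rw [grRestrict_apply hv, grRestrict_apply (xOp_mem_weightSpace hv), grX_mk]

theorem grRestrict_hOp (V : RepOSp12 k) (v : (restrictObj V).V) :
    grRestrict V (hOp V v) = grH (restrictObj V) (grRestrict V v) := by
  refine LinearMap.congr_fun (f := (grRestrict V).toLinearMap ∘ₗ hOp V)
    (g := grH (restrictObj V) ∘ₗ (grRestrict V).toLinearMap) ?_ v
  refine weightSpace_hom_ext fun i v hv => ?_
  simp only [LinearMap.comp_apply, LinearEquiv.coe_coe]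
  rw [mem_weightSpace.1 hv, map_smul, grRestrict_apply hv, grH_mk]

/-- A linear map raising weights by `2` and anticommuting with `X` vanishes: it preserves
the Deligne filtration, but weights are degrees. -/
theorem eq_zero_of_anticommutes {V W : RepOSp12 k} (D : (restrictObj V).V →ₗ[k] (restrictObj W).V)
    (hx : ∀ v, D (xOp (restrictObj V) v) = -xOp (restrictObj W) (D v))
    (hh : ∀ v, hOp W (D v) = D (hOp V v) + (2 : k) • D v) : D = 0 := by
  have hpow : ∀ (n : ℕ) v, D ((xOp (restrictObj V) ^ n) v) =
      (-1 : k) ^ n • (xOp (restrictObj W) ^ n) (D v) := by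
    intro n v
    induction n with
    | zero => simp
    | succ n ih =>
      rw [pow_succ', pow_succ' (xOp (restrictObj W)), Module.End.mul_apply, Module.End.mul_apply,
        hx, ih, map_smul, pow_succ]
      simp
  refine weightSpace_hom_ext fun i v hv => ?_
  rw [LinearMap.zero_apply]
  have h1 : D v ∈ weightSpace W (i + 1) := by
    rw [mem_weightSpace] at hv ⊢
    rw [hh, hv, map_smul]
    push_cast
    module
  refine eq_zero_of_mem_weightSpace h1 (deligne_mono _ (a := 2 * i) (by omega) ?_)
  refine map_mem_deligne D (fun s v hv hv' => mem_deligne s ?_ ?_) v (weightSpace_le_deligne V i hv)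
  · have h2 := hpow (2 * i + s + 1).toNat v
    rw [hv, map_zero, eq_comm, smul_eq_zero] at h2
    exact h2.resolve_left (pow_ne_zero _ (neg_ne_zero.2 one_ne_zero))
  · obtain ⟨u, rfl⟩ := hv'
    exact ⟨(-1 : k) ^ s • D u, by rw [map_smul, hpow]⟩

/-- An even linear map commuting with `h` and `X` is a morphism of representations
of `OSp(1|2)`. -/
def ospHom {V W : RepOSp12 k} (f : (restrictObj V).V →ₗ[k] (restrictObj W).V)
    (hp : ∀ v, f ((restrictObj V).parity v) = (restrictObj W).parity (f v))
    (hx : ∀ v, f (xOp (restrictObj V) v) = xOp (restrictObj W) (f v))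
    (hh : ∀ v, f (hOp V v) = hOp W (f v)) : V ⟶ W :=
  have hY : f ∘ₗ yOp V - yOp W ∘ₗ f = 0 := eq_zero_of_anticommutes _
    (fun v => by
      simp only [LinearMap.sub_apply, LinearMap.comp_apply, map_sub, ← hx, xOp_yOp, hh]
      abel)
    (fun v => by
      simp only [LinearMap.sub_apply, LinearMap.comp_apply, map_sub, ← hh, hOp_yOp, map_add,
        map_smul]
      module)
  ospHomOfCommutes f hp
    (fun v => (congr_arg f (xOp_restrict V v).symm).trans ((hx v).trans (xOp_restrict W (f v))))
    (fun v => sub_eq_zero.1 (LinearMap.congr_fun hY v))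

/-- A morphism from the restriction of a representation of `OSp(1|2)` which vanishes on the
associated graded is negligible, since its composition with any morphism is nilpotent. -/
theorem negligible_of_grHom_eq_zero {V : RepOSp12 k} {N : RepGa11 k} (f : restrictObj V ⟶ N)
    (hf : grHom f = 0) : Negligible f := by
  rw [negligible_iff_trace]
  intro g
  -- `A` lowers the degree by `2`, hence is nilpotent
  set A := (restrictObj V).parity ∘ₗ SRep.lin g ∘ₗ SRep.lin f with hA
  have h1 : ∀ i v, v ∈ deligne (restrictObj V) (2 * i) →
      A v ∈ deligne (restrictObj V) (2 * (i - 1)) := by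
    intro i v hv
    have h2 := LinearMap.congr_fun hf (GrEv.mk i v hv)
    have h0 : GrEv.mk (M := N) i 0 (Submodule.zero_mem _) = 0 := by
      have := GrEv.mk_smul (M := N) i 0 0 (Submodule.zero_mem _)
      simpa only [zero_smul] using this
    rw [grHom_mk, LinearMap.zero_apply, ← h0, GrEv.mk_eq_mk_iff, sub_zero] at h2
    rw [← deligne_restrict_odd]
    exact parity_mem_deligne _ _ _ (lin_mem_deligne g _ _ h2)
  have h2 : ∀ (n : ℕ) i v, v ∈ deligne (restrictObj V) (2 * i) →
      (A ^ n) v ∈ deligne (restrictObj V) (2 * (i - n)) := by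
    intro n i v hv
    induction n with
    | zero => simpa using hv
    | succ n ih =>
      rw [pow_succ', Module.End.mul_apply]
      convert h1 _ _ ih using 2; push_cast; ring
  obtain ⟨b, hb⟩ := (isDeligneFiltration_deligne (restrictObj V)).exists_eq_bot
  obtain ⟨t, ht⟩ := (isDeligneFiltration_deligne (restrictObj V)).exists_eq_top
  have h3 : IsNilpotent A := by
    refine ⟨t.toNat + (-b).toNat, LinearMap.ext fun v => ?_⟩
    have h4 := h2 (t.toNat + (-b).toNat) t.toNat v
      (deligne_mono _ (a := t) (by omega) (by rw [ht]; trivial))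
    have h5 := deligne_mono _ (b := b) (by push_cast; omega) h4
    rwa [hb, Submodule.mem_bot] at h5
  exact (LinearMap.isNilpotent_trace_of_isNilpotent h3).eq_zero

end Weights

/-! ### Constructions of representations -/

namespace SRep

variable {k : Type u} [Field k] {L : HarishChandra k}

/-- The change of parity of a representation. -/
noncomputable def shift (M : SRep L) : SRep L where
  V := M.V
  parity := -M.parity
  parity_sq := by rw [neg_mul_neg, M.parity_sq]
  action :=
    { ev := M.action.ev
      od := M.action.od
      ev_parity := fun a => by rw [mul_neg, neg_mul, M.action.ev_parity]
      od_parity := fun x => by rw [mul_neg, neg_mul, M.action.od_parity]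
      ev_lie := M.action.ev_lie
      od_act := M.action.od_act
      ev_bracket := M.action.ev_bracket }
  ρ := M.ρ
  ρ_parity g := by rw [mul_neg, neg_mul, M.ρ_parity]
  algebraic := M.algebraic

/-- The direct sum of two representations. -/
noncomputable def prod (M N : SRep L) : SRep L where
  V := M.V × N.V
  parity := M.parity.prodMap N.parity
  parity_sq := by
    ext v <;> simp [parity_parity]
  action :=
    { ev :=
        { toFun := fun a => (M.action.ev a).prodMap (N.action.ev a)
          map_add' := fun a b => by ext v <;> simp
          map_smul' := fun c a => by ext v <;> simp }
      od :=
        { toFun := fun a => (M.action.od a).prodMap (N.action.od a)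
          map_add' := fun a b => by ext v <;> simp
          map_smul' := fun c a => by ext v <;> simp }
      ev_parity := fun a => by ext v <;> simp [ev_parity_apply]
      od_parity := fun a => by ext v <;> simp [od_parity_apply]
      ev_lie := fun a b => by ext v <;> simp [ev_lie_apply]
      od_act := fun a x => by ext v <;> simp [od_act_apply]
      ev_bracket := fun x y => by ext v <;> simp [ev_bracket_apply] }
  ρ :=
    { toFun := fun g => (M.ρ g).prodMap (N.ρ g)
      map_one' := by ext v <;> simp
      map_mul' := fun g h => by ext v <;> simp }
  ρ_parity g := by ext v <;> simp [ρ_parity_apply]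
  algebraic φ v := by
    have h := (M.algebraic (φ ∘ₗ LinearMap.inl k M.V N.V) v.1).add
      (N.algebraic (φ ∘ₗ LinearMap.inr k M.V N.V) v.2)
    convert h using 2
    · simp [← map_add]
    · simp [← map_add]

/-- The first inclusion into a direct sum. -/
noncomputable def inl (M N : SRep L) : M ⟶ M.prod N :=
  (⟨LinearMap.inl k M.V N.V, fun _ => Prod.ext rfl N.parity.map_zero.symm,
    fun a _ => Prod.ext rfl (N.action.ev a).map_zero.symm,
    fun a _ => Prod.ext rfl (N.action.od a).map_zero.symm,
    fun g _ => Prod.ext rfl (N.ρ g).map_zero.symm⟩ : Hom M (M.prod N))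

/-- The second inclusion into a direct sum. -/
noncomputable def inr (M N : SRep L) : N ⟶ M.prod N :=
  (⟨LinearMap.inr k M.V N.V, fun _ => Prod.ext M.parity.map_zero.symm rfl,
    fun a _ => Prod.ext (M.action.ev a).map_zero.symm rfl,
    fun a _ => Prod.ext (M.action.od a).map_zero.symm rfl,
    fun g _ => Prod.ext (M.ρ g).map_zero.symm rfl⟩ : Hom N (M.prod N))

/-- The first projection from a direct sum. -/
noncomputable def fst (M N : SRep L) : M.prod N ⟶ M :=
  (⟨LinearMap.fst k M.V N.V, fun _ => rfl, fun _ _ => rfl, fun _ _ => rfl, fun _ _ => rfl⟩ :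
    Hom (M.prod N) M)

/-- The second projection from a direct sum. -/
noncomputable def snd (M N : SRep L) : M.prod N ⟶ N :=
  (⟨LinearMap.snd k M.V N.V, fun _ => rfl, fun _ _ => rfl, fun _ _ => rfl, fun _ _ => rfl⟩ :
    Hom (M.prod N) N)

/-- The image of an endomorphism, as a subrepresentation. -/
noncomputable def image {M : SRep L} (e : M ⟶ M) : SRep L :=
  have hp : ∀ v ∈ LinearMap.range (lin e), M.parity v ∈ LinearMap.range (lin e) := by
    rintro _ ⟨v, rfl⟩; exact ⟨_, e.parity v⟩
  have hev : ∀ a, ∀ v ∈ LinearMap.range (lin e), M.action.ev a v ∈ LinearMap.range (lin e) := by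
    rintro a _ ⟨v, rfl⟩; exact ⟨_, e.ev a v⟩
  have hod : ∀ a, ∀ v ∈ LinearMap.range (lin e), M.action.od a v ∈ LinearMap.range (lin e) := by
    rintro a _ ⟨v, rfl⟩; exact ⟨_, e.od a v⟩
  have hρ : ∀ g, ∀ v ∈ LinearMap.range (lin e), M.ρ g v ∈ LinearMap.range (lin e) := by
    rintro g _ ⟨v, rfl⟩; exact ⟨_, e.ρ g v⟩
  { V := LinearMap.range (lin e)
    parity := M.parity.restrict hp
    parity_sq := by ext v; simp [parity_parity]
    action :=
      { ev :=
          { toFun := fun a => (M.action.ev a).restrict (hev a)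
            map_add' := fun a b => by ext v; simp
            map_smul' := fun c a => by ext v; simp }
        od :=
          { toFun := fun a => (M.action.od a).restrict (hod a)
            map_add' := fun a b => by ext v; simp
            map_smul' := fun c a => by ext v; simp }
        ev_parity := fun a => by ext v; simp [ev_parity_apply]
        od_parity := fun a => by ext v; simp [od_parity_apply]
        ev_lie := fun a b => by ext v; simp [ev_lie_apply]
        od_act := fun a x => by ext v; simp [od_act_apply]
        ev_bracket := fun x y => by ext v; simp [ev_bracket_apply] }
    ρ :=
      { toFun := fun g => (M.ρ g).restrict (hρ g)
        map_one' := by ext v; simp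
        map_mul' := fun g h => by ext v; simp }
    ρ_parity := fun g => by ext v; simp [ρ_parity_apply]
    algebraic := fun φ v => by
      obtain ⟨ψ, hψ⟩ := φ.exists_extend
      subst hψ
      exact M.algebraic ψ v }

/-- Idempotents split. -/
theorem exists_split {M : SRep L} (e : M ⟶ M) (he : e ≫ e = e) :
    ∃ (N : SRep L) (i : N ⟶ M) (r : M ⟶ N), i ≫ r = 𝟙 N ∧ r ≫ i = e := by
  refine ⟨image e, (⟨(LinearMap.range (lin e)).subtype, fun _ => rfl, fun _ _ => rfl,
      fun _ _ => rfl, fun _ _ => rfl⟩ : Hom (image e) M),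
    (⟨(lin e).rangeRestrict, fun v => Subtype.ext (e.parity v),
      fun a v => Subtype.ext (e.ev a v), fun a v => Subtype.ext (e.od a v),
      fun g v => Subtype.ext (e.ρ g v)⟩ : Hom M (image e)), ?_, rfl⟩
  refine hom_ext (LinearMap.ext ?_)
  rintro ⟨_, v, rfl⟩
  exact Subtype.ext (LinearMap.congr_fun (congr_arg lin he) v)

end SRep

/-! ### Representations of `OSp(1|2)` with a long Jordan block -/

section Standard

variable {k : Type u} [Field k]

theorem mulVec_fin_two (A : Matrix (Fin 2) (Fin 2) k) (v : Fin 2 → k) (i : Fin 2) :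
    A.mulVec v i = A i 0 * v 0 + A i 1 * v 1 := by
  simp [Matrix.mulVec, dotProduct, Fin.sum_univ_two]

variable (k) in
/-- The standard representation of `OSp(1|2)` on `k^(2|1)`. -/
noncomputable def ospStandard : RepOSp12 k where
  V := (Fin 2 → k) × k
  parity := LinearMap.id.prodMap (-LinearMap.id)
  parity_sq := by ext v <;> simp
  action :=
    { ev := (LinearMap.mk₂ k (fun (a : LieAlgebra.SpecialLinear.sl (Fin 2) k)
          (v : (Fin 2 → k) × k) => ((a.1.mulVec v.1, 0) : (Fin 2 → k) × k))
          (fun a b v => Prod.ext (Matrix.add_mulVec a.1 b.1 v.1) (add_zero 0).symm)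
          (fun c a v => Prod.ext (Matrix.smul_mulVec c a.1 v.1) (smul_zero c).symm)
          (fun a v w => Prod.ext (Matrix.mulVec_add a.1 v.1 w.1) (add_zero 0).symm)
          (fun c a v => Prod.ext (Matrix.mulVec_smul a.1 c v.1) (smul_zero c).symm) :
          LieAlgebra.SpecialLinear.sl (Fin 2) k →ₗ[k] _)
      od := (LinearMap.mk₂ k (fun (w : Fin 2 → k)
          (v : (Fin 2 → k) × k) => ((v.2 • w, v.1 0 * w 1 - v.1 1 * w 0) : (Fin 2 → k) × k))
          (fun a b v => by ext <;> simp <;> ring)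
          (fun c a v => by ext <;> simp <;> ring)
          (fun a v w => by ext <;> simp <;> ring)
          (fun c a v => by ext <;> simp <;> ring) :
          (Fin 2 → k) →ₗ[k] _)
      ev_parity := fun (a : LieAlgebra.SpecialLinear.sl (Fin 2) k) => by
        refine LinearMap.ext fun v => ?_
        change (a.1.mulVec v.1, (0 : k)) = (a.1.mulVec v.1, -(0 : k))
        rw [neg_zero]
      od_parity := fun (w : Fin 2 → k) => by
        refine LinearMap.ext fun v => ?_
        change ((-v.2) • w, v.1 0 * w 1 - v.1 1 * w 0) =
          -(v.2 • w, -(v.1 0 * w 1 - v.1 1 * w 0))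
        ext <;> simp
      ev_lie := fun (a b : LieAlgebra.SpecialLinear.sl (Fin 2) k) => by
        refine LinearMap.ext fun v => ?_
        change ((a.1 * b.1 - b.1 * a.1).mulVec v.1, (0 : k)) =
          (a.1.mulVec (b.1.mulVec v.1), (0 : k)) - (b.1.mulVec (a.1.mulVec v.1), (0 : k))
        rw [Matrix.sub_mulVec, Matrix.mulVec_mulVec, Matrix.mulVec_mulVec]
        exact Prod.ext rfl (sub_zero 0).symm
      od_act := fun (a : LieAlgebra.SpecialLinear.sl (Fin 2) k) (w : Fin 2 → k) => by
        refine LinearMap.ext fun v => ?_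
        have ha : a.1 0 0 + a.1 1 1 = 0 := by
          have h : Matrix.trace a.1 = 0 := a.2
          rwa [Matrix.trace_fin_two] at h
        change (v.2 • a.1.mulVec w, v.1 0 * a.1.mulVec w 1 - v.1 1 * a.1.mulVec w 0) =
          (a.1.mulVec (v.2 • w), (0 : k)) -
            ((0 : k) • w, a.1.mulVec v.1 0 * w 1 - a.1.mulVec v.1 1 * w 0)
        refine Prod.ext ?_ ?_
        · change v.2 • a.1.mulVec w = a.1.mulVec (v.2 • w) - (0 : k) • w
          rw [Matrix.mulVec_smul, zero_smul, sub_zero]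
        · change v.1 0 * a.1.mulVec w 1 - v.1 1 * a.1.mulVec w 0 =
            0 - (a.1.mulVec v.1 0 * w 1 - a.1.mulVec v.1 1 * w 0)
          simp only [mulVec_fin_two]
          linear_combination (v.1 0 * w 1 - v.1 1 * w 0) * ha
      ev_bracket := fun (w w' : Fin 2 → k) => by
        refine LinearMap.ext fun v => ?_
        change ((ospBracket k w w').1.mulVec v.1, (0 : k)) =
          ((v.1 0 * w' 1 - v.1 1 * w' 0) • w, (v.2 • w') 0 * w 1 - (v.2 • w') 1 * w 0) +
          ((v.1 0 * w 1 - v.1 1 * w 0) • w', (v.2 • w) 0 * w' 1 - (v.2 • w) 1 * w' 0)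
        rw [ospBracket_mulVec]
        refine Prod.ext (funext fun i => ?_) ?_
        · simp; ring
        · simp; ring }
  ρ :=
    { toFun := fun (g : Matrix.SpecialLinearGroup (Fin 2) k) =>
        g.1.mulVecLin.prodMap LinearMap.id
      map_one' := by
        refine LinearMap.ext fun v => ?_
        change ((1 : Matrix (Fin 2) (Fin 2) k).mulVec v.1, v.2) = v
        rw [Matrix.one_mulVec]
      map_mul' := fun (g h : Matrix.SpecialLinearGroup (Fin 2) k) => by
        refine LinearMap.ext fun v => ?_
        change ((g.1 * h.1).mulVec v.1, v.2) = (g.1.mulVec (h.1.mulVec v.1), v.2)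
        rw [Matrix.mulVec_mulVec] }
  ρ_parity _ := rfl
  algebraic φ v := by
    obtain ⟨a₀, a₁, b, hφ⟩ : ∃ a₀ a₁ b : k, ∀ (w : Fin 2 → k) (c : k),
        φ (w, c) = w 0 * a₀ + w 1 * a₁ + c * b := by
      refine ⟨φ (Pi.single 0 1, 0), φ (Pi.single 1 1, 0), φ (0, 1), fun w c => ?_⟩
      have : ((w, c) : (Fin 2 → k) × k) = w 0 • (Pi.single 0 1, 0) + w 1 • (Pi.single 1 1, 0) +
          c • (0, 1) := by
        ext i
        · fin_cases i <;> simp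
        · simp
      rw [this, map_add, map_add, map_smul, map_smul, map_smul]; rfl
    let p : MvPolynomial (Fin 2 × Fin 2) k :=
      MvPolynomial.C (a₀ * v.1 0) * MvPolynomial.X (0, 0) +
      MvPolynomial.C (a₀ * v.1 1) * MvPolynomial.X (0, 1) +
      MvPolynomial.C (a₁ * v.1 0) * MvPolynomial.X (1, 0) +
      MvPolynomial.C (a₁ * v.1 1) * MvPolynomial.X (1, 1) + MvPolynomial.C (v.2 * b)
    have h1 : ∀ A : Matrix (Fin 2) (Fin 2) k,
        MvPolynomial.eval (fun q : Fin 2 × Fin 2 => A q.1 q.2) p = φ (A.mulVec v.1, v.2) := by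
      intro A
      rw [hφ]
      simp only [p, map_add, map_mul, MvPolynomial.eval_C, MvPolynomial.eval_X, mulVec_fin_two]
      ring
    have h2 : ∀ A : Matrix (Fin 2) (Fin 2) k,
        (MvPolynomial.aeval (fun q : Fin 2 × Fin 2 =>
          (TrivSqZeroExt.inl ((1 : Matrix (Fin 2) (Fin 2) k) q.1 q.2) +
            TrivSqZeroExt.inr (A q.1 q.2) : DualNumber k)) p).snd = φ (A.mulVec v.1, 0) := by
      intro A
      rw [hφ]
      simp [p, mulVec_fin_two, TrivSqZeroExt.algebraMap_eq_inl]
      ring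
    exact ⟨p, fun (g : Matrix.SpecialLinearGroup (Fin 2) k) => h1 g.1,
      fun (a : LieAlgebra.SpecialLinear.sl (Fin 2) k) => h2 a.1⟩

/-- The vector of the standard representation with even part `v` and odd part `c`. -/
def ospVec (v : Fin 2 → k) (c : k) : (ospStandard k).V := ((v, c) : (Fin 2 → k) × k)

theorem exists_ospVec (v : (ospStandard k).V) : ∃ w c, v = ospVec w c := by
  obtain ⟨w, c⟩ : (Fin 2 → k) × k := v
  exact ⟨w, c, rfl⟩

theorem ospStandard_od (v : Fin 2 → k) (c : k) :
    (ospStandard k).action.od (ospX k) (ospVec v c) = ospVec ![0, c] (v 0) := by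
  change ((c • ![0, 1], v 0 * 1 - v 1 * 0) : (Fin 2 → k) × k) = (![0, c], v 0)
  simp

theorem ospVec_zero : ospVec 0 0 = (0 : (ospStandard k).V) := rfl

theorem ospStandard_od_cube (v : (ospStandard k).V) : (ospStandard k).action.od (ospX k)
    (((ospStandard k).action.od (ospX k) ^ 2) v) = 0 := by
  obtain ⟨w, c, rfl⟩ := exists_ospVec v
  rw [pow_two, Module.End.mul_apply, ospStandard_od, ospStandard_od, ospStandard_od,
    ← ospVec_zero]
  congr 1
  ext i
  fin_cases i <;> rfl

theorem tensor_od {L : HarishChandra k} (V W : SRep L) (x : L.odd) (v : V.V) (w : W.V) :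
    (SRep.tensor V W).action.od x (v ⊗ₜ w) =
      V.action.od x v ⊗ₜ w + V.parity v ⊗ₜ W.action.od x w := rfl

/-- The square of an odd operator satisfies the Leibniz rule without signs. -/
theorem tensor_od_od {L : HarishChandra k} (V W : SRep L) (x : L.odd) (v : V.V) (w : W.V) :
    (SRep.tensor V W).action.od x ((SRep.tensor V W).action.od x (v ⊗ₜ w)) =
      V.action.od x (V.action.od x v) ⊗ₜ w + v ⊗ₜ W.action.od x (W.action.od x w) := by
  rw [tensor_od, map_add, tensor_od, tensor_od, SRep.od_parity_apply, SRep.parity_parity,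
    TensorProduct.neg_tmul]
  abel

/-- The binomial expansion of `(X ^ 2) ^ (m + 1)` on the tensor product with the standard
representation has two terms only, since `X ^ 3 = 0` there. -/
theorem ospStandard_tensor (W : RepOSp12 k) (m : ℕ) (v : (ospStandard k).V) (w : W.V) :
    ((SRep.tensor (ospStandard k) W).action.od (ospX k) ^ (2 * (m + 1))) (v ⊗ₜ w) =
      v ⊗ₜ (W.action.od (ospX k) ^ (2 * (m + 1))) w + (m + 1 : k) •
        (((ospStandard k).action.od (ospX k) ^ 2) v ⊗ₜ (W.action.od (ospX k) ^ (2 * m)) w) := by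
  have hsq : ∀ (U : RepOSp12 k) (n : ℕ) (u : U.V), (U.action.od (ospX k) ^ (2 * (n + 1))) u =
      U.action.od (ospX k) (U.action.od (ospX k) ((U.action.od (ospX k) ^ (2 * n)) u)) := by
    intro U n u
    rw [show 2 * (n + 1) = 2 * n + 1 + 1 by ring, pow_succ', pow_succ']; rfl
  induction m with
  | zero =>
    rw [hsq, hsq]
    simp only [mul_zero, pow_zero, Module.End.one_apply, Nat.cast_zero, zero_add, one_smul]
    rw [tensor_od_od, pow_two, Module.End.mul_apply, add_comm]
  | succ m ih =>
    rw [hsq (SRep.tensor (ospStandard k) W), ih, map_add, map_add, map_smul, map_smul,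
      tensor_od_od, tensor_od_od, ospStandard_od_cube, map_zero, TensorProduct.zero_tmul, zero_add,
      ← hsq, ← hsq, pow_two, Module.End.mul_apply]
    push_cast
    module

variable [CharZero k]

/-- There are representations of `OSp(1|2)` on which `X` is nilpotent of any given odd order: they
arise from the powers of the standard representation. -/
theorem exists_od_pow (a : ℕ) : ∃ V : RepOSp12 k,
    V.action.od (ospX k) ^ (2 * a + 1) = 0 ∧ V.action.od (ospX k) ^ (2 * a) ≠ 0 := by
  induction a with
  | zero =>
    refine ⟨SRep.triv (osp12 k), by simp, ?_⟩
    rw [mul_zero, pow_zero]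
    exact one_ne_zero (α := Module.End k k)
  | succ m ih =>
    obtain ⟨W, hW, hW'⟩ := ih
    have key : ∀ (v : (ospStandard k).V) (w : W.V),
        ((SRep.tensor (ospStandard k) W).action.od (ospX k) ^ (2 * (m + 1))) (v ⊗ₜ w) =
        (m + 1 : k) • (((ospStandard k).action.od (ospX k) ^ 2) v ⊗ₜ[k]
          (W.action.od (ospX k) ^ (2 * m)) w) := by
      intro v w
      rw [ospStandard_tensor, show 2 * (m + 1) = 1 + (2 * m + 1) by ring, pow_add _ 1, hW,
        mul_zero, LinearMap.zero_apply, TensorProduct.tmul_zero, zero_add]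
    refine ⟨SRep.tensor (ospStandard k) W, TensorProduct.ext' fun v w => ?_, fun h => ?_⟩
    · rw [pow_succ', Module.End.mul_apply, key, map_smul, tensor_od, ospStandard_od_cube,
        ← Module.End.mul_apply (W.action.od (ospX k)), ← pow_succ', hW]
      simp
    · obtain ⟨w, hw⟩ : ∃ w, (W.action.od (ospX k) ^ (2 * m)) w ≠ 0 := by
        by_contra! hc
        exact hW' (LinearMap.ext hc)
      have h1 := LinearMap.congr_fun h (ospVec ![1, 0] 0 ⊗ₜ[k] w)
      rw [key, LinearMap.zero_apply, smul_eq_zero] at h1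
      have h2 := h1.resolve_left (by exact_mod_cast Nat.succ_ne_zero m)
      have h3 : ((ospStandard k).action.od (ospX k) ^ 2) (ospVec ![1, 0] 0) ≠ 0 := by
        rw [pow_two, Module.End.mul_apply, ospStandard_od, ospStandard_od]
        intro h4
        have h5 : (![0, 1] : Fin 2 → k) = 0 := congr_arg Prod.fst
          (h4 : ((![0, 1], 0) : (Fin 2 → k) × k) = (0, 0))
        exact one_ne_zero (congr_fun h5 1)
      obtain ⟨φ, hφ⟩ := Module.Projective.exists_dual_ne_zero k h3
      obtain ⟨ψ, hψ⟩ := Module.Projective.exists_dual_ne_zero k hw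
      have h6 := congr_arg (LinearMap.mul' k k ∘ₗ TensorProduct.map φ ψ) h2
      rw [LinearMap.comp_apply, TensorProduct.map_tmul, LinearMap.mul'_apply, map_zero] at h6
      exact mul_ne_zero hφ hψ h6

end Standard

/-! ### Every object is a summand of a restricted one, up to negligible morphisms -/

section Summand

variable {k : Type u} [Field k]

theorem pow_xOp_restrict (V : RepOSp12 k) (n : ℕ) :
    xOp (restrictObj V) ^ n = V.action.od (ospX k) ^ n := by
  have : xOp (restrictObj V) = V.action.od (ospX k) := LinearMap.ext (xOp_restrict V)
  exact congr_arg (· ^ n) this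

variable [CharZero k]

/-- A homogeneous vector generating a Jordan block has a homogeneous dual functional. -/
theorem exists_dual_generator {M : RepGa11 k} {n : ℕ} {ε : k} {p : M.V} (hε : ε * ε = 1)
    (hp : M.parity p = ε • p) (hne : (xOp M ^ n) p ≠ 0) (hx : (xOp M ^ (n + 1)) p = 0) :
    ∃ ξ : Module.Dual k M.V, ξ ((xOp M ^ n) p) = 1 ∧ (∀ l < n, ξ ((xOp M ^ l) p) = 0) ∧
      ∀ u, ξ (M.parity u) = ((-1) ^ n * ε) * ξ u := by
  -- subtracting a multiple of `ξ ∘ x ^ (d + 1)` corrects the value of `ξ` at `x ^ (n - (d + 1)) p`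
  have key : ∀ d ≤ n, ∃ ξ : Module.Dual k M.V, ξ ((xOp M ^ n) p) = 1 ∧
      ∀ l < n, n ≤ l + d → ξ ((xOp M ^ l) p) = 0 := by
    intro d
    induction d with
    | zero =>
      intro _
      obtain ⟨ξ, hξ⟩ := Module.Projective.exists_dual_eq_one k hne
      exact ⟨ξ, hξ, fun l hl hl' => absurd hl' (by omega)⟩
    | succ d ih =>
      intro hd
      obtain ⟨ξ, h1, h0⟩ := ih (by omega)
      have hz : ∀ m, n < m → (xOp M ^ m) p = 0 := fun m hm => by
        rw [show m = (m - (n + 1)) + (n + 1) by omega, pow_add, Module.End.mul_apply, hx, map_zero]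
      have hs : ∀ l, (ξ - ξ ((xOp M ^ (n - (d + 1))) p) • ξ ∘ₗ (xOp M ^ (d + 1)))
          ((xOp M ^ l) p) = ξ ((xOp M ^ l) p) -
            ξ ((xOp M ^ (n - (d + 1))) p) * ξ ((xOp M ^ (d + 1 + l)) p) := fun l => by
        rw [LinearMap.sub_apply, LinearMap.smul_apply, LinearMap.comp_apply,
          ← Module.End.mul_apply, ← pow_add, smul_eq_mul]
      refine ⟨ξ - ξ ((xOp M ^ (n - (d + 1))) p) • ξ ∘ₗ (xOp M ^ (d + 1)), ?_, fun l hl hl' => ?_⟩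
      · rw [hs, h1, hz (d + 1 + n) (by omega), map_zero, mul_zero, sub_zero]
      · rw [hs]
        obtain h | h := eq_or_lt_of_le hl'
        · rw [show d + 1 + l = n by omega, h1, mul_one, show n - (d + 1) = l by omega, sub_self]
        · rw [h0 l hl (by omega), hz (d + 1 + l) (by omega), map_zero, mul_zero, sub_zero]
  obtain ⟨ξ, h1, h0⟩ := key n le_rfl
  have hσ : ((-1) ^ n * ε) * ((-1) ^ n * ε) = 1 := by
    rw [mul_mul_mul_comm, hε, ← mul_pow]; simp
  obtain ⟨ξ', h2, h3, h4⟩ := exists_homogeneous_dual M ξ hσ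
  refine ⟨ξ', ?_, fun l hl => h4 _ (h0 l hl (by omega)) ?_, h2⟩
  · rw [h3 _ (parity_pow_xOp hp n), h1]
  · rw [parity_pow_xOp hp, map_smul, h0 l hl (by omega), smul_zero]

theorem SRep.exists_homogeneous {L : HarishChandra k} (M : SRep L) {W : Type*} [AddCommMonoid W]
    [Module k W] {f : M.V →ₗ[k] W} (hf : f ≠ 0) :
    ∃ (ε : k) (u : M.V), ε * ε = 1 ∧ M.parity u = ε • u ∧ f u ≠ 0 := by
  obtain ⟨w, hw⟩ : ∃ w, f w ≠ 0 := by
    by_contra! hc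
    exact hf (LinearMap.ext hc)
  obtain ⟨u₀, u₁, h₀, h₁, rfl⟩ := M.exists_even_add_odd w
  by_cases h : f u₀ = 0
  · exact ⟨-1, u₁, by simp, by rw [h₁, neg_one_smul],
      fun h' => hw (by rw [map_add, h, h', add_zero])⟩
  · exact ⟨1, u₀, by simp, by rw [h₀, one_smul], h⟩

/-- A restricted representation with a Jordan block of size `2 a + 1` of given parity, and no
longer ones. -/
theorem exists_restrict_generator (a : ℕ) {ε : k} (hε : ε * ε = 1) :
    ∃ (V : RepOSp12 k) (q : (restrictObj V).V) (η : Module.Dual k (restrictObj V).V),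
      (restrictObj V).parity q = ε • q ∧ xOp (restrictObj V) ^ (2 * a + 1) = 0 ∧
      (∀ u, η ((restrictObj V).parity u) = ((-1) ^ (2 * a) * ε) * η u) ∧
      η ((xOp (restrictObj V) ^ (2 * a)) q) = 1 ∧
      ∀ l < 2 * a, η ((xOp (restrictObj V) ^ l) q) = 0 := by
  obtain ⟨V, hV, hV'⟩ := exists_od_pow (k := k) a
  rw [← pow_xOp_restrict] at hV hV'
  obtain ⟨σ, q, hσ, hq, hne⟩ := (restrictObj V).exists_homogeneous hV'
  have key : ∀ W : RepOSp12 k, ∀ q : (restrictObj W).V, (restrictObj W).parity q = ε • q →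
      xOp (restrictObj W) ^ (2 * a + 1) = 0 → (xOp (restrictObj W) ^ (2 * a)) q ≠ 0 → _ :=
    fun W q h1 h2 h3 =>
      have ⟨η, h4, h5, h6⟩ := exists_dual_generator hε h1 h3 (by rw [h2, LinearMap.zero_apply])
      (⟨W, q, η, h1, h2, h6, h4, h5⟩ : ∃ (V : RepOSp12 k) (q : (restrictObj V).V)
        (η : Module.Dual k (restrictObj V).V),
      (restrictObj V).parity q = ε • q ∧ xOp (restrictObj V) ^ (2 * a + 1) = 0 ∧
      (∀ u, η ((restrictObj V).parity u) = ((-1) ^ (2 * a) * ε) * η u) ∧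
      η ((xOp (restrictObj V) ^ (2 * a)) q) = 1 ∧
      ∀ l < 2 * a, η ((xOp (restrictObj V) ^ l) q) = 0)
  by_cases h : σ = ε
  · exact key V q (by rw [hq, h]) hV hne
  · have h' : σ = -ε := by
      have : (σ - ε) * (σ + ε) = 0 := by linear_combination hσ - hε
      exact eq_neg_of_add_eq_zero_left ((mul_eq_zero.1 this).resolve_left (sub_ne_zero.2 h))
    refine key V.shift q ?_ hV hne
    have h1 : (restrictObj V.shift).parity q = -((restrictObj V).parity q) := rfl
    rw [h1, hq, h']
    exact (neg_smul (-ε) (q : V.V)).symm.trans (by rw [neg_neg]; rfl)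

/-- A morphism which, up to negligible morphisms, factors through the restriction of a
representation of `OSp(1|2)`. -/
def FactorsThroughRestrict {M N : RepGa11 k} (f : M ⟶ N) : Prop :=
  ∃ (V : RepOSp12 k) (a : M ⟶ restrictObj V) (b : restrictObj V ⟶ N), Negligible (f - a ≫ b)

theorem Negligible.factorsThroughRestrict {M N : RepGa11 k} {f : M ⟶ N} (hf : Negligible f) :
    FactorsThroughRestrict f :=
  ⟨SRep.triv (osp12 k), 0, 0, by simpa using hf⟩

theorem FactorsThroughRestrict.add {M N : RepGa11 k} {f g : M ⟶ N}
    (hf : FactorsThroughRestrict f) (hg : FactorsThroughRestrict g) :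
    FactorsThroughRestrict (f + g) := by
  obtain ⟨V, a, b, h⟩ := hf
  obtain ⟨W, c, d, h'⟩ := hg
  let i : restrictObj V ⟶ restrictObj (V.prod W) := restrict.map (V.inl W)
  let j : restrictObj W ⟶ restrictObj (V.prod W) := restrict.map (V.inr W)
  let p : restrictObj (V.prod W) ⟶ restrictObj V := restrict.map (V.fst W)
  let q : restrictObj (V.prod W) ⟶ restrictObj W := restrict.map (V.snd W)
  have hip : i ≫ p = 𝟙 _ := rfl
  have hjq : j ≫ q = 𝟙 _ := rfl
  have hiq : i ≫ q = 0 := rfl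
  have hjp : j ≫ p = 0 := rfl
  refine ⟨V.prod W, a ≫ i + c ≫ j, p ≫ b + q ≫ d, ?_⟩
  have e : f + g - (a ≫ i + c ≫ j) ≫ (p ≫ b + q ≫ d) = (f - a ≫ b) + (g - c ≫ d) := by
    simp only [Preadditive.add_comp, Preadditive.comp_add, Category.assoc]
    simp only [← Category.assoc i, ← Category.assoc j, hip, hjq, hiq, hjp, Category.id_comp,
      Limits.zero_comp, Limits.comp_zero]
    abel
  rw [e]
  exact h.add h'

/-- Jordan blocks of odd size occur in restricted representations, and morphisms through Jordan
blocks of even size are negligible. -/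
theorem factorsThroughRestrict_jordanHom {M N : RepGa11 k} (n : ℕ) (p : M.V)
    (ξ : Module.Dual k N.V) {ε : k} (hε : ε * ε = 1)
    (hp : M.parity p = ε • p) (hξ : ∀ u, ξ (N.parity u) = ((-1) ^ n * ε) * ξ u)
    (hxp : (xOp M ^ (n + 1)) p = 0) (hξx : ∀ u, ξ ((xOp N ^ (n + 1)) u) = 0) :
    FactorsThroughRestrict (jordanHom n p ξ ε hp hξ hxp hξx) := by
  obtain hn | hn := n.even_or_odd'.choose_spec
  · generalize n.even_or_odd'.choose = a at hn
    subst hn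
    obtain ⟨V, q, η, hq, hx, hη, h1, h0⟩ := exists_restrict_generator a hε
    let c : N ⟶ restrictObj V := jordanHom (2 * a) q ξ ε hq hξ
      (by rw [hx, LinearMap.zero_apply]) hξx
    let d : restrictObj V ⟶ M := jordanHom (2 * a) p η ε hp hη hxp
      (fun u => by rw [hx, LinearMap.zero_apply, map_zero])
    have hcd : c ≫ d = jordanHom (2 * a) p ξ ε hp hξ hxp hξx := by
      refine SRep.hom_ext ?_
      rw [SRep.lin_comp]
      refine jordanLin_comp_jordanLin (2 * a) p η q ξ h1 h0 fun u => ?_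
      have := lin_pow_xOp d 1 u
      simp only [pow_one] at this
      exact this
    refine ⟨V, c, d, ?_⟩
    rw [hcd, sub_self]
    exact negligible_zero _ _
  · exact (negligible_jordanHom ⟨_, hn⟩ _ _ _ _ _ _ _).factorsThroughRestrict

/-- Splitting off the longest Jordan blocks of the image one by one. -/
theorem factorsThroughRestrict_of_idempotent {M : RepGa11 k} (e : M ⟶ M) (he : e ≫ e = e) :
    FactorsThroughRestrict e := by
  induction hd : Module.finrank k (LinearMap.range (SRep.lin e)) using Nat.strong_induction_on
    generalizing e with
  | _ d ih =>
  have hee : ∀ v, SRep.lin e (SRep.lin e v) = SRep.lin e v :=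
    LinearMap.congr_fun (congr_arg SRep.lin he)
  by_cases h0 : SRep.lin e = 0
  · have : e = 0 := SRep.hom_ext h0
    rw [this]
    exact (negligible_zero _ _).factorsThroughRestrict
  have hnil : ∃ m, xOp M ^ m * SRep.lin e = 0 := by
    obtain ⟨m, hm⟩ := isNilpotent_xOp M
    exact ⟨m, by rw [hm, zero_mul]⟩
  classical
  obtain ⟨n, hn⟩ : ∃ n, Nat.find hnil = n + 1 :=
    Nat.exists_eq_succ_of_ne_zero fun h => h0 (by
      have := Nat.find_spec hnil
      rwa [h, pow_zero, one_mul] at this)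
  have hz : xOp M ^ (n + 1) * SRep.lin e = 0 := hn ▸ Nat.find_spec hnil
  have hnz : xOp M ^ n * SRep.lin e ≠ 0 := Nat.find_min hnil (by omega)
  obtain ⟨ε, u, hε, hu, hne⟩ := M.exists_homogeneous hnz
  set p := SRep.lin e u with hpu
  have hp : M.parity p = ε • p :=
    (e.parity u).symm.trans (by rw [hu]; exact (SRep.lin e).map_smul _ _)
  have hep : SRep.lin e p = p := hee u
  have hxp : (xOp M ^ (n + 1)) p = 0 := LinearMap.congr_fun hz u
  obtain ⟨ξ, h1, hlt, hξ⟩ := exists_dual_generator hε hp hne hxp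
  have hξx : ∀ w, (ξ ∘ₗ SRep.lin e) ((xOp M ^ (n + 1)) w) = 0 := fun w => by
    rw [LinearMap.comp_apply, lin_pow_xOp]
    exact (congr_arg ξ (LinearMap.congr_fun hz w)).trans (map_zero ξ)
  -- the projection of `M` onto a longest Jordan block of the image of `e`, generated by `p`
  let R : M ⟶ M := jordanHom n p (ξ ∘ₗ SRep.lin e) ε hp
    (fun w => (congr_arg ξ (e.parity w)).trans (hξ _)) hxp hξx
  have hR : SRep.lin R = jordanLin n p (ξ ∘ₗ SRep.lin e) := rfl
  have heR : e ≫ R = R := SRep.hom_ext (by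
    rw [SRep.lin_comp, hR, jordanLin_comp_lin]
    congr 1
    exact LinearMap.ext fun v => congr_arg ξ (hee v))
  have hRe : R ≫ e = R := SRep.hom_ext (by rw [SRep.lin_comp, hR, lin_comp_jordanLin, hep])
  have hl : ∀ l, (ξ ∘ₗ SRep.lin e) ((xOp M ^ l) p) = ξ ((xOp M ^ l) p) := fun l => by
    rw [LinearMap.comp_apply, lin_pow_xOp, hep]
  have hRR : R ≫ R = R := SRep.hom_ext (by
    rw [SRep.lin_comp]
    refine jordanLin_comp_jordanLin n p _ p _ (by rw [hl, h1]) (fun l h => by rw [hl, hlt l h])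
      fun w => ?_
    have := lin_pow_xOp R 1 w
    simp only [pow_one] at this
    exact this)
  have hRp : SRep.lin R p = p :=
    jordanLin_apply_generator n p _ p (by rw [hl, h1]) (fun l h => by rw [hl, hlt l h])
  have hsub : ∀ v, SRep.lin (e - R) v = SRep.lin e v - SRep.lin R v := fun _ => rfl
  have hidem : (e - R) ≫ (e - R) = e - R := by
    simp only [Preadditive.sub_comp, Preadditive.comp_sub, he, heR, hRe, hRR]
    abel
  have hlt' : LinearMap.range (SRep.lin (e - R)) < LinearMap.range (SRep.lin e) := by
    refine lt_of_le_of_ne ?_ fun h => ?_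
    · rintro _ ⟨v, rfl⟩
      have h2 : (e - R) ≫ e = e - R := by rw [Preadditive.sub_comp, he, hRe]
      exact ⟨SRep.lin (e - R) v, LinearMap.congr_fun (congr_arg SRep.lin h2) v⟩
    · obtain ⟨w, hw⟩ : p ∈ LinearMap.range (SRep.lin (e - R)) := h ▸ ⟨u, rfl⟩
      have h2 : SRep.lin (e - R) p = p := by
        conv_rhs => rw [← hw]
        rw [← hw]
        exact LinearMap.congr_fun (congr_arg SRep.lin hidem) w
      rw [hsub, hep, hRp, sub_self] at h2
      exact hne ((congr_arg (xOp M ^ n) h2.symm).trans (map_zero _))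
  have h3 := (ih _ (hd ▸ Submodule.finrank_lt_finrank_of_lt hlt') (e - R) hidem rfl).add
    (factorsThroughRestrict_jordanHom n p _ hε hp _ hxp hξx : FactorsThroughRestrict R)
  rwa [sub_add_cancel] at h3

/-- Every object is, up to negligible morphisms, a retract of the restriction of a representation
of `OSp(1|2)`. -/
theorem exists_summand (M : RepGa11 k) : ∃ (V : RepOSp12 k) (a : M ⟶ restrictObj V)
    (b : restrictObj V ⟶ M), Negligible (𝟙 M - a ≫ b) :=
  factorsThroughRestrict_of_idempotent (𝟙 M) (Category.comp_id _)

end Summand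

/-! ### Restriction is an equivalence onto the semisimplification -/

section GrHom

variable {k : Type u} [Field k] {M N : RepGa11 k}

theorem grHom_add (f g : M ⟶ N) : grHom (f + g) = grHom f + grHom g :=
  GrEv.hom_ext (M := M) fun i v hv => by
    rw [LinearMap.add_apply, grHom_mk, grHom_mk, grHom_mk, ← GrEv.mk_add]
    rfl

theorem grHom_smul (c : k) (f : M ⟶ N) : grHom (c • f) = c • grHom f :=
  GrEv.hom_ext (M := M) fun i v hv => by
    rw [LinearMap.smul_apply, grHom_mk, grHom_mk, ← GrEv.mk_smul]
    rfl

theorem grHom_sub_eq_zero {f g : M ⟶ N} (h : grHom f = grHom g) : grHom (f - g) = 0 := by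
  have h1 : f - g = (1 : k) • f + (-1 : k) • g := by rw [one_smul, neg_one_smul, sub_eq_add_neg]
  rw [h1, grHom_add, grHom_smul, grHom_smul, h, ← add_smul, add_neg_cancel, zero_smul]

theorem grHom_grParity (f : M ⟶ N) (a : GrEv M) :
    grHom f (grParity M a) = grParity N (grHom f a) := by
  refine LinearMap.congr_fun (f := grHom f ∘ₗ grParity M) (g := grParity N ∘ₗ grHom f) ?_ a
  refine GrEv.hom_ext (M := M) fun i v hv => ?_
  simp only [LinearMap.comp_apply, grParity_mk, grHom_mk]
  congr 1
  exact f.parity v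

theorem grHom_grX (f : M ⟶ N) (a : GrEv M) : grHom f (grX M a) = grX N (grHom f a) := by
  refine LinearMap.congr_fun (f := grHom f ∘ₗ grX M) (g := grX N ∘ₗ grHom f) ?_ a
  refine GrEv.hom_ext (M := M) fun i v hv => ?_
  simp only [LinearMap.comp_apply, grX_mk, grHom_mk]
  congr 1
  exact f.od _ v

theorem grHom_grH (f : M ⟶ N) (a : GrEv M) : grHom f (grH M a) = grH N (grHom f a) := by
  refine LinearMap.congr_fun (f := grHom f ∘ₗ grH M) (g := grH N ∘ₗ grHom f) ?_ a
  refine GrEv.hom_ext (M := M) fun i v hv => ?_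
  simp only [LinearMap.comp_apply, grH_mk, grHom_mk, map_smul]

end GrHom

section Retract

variable {C D : Type*} [Category C] [Category D]

/-- A retract of an object in the image of a fully faithful functor from a category with split
idempotents is in the essential image. -/
theorem nonempty_iso_of_retract (E : C ⥤ D) [E.Full] [E.Faithful]
    (hC : ∀ (V : C) (e : V ⟶ V), e ≫ e = e →
      ∃ (N : C) (i : N ⟶ V) (r : V ⟶ N), i ≫ r = 𝟙 N ∧ r ≫ i = e)
    {X : D} {V : C} (a : X ⟶ E.obj V) (b : E.obj V ⟶ X) (hab : a ≫ b = 𝟙 X) :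
    ∃ N : C, Nonempty (E.obj N ≅ X) := by
  obtain ⟨e, he⟩ := E.map_surjective (b ≫ a)
  have hee : e ≫ e = e := E.map_injective (by
    rw [E.map_comp, he, Category.assoc, reassoc_of% hab])
  obtain ⟨N, i, r, hir, hri⟩ := hC V e hee
  have h1 : E.map i ≫ E.map r = 𝟙 _ := by rw [← E.map_comp, hir, E.map_id]
  have h2 : E.map r ≫ E.map i = b ≫ a := by rw [← E.map_comp, hri, he]
  refine ⟨N, ⟨⟨E.map i ≫ b, a ≫ E.map r, ?_, ?_⟩⟩⟩
  · rw [Category.assoc, ← Category.assoc b, ← h2, Category.assoc, h1, Category.comp_id, h1]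
  · rw [Category.assoc, ← Category.assoc (E.map r), h2, Category.assoc, hab, Category.comp_id, hab]

end Retract

section Equivalence

variable {k : Type u} [Field k]

/-- The restriction of a morphism. -/
noncomputable def restrictHom {V W : RepOSp12 k} (f : V ⟶ W) : restrictObj V ⟶ restrictObj W :=
  restrict.map f

theorem lin_mem_weightSpace {V W : RepOSp12 k} (f : V ⟶ W) {i : ℤ} {v : (restrictObj V).V}
    (hv : v ∈ weightSpace V i) : SRep.lin (restrictHom f) v ∈ weightSpace W i := by
  rw [mem_weightSpace] at hv ⊢
  exact (f.ev _ v).symm.trans ((congr_arg (SRep.lin f) hv).trans ((SRep.lin f).map_smul _ _))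

variable [CharZero k]

theorem proj_map_eq_iff {M N : RepGa11 k} {f g : M ⟶ N} :
    (SemisimpleQuotient.proj (C := RepGa11 k)).map f = SemisimpleQuotient.proj.map g ↔
      Negligible (f - g) :=
  Quotient.functor_map_eq_iff _ f g

theorem grRestrict_naturality {V W : RepOSp12 k} (f : V ⟶ W) (v : (restrictObj V).V) :
    grRestrict W (SRep.lin (restrictHom f) v) = grHom (restrictHom f) (grRestrict V v) := by
  refine LinearMap.congr_fun
    (f := (grRestrict W).toLinearMap ∘ₗ SRep.lin (restrictHom f))
    (g := grHom (restrictHom f) ∘ₗ (grRestrict V).toLinearMap) ?_ v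
  refine weightSpace_hom_ext (V := V) fun i v hv => ?_
  simp only [LinearMap.comp_apply, LinearEquiv.coe_coe]
  rw [grRestrict_apply (lin_mem_weightSpace f hv), grRestrict_apply hv, grHom_mk]

/-- The associated graded of a morphism between restricted representations is a morphism of
representations of `OSp(1|2)`. -/
noncomputable def liftRestrict {V W : RepOSp12 k} (g : restrictObj V ⟶ restrictObj W) : V ⟶ W :=
  ospHom ((grRestrict W).symm.toLinearMap ∘ₗ grHom g ∘ₗ (grRestrict V).toLinearMap)
    (fun v => by
      simp only [LinearMap.comp_apply, LinearEquiv.coe_coe]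
      rw [LinearEquiv.symm_apply_eq, grRestrict_parity, grRestrict_parity, grHom_grParity,
        LinearEquiv.apply_symm_apply])
    (fun v => by
      simp only [LinearMap.comp_apply, LinearEquiv.coe_coe]
      rw [LinearEquiv.symm_apply_eq, grRestrict_xOp, grRestrict_xOp, grHom_grX,
        LinearEquiv.apply_symm_apply])
    (fun v => by
      simp only [LinearMap.comp_apply, LinearEquiv.coe_coe]
      rw [LinearEquiv.symm_apply_eq, grRestrict_hOp, grRestrict_hOp, grHom_grH,
        LinearEquiv.apply_symm_apply])

/-- Fullness of restriction modulo negligible morphisms. -/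
theorem negligible_sub_map_liftRestrict {V W : RepOSp12 k} (g : restrictObj V ⟶ restrictObj W) :
    Negligible (g - restrictHom (liftRestrict g)) := by
  refine negligible_of_grHom_eq_zero _ (grHom_sub_eq_zero (LinearMap.ext fun a => ?_))
  obtain ⟨v, rfl⟩ := (grRestrict V).surjective a
  rw [← grRestrict_naturality]
  exact ((grRestrict W).apply_symm_apply _).symm

instance : (restrict (k := k) ⋙ SemisimpleQuotient.proj).Full where
  map_surjective {V W} g := by
    obtain ⟨g, rfl⟩ := (SemisimpleQuotient.proj (C := RepGa11 k)).map_surjective g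
    exact ⟨liftRestrict g, (proj_map_eq_iff.2 (negligible_sub_map_liftRestrict g)).symm⟩

instance : (restrict (k := k) ⋙ SemisimpleQuotient.proj).Faithful where
  map_injective {V W} f g h := by
    have h1 := grHom_eq_of_negligible (proj_map_eq_iff.1 h)
    refine SRep.hom_ext (LinearMap.ext fun v => (grRestrict W).injective ?_)
    exact (grRestrict_naturality f v).trans
      ((LinearMap.congr_fun h1 _).trans (grRestrict_naturality g v).symm)

instance : (restrict (k := k) ⋙ SemisimpleQuotient.proj).EssSurj where
  mem_essImage := by
    rintro ⟨M⟩
    obtain ⟨V, a, b, h⟩ := exists_summand M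
    refine nonempty_iso_of_retract (restrict ⋙ SemisimpleQuotient.proj)
      (fun V e => SRep.exists_split e) (X := ⟨M⟩) (V := V)
      (SemisimpleQuotient.proj.map a) (SemisimpleQuotient.proj.map b) ?_
    exact (SemisimpleQuotient.proj.map_comp a b).symm.trans
      ((proj_map_eq_iff.2 h).symm.trans (SemisimpleQuotient.proj.map_id M))

instance isEquivalence_restrict_proj :
    (restrict (k := k) ⋙ SemisimpleQuotient.proj).IsEquivalence where

end Equivalence

/-! ### Inverses and factorizations of symmetric monoidal functors -/

section Monoidal

open Functor.LaxMonoidal Functor.OplaxMonoidal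

variable {C D Q : Type*} [Category C] [Category D] [Category Q]

section Factorization

variable {T : D ⥤ C} {R : C ⥤ D} {P : D ⥤ Q} (α : T ⋙ R ⋙ P ⟶ P)

theorem map_comp_of_factorization {M N : D} (f : M ⟶ N) (c : R.obj (T.obj M) ⟶ M)
    (d : R.obj (T.obj N) ⟶ N) (hc : P.map c = α.app M) (hd : P.map d = α.app N) :
    P.map (R.map (T.map f) ≫ d) = P.map (c ≫ f) := by
  rw [P.map_comp, P.map_comp, hc, hd]
  exact α.naturality f

variable [MonoidalCategory C] [MonoidalCategory D] [MonoidalCategory Q]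

/-- The compatibility of a monoidal transformation `α` with tensor products, in terms of
representatives `c`, `d`, `g` of its components. -/
theorem map_μ_comp_of_factorization [T.LaxMonoidal] [R.LaxMonoidal] [P.Monoidal] [α.IsMonoidal]
    {M N : D} (c : R.obj (T.obj M) ⟶ M) (d : R.obj (T.obj N) ⟶ N)
    (g : R.obj (T.obj (M ⊗ N)) ⟶ M ⊗ N)
    (hc : P.map c = α.app M) (hd : P.map d = α.app N) (hg : P.map g = α.app (M ⊗ N)) :
    P.map (μ R (T.obj M) (T.obj N) ≫ R.map (μ T M N) ≫ g) = P.map (c ⊗ₘ d) := by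
  have h := NatTrans.IsMonoidal.tensor (τ := α) M N
  rw [← hc, ← hd, ← hg] at h
  have h2 : μ P _ _ ≫ P.map (μ R (T.obj M) (T.obj N) ≫ R.map (μ T M N) ≫ g) =
      μ P _ _ ≫ P.map (c ⊗ₘ d) := by
    refine Eq.trans ?_ (h.trans (μ_natural P c d))
    simp only [comp_μ, P.map_comp, Category.assoc]
    rfl
  exact (cancel_epi _).1 h2

end Factorization

variable [MonoidalCategory C] [MonoidalCategory D] [BraidedCategory C] [BraidedCategory D]

/-- The inverse of a braided monoidal equivalence is braided monoidal, and so is the counit. -/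
theorem CategoryTheory.Equivalence.exists_braided_inverse (e : C ≌ D) [e.functor.Braided] :
    ∃ _ : e.inverse.Braided, e.counitIso.hom.IsMonoidal := by
  let _ : e.inverse.Monoidal := e.inverseMonoidal
  have : e.IsMonoidal := ⟨rfl, fun _ _ => rfl⟩
  have hμ : ∀ X Y : D, e.functor.map (μ e.inverse X Y) ≫ e.counitIso.hom.app (X ⊗ Y) =
      δ e.functor _ _ ≫ (e.counitIso.hom.app X ⊗ₘ e.counitIso.hom.app Y) :=
    e.functor_map_μ_inverse_comp_counitIso_hom_app_tensor
  let _ : e.inverse.Braided :=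
    { braided := fun X Y => e.functor.map_injective (by
        rw [← cancel_mono (e.counitIso.hom.app (Y ⊗ X)), Functor.map_comp, Functor.map_comp,
          Category.assoc, Category.assoc, hμ Y X,
          e.functor.map_braiding (e.inverse.obj X) (e.inverse.obj Y)]
        have h1 := e.counitIso.hom.naturality (β_ X Y).hom
        rw [Functor.comp_map, Functor.id_map] at h1
        rw [h1, ← Category.assoc, hμ X Y]
        simp) }
  exact ⟨inferInstance, inferInstanceAs (NatTrans.IsMonoidal e.toAdjunction.counit)⟩

theorem exists_braided_inverse (E : C ⥤ D) [h : E.Braided] [E.IsEquivalence] :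
    ∃ (G : D ⥤ C) (_ : G.Braided) (c : G ⋙ E ≅ 𝟭 D), c.hom.IsMonoidal :=
  have ⟨hG, hc⟩ := @Equivalence.exists_braided_inverse _ _ _ _ _ _ _ _ E.asEquivalence h
  ⟨_, hG, _, hc⟩

theorem exists_braided_factorization [MonoidalCategory Q] [BraidedCategory Q] (E : C ⥤ D)
    [E.Braided] [E.IsEquivalence] (P : Q ⥤ D) [P.Braided] :
    ∃ (T : Q ⥤ C) (_ : T.Braided) (α : T ⋙ E ≅ P), α.hom.IsMonoidal := by
  obtain ⟨G, _, c, _⟩ := exists_braided_inverse E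
  refine ⟨P ⋙ G, inferInstance,
    Functor.associator _ _ _ ≪≫ Functor.isoWhiskerLeft P c ≪≫ P.rightUnitor, ?_⟩
  change (_ ≫ Functor.whiskerLeft P c.hom ≫ _).IsMonoidal
  infer_instance

end Monoidal

/-! ### The Deligne filtration of a tensor product -/

section Tensor

variable {k : Type u} [Field k]

theorem tmul_mem_weightSpace {V W : RepOSp12 k} {i j : ℤ} {v : (restrictObj V).V}
    {w : (restrictObj W).V} (hv : v ∈ weightSpace V i) (hw : w ∈ weightSpace W j) :
    (v ⊗ₜ[k] w : V.V ⊗[k] W.V) ∈ weightSpace (V ⊗ W) (i + j) := by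
  rw [mem_weightSpace] at hv hw
  have h1 : hOp (V ⊗ W) (v ⊗ₜ[k] w : V.V ⊗[k] W.V) =
      ((hOp V v) ⊗ₜ[k] w + v ⊗ₜ[k] (hOp W w) : (restrictObj V).V ⊗[k] (restrictObj W).V) := rfl
  have h2 : ((hOp V v) ⊗ₜ[k] w + v ⊗ₜ[k] (hOp W w) : (restrictObj V).V ⊗[k] (restrictObj W).V) =
      ((2 * (i + j) : ℤ) : k) • (v ⊗ₜ[k] w) := by
    rw [hv, hw, ← TensorProduct.smul_tmul', TensorProduct.tmul_smul, ← add_smul]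
    push_cast
    rw [mul_add]
  exact mem_weightSpace.2 (h1.trans h2)

variable [CharZero k]

/-- The step `2 i` of the filtration is spanned by the weight vectors of weights at most `2 i`. -/
theorem weightSpace_induction {V : RepOSp12 k} {i : ℤ} {P : Submodule k (restrictObj V).V}
    (h : ∀ j ≤ i, weightSpace V j ≤ P) : deligne (restrictObj V) (2 * i) ≤ P := by
  obtain ⟨b, hb⟩ := (isDeligneFiltration_deligne (restrictObj V)).exists_eq_bot
  have key : ∀ (d : ℕ) (j : ℤ), j ≤ i → 2 * j ≤ b + d → deligne (restrictObj V) (2 * j) ≤ P := by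
    intro d
    induction d with
    | zero =>
      intro j _ hj
      refine (deligne_mono _ (b := b) (by omega)).trans ?_
      rw [hb]
      exact bot_le
    | succ d ih =>
      intro j hj hd v hv
      obtain ⟨w, hw, hvw⟩ := exists_mem_weightSpace hv
      rw [deligne_restrict_odd] at hvw
      simpa using Submodule.add_mem _ (ih (j - 1) (by omega) (by omega) hvw) (h j hj hw)
  exact key (2 * i - b).toNat i le_rfl (by omega)

theorem tmul_mem_deligne_restrict {V W : RepOSp12 k} {i j : ℤ} {v : (restrictObj V).V}
    {w : (restrictObj W).V} (hv : v ∈ deligne (restrictObj V) (2 * i))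
    (hw : w ∈ deligne (restrictObj W) (2 * j)) :
    (v ⊗ₜ[k] w : (restrictObj V).V ⊗[k] (restrictObj W).V) ∈
      deligne (restrictObj V ⊗ restrictObj W) (2 * (i + j)) := by
  let B := TensorProduct.mk k (restrictObj V).V (restrictObj W).V
  let D : Submodule k ((restrictObj V).V ⊗[k] (restrictObj W).V) :=
    deligne (restrictObj V ⊗ restrictObj W) (2 * (i + j))
  have h1 : deligne (restrictObj V) (2 * i) ≤ D.comap (B.flip w) := by
    refine weightSpace_induction fun a ha v hv => ?_
    have h2 : deligne (restrictObj W) (2 * j) ≤ D.comap (B v) := by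
      refine weightSpace_induction fun b hb w hw => ?_
      have h3 := weightSpace_le_deligne _ _ (tmul_mem_weightSpace hv hw)
      have h4 := lin_mem_deligne (Functor.OplaxMonoidal.δ restrict V W) _ _ h3
      exact deligne_mono _ (by omega) h4
    exact h2 hw
  exact h1 hv

/-- The even steps of the Deligne filtration are spanned by images of restricted
representations. -/
theorem deligne_even_induction {M : RepGa11 k} {i : ℤ} {P : Submodule k M.V}
    (h : ∀ (V : RepOSp12 k) (f : restrictObj V ⟶ M), ∀ v ∈ deligne (restrictObj V) (2 * i),
      SRep.lin f v ∈ P) : deligne M (2 * i) ≤ P := by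
  refine deligne_homogeneous_induction fun s n ε u hn hs hε hp hu => ?_
  obtain ⟨a, rfl⟩ : ∃ a, n = 2 * a := ⟨(i + s).toNat, by omega⟩
  obtain ⟨V, q, η, hq, hx, hη, h1, h0⟩ := exists_restrict_generator a hε
  let f : restrictObj V ⟶ M := jordanHom (2 * a) u η ε hp hη hu
    (fun w => by rw [hx, LinearMap.zero_apply, map_zero])
  have hf : SRep.lin f q = u := jordanLin_apply_generator _ _ _ _ h1 h0
  rw [← hf, ← lin_pow_xOp]
  refine h V f _ (pow_xOp_mem_deligne _ s (i := (2 * a : ℕ)) (by omega) ?_)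
  exact mem_deligne_of_pow_eq_zero (n := 2 * a + 1) (by rw [hx, LinearMap.zero_apply])
    (by push_cast; ring)

/-- The even steps of the Deligne filtration are compatible with tensor products. -/
theorem tmul_mem_deligne {M N : RepGa11 k} {i j : ℤ} {m : M.V} {n : N.V}
    (hm : m ∈ deligne M (2 * i)) (hn : n ∈ deligne N (2 * j)) :
    (m ⊗ₜ[k] n : M.V ⊗[k] N.V) ∈ deligne (M ⊗ N) (2 * (i + j)) := by
  let B := TensorProduct.mk k M.V N.V
  let D : Submodule k (M.V ⊗[k] N.V) := deligne (M ⊗ N) (2 * (i + j))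
  have h1 : deligne M (2 * i) ≤ D.comap (B.flip n) := by
    refine deligne_even_induction fun V f v hv => ?_
    have h2 : deligne N (2 * j) ≤ D.comap (B (SRep.lin f v)) :=
      deligne_even_induction fun W g w hw =>
        lin_mem_deligne (f ⊗ₘ g) _ _ (tmul_mem_deligne_restrict hv hw)
    exact h2 hn
  exact h1 hm

/-- A product with an element of odd degree `2 i - 1` does not contribute in degree `2 (i + j)`: up
to negligible morphisms, the element comes from a restricted representation, where the filtration
jumps in even degrees only. -/
theorem tmul_mem_deligne_left {M N : RepGa11 k} {i j : ℤ} {m : M.V} {n : N.V}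
    (hm : m ∈ deligne M (2 * i - 1)) (hn : n ∈ deligne N (2 * j)) :
    (m ⊗ₜ[k] n : M.V ⊗[k] N.V) ∈ deligne (M ⊗ N) (2 * (i + j) - 1) := by
  obtain ⟨V, a, b, h⟩ := exists_summand M
  have h1 := lin_mem_deligne a _ _ hm
  rw [deligne_restrict_odd] at h1
  have h2 := deligne_mono _ (b := 2 * (i + j) - 1) (by omega)
    (tmul_mem_deligne (lin_mem_deligne b _ _ h1) hn)
  have h3 := (h.whiskerRight N).mem_deligne (i := i + j)
    (tmul_mem_deligne (deligne_mono _ (by omega) hm) hn)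
  have h4 : SRep.lin ((𝟙 M - a ≫ b) ▷ N) (m ⊗ₜ[k] n : M.V ⊗[k] N.V) =
      ((m - SRep.lin b (SRep.lin a m)) ⊗ₜ[k] n : M.V ⊗[k] N.V) := rfl
  have h5 : (m ⊗ₜ[k] n : M.V ⊗[k] N.V) =
      (m - SRep.lin b (SRep.lin a m)) ⊗ₜ[k] n + SRep.lin b (SRep.lin a m) ⊗ₜ[k] n := by
    rw [← TensorProduct.add_tmul, sub_add_cancel]
  rw [h5]
  exact Submodule.add_mem _ (h4 ▸ h3) h2

theorem tmul_mem_deligne_right {M N : RepGa11 k} {i j : ℤ} {m : M.V} {n : N.V}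
    (hm : m ∈ deligne M (2 * i)) (hn : n ∈ deligne N (2 * j - 1)) :
    (m ⊗ₜ[k] n : M.V ⊗[k] N.V) ∈ deligne (M ⊗ N) (2 * (i + j) - 1) := by
  obtain ⟨V, a, b, h⟩ := exists_summand N
  have h1 := lin_mem_deligne a _ _ hn
  rw [deligne_restrict_odd] at h1
  have h2 := deligne_mono _ (b := 2 * (i + j) - 1) (by omega)
    (tmul_mem_deligne hm (lin_mem_deligne b _ _ h1))
  have h3 := (h.whiskerLeft M).mem_deligne (i := i + j)
    (tmul_mem_deligne hm (deligne_mono _ (by omega) hn))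
  have h4 : SRep.lin (M ◁ (𝟙 N - a ≫ b)) (m ⊗ₜ[k] n : M.V ⊗[k] N.V) =
      (m ⊗ₜ[k] (n - SRep.lin b (SRep.lin a n)) : M.V ⊗[k] N.V) := rfl
  have h5 : (m ⊗ₜ[k] n : M.V ⊗[k] N.V) =
      m ⊗ₜ[k] (n - SRep.lin b (SRep.lin a n)) + m ⊗ₜ[k] SRep.lin b (SRep.lin a n) := by
    rw [← TensorProduct.tmul_add, sub_add_cancel]
  rw [h5]
  exact Submodule.add_mem _ (h4 ▸ h3) h2

end Tensor

/-! ### The functor given by the even part of the associated graded -/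

section GrFunctor

variable {k : Type u} [Field k] [CharZero k]

/-- The semisimplification factors through the equivalence `restrict ⋙ proj`. -/
theorem exists_factorization : ∃ (T : RepGa11 k ⥤ RepOSp12 k) (_ : T.Braided)
    (α : T ⋙ restrict ⋙ SemisimpleQuotient.proj ≅
      (SemisimpleQuotient.proj : RepGa11 k ⥤ SemisimpleQuotient (RepGa11 k))),
    α.hom.IsMonoidal :=
  exists_braided_factorization (restrict ⋙ SemisimpleQuotient.proj) SemisimpleQuotient.proj

variable {T : RepGa11 k ⥤ RepOSp12 k} (α : T ⋙ restrict ⋙ SemisimpleQuotient.proj ≅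
  (SemisimpleQuotient.proj : RepGa11 k ⥤ SemisimpleQuotient (RepGa11 k)))

/-- A morphism representing the component at `M` of the isomorphism `α`. -/
noncomputable def comparison (M : RepGa11 k) : restrictObj (T.obj M) ⟶ M :=
  (SemisimpleQuotient.proj.map_surjective (X := restrictObj (T.obj M)) (α.hom.app M)).choose

theorem proj_map_comparison (M : RepGa11 k) :
    SemisimpleQuotient.proj.map (comparison α M) = α.hom.app M :=
  (SemisimpleQuotient.proj.map_surjective (X := restrictObj (T.obj M)) (α.hom.app M)).choose_spec

/-- A morphism representing the component at `M` of the inverse of the isomorphism `α`. -/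
noncomputable def comparisonInv (M : RepGa11 k) : M ⟶ restrictObj (T.obj M) :=
  (SemisimpleQuotient.proj.map_surjective (Y := restrictObj (T.obj M)) (α.inv.app M)).choose

theorem proj_map_comparisonInv (M : RepGa11 k) :
    SemisimpleQuotient.proj.map (comparisonInv α M) = α.inv.app M :=
  (SemisimpleQuotient.proj.map_surjective (Y := restrictObj (T.obj M)) (α.inv.app M)).choose_spec

theorem grHom_eq_of_proj_map_eq {M N : RepGa11 k} {f g : M ⟶ N}
    (h : (SemisimpleQuotient.proj (C := RepGa11 k)).map f = SemisimpleQuotient.proj.map g) :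
    grHom f = grHom g :=
  grHom_eq_of_negligible (proj_map_eq_iff.1 h)

/-- The comparison induces an isomorphism of associated graded spaces, since negligible morphisms
act by zero on them. -/
noncomputable def grComparison (M : RepGa11 k) :
    GrEv (restrictObj (T.obj M)) ≃ₗ[k] GrEv M :=
  LinearEquiv.ofLinearMap (grHom (comparison α M)) (grHom (comparisonInv α M))
    (by
      rw [← grHom_comp, ← grHom_id]
      refine grHom_eq_of_proj_map_eq ?_
      rw [SemisimpleQuotient.proj.map_comp, SemisimpleQuotient.proj.map_id, proj_map_comparison,
        proj_map_comparisonInv]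
      exact α.inv_hom_id_app M)
    (by
      rw [← grHom_comp, ← grHom_id]
      refine grHom_eq_of_proj_map_eq ?_
      rw [SemisimpleQuotient.proj.map_comp, SemisimpleQuotient.proj.map_id, proj_map_comparison,
        proj_map_comparisonInv]
      exact α.hom_inv_id_app M)

/-- The identification of `T.obj M` with the even part of the associated graded of `M`. -/
noncomputable def grIso (M : RepGa11 k) : (restrictObj (T.obj M)).V ≃ₗ[k] GrEv M :=
  grRestrict (T.obj M) ≪≫ₗ grComparison α M

theorem grIso_apply (M : RepGa11 k) (v : (restrictObj (T.obj M)).V) :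
    grIso α M v = grHom (comparison α M) (grRestrict (T.obj M) v) := rfl

theorem grIso_of_mem_weightSpace (M : RepGa11 k) {i : ℤ} {v : (restrictObj (T.obj M)).V}
    (hv : v ∈ weightSpace (T.obj M) i) : grIso α M v =
      GrEv.mk i (SRep.lin (comparison α M) v)
        (lin_mem_deligne _ _ v (weightSpace_le_deligne _ i hv)) := by
  rw [grIso_apply, grRestrict_apply hv, grHom_mk]

theorem grIso_parity (M : RepGa11 k) (v : (restrictObj (T.obj M)).V) :
    grIso α M ((restrictObj (T.obj M)).parity v) = grParity M (grIso α M v) := by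
  rw [grIso_apply, grIso_apply, grRestrict_parity, grHom_grParity]

theorem grIso_xOp (M : RepGa11 k) (v : (restrictObj (T.obj M)).V) :
    grIso α M (xOp (restrictObj (T.obj M)) v) = grX M (grIso α M v) := by
  rw [grIso_apply, grIso_apply, grRestrict_xOp, grHom_grX]

theorem grIso_hOp (M : RepGa11 k) (v : (restrictObj (T.obj M)).V) :
    grIso α M (hOp (T.obj M) v) = grH M (grIso α M v) := by
  rw [grIso_apply, grIso_apply, grRestrict_hOp, grHom_grH]

theorem grIso_naturality {M N : RepGa11 k} (f : M ⟶ N) (v : (restrictObj (T.obj M)).V) :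
    grIso α N (SRep.lin (restrictHom (T.map f)) v) = grHom f (grIso α M v) := by
  have h : (SemisimpleQuotient.proj (C := RepGa11 k)).map
      (restrictHom (T.map f) ≫ comparison α N) =
      SemisimpleQuotient.proj.map (comparison α M ≫ f) :=
    map_comp_of_factorization α.hom f _ _ (proj_map_comparison α M) (proj_map_comparison α N)
  have h1 := grHom_eq_of_proj_map_eq h
  rw [grHom_comp, grHom_comp] at h1
  rw [grIso_apply, grIso_apply, grRestrict_naturality]
  exact LinearMap.congr_fun h1 _

theorem symm_mk_mem_weightSpace (M : RepGa11 k) {i : ℤ} {m : M.V} (hm : m ∈ deligne M (2 * i)) :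
    (grIso α M).symm (GrEv.mk i m hm) ∈ weightSpace (T.obj M) i := by
  rw [mem_weightSpace]
  refine (grIso α M).injective ?_
  rw [grIso_hOp, map_smul, LinearEquiv.apply_symm_apply, grH_mk]

/-- A functor lifting the semisimplification is additive, since `grHom` is additive. -/
theorem functor_additive (α : T ⋙ restrict ⋙ SemisimpleQuotient.proj ≅
    (SemisimpleQuotient.proj : RepGa11 k ⥤ SemisimpleQuotient (RepGa11 k))) : T.Additive where
  map_add {M N f g} := by
    have h : ∀ v : (restrictObj (T.obj M)).V,
        grIso α N (SRep.lin (restrictHom (T.map (f + g))) v) =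
        grIso α N (SRep.lin (restrictHom (T.map f)) v + SRep.lin (restrictHom (T.map g)) v) := by
      intro v
      rw [grIso_naturality, map_add, grIso_naturality, grIso_naturality, grHom_add,
        LinearMap.add_apply]
    exact SRep.hom_ext (LinearMap.ext fun v => (grIso α N).injective (h v))

theorem functor_linear (α : T ⋙ restrict ⋙ SemisimpleQuotient.proj ≅
    (SemisimpleQuotient.proj : RepGa11 k ⥤ SemisimpleQuotient (RepGa11 k))) : T.Linear k where
  map_smul {M N} f c := by
    have h : ∀ v : (restrictObj (T.obj M)).V,
        grIso α N (SRep.lin (restrictHom (T.map (c • f))) v) =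
        grIso α N (c • SRep.lin (restrictHom (T.map f)) v) := by
      intro v
      rw [grIso_naturality, map_smul, grIso_naturality, grHom_smul, LinearMap.smul_apply]
    exact SRep.hom_ext (LinearMap.ext fun v => (grIso α N).injective (h v))

/-- The tensor structure of the restriction functor, which is the identity map. -/
noncomputable def restrictTensor (V W : RepOSp12 k) :
    restrictObj V ⊗ restrictObj W ⟶ restrictObj (V ⊗ W) :=
  Functor.LaxMonoidal.μ restrict V W

/-- Monoidality of `α`, in terms of the representatives of its components. -/
theorem negligible_comparison_tensor [T.Braided] [α.hom.IsMonoidal] (M N : RepGa11 k) :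
    Negligible (restrictTensor (T.obj M) (T.obj N) ≫
      restrictHom (Functor.LaxMonoidal.μ T M N) ≫ comparison α (M ⊗ N) -
        (comparison α M ⊗ₘ comparison α N)) :=
  proj_map_eq_iff.1 (map_μ_comp_of_factorization α.hom _ _ _ (proj_map_comparison α M)
    (proj_map_comparison α N) (proj_map_comparison α (M ⊗ N)))

/-- The tensor structure takes the classes of `m` and `n` to the class of `m ⊗ n`. -/
theorem grIso_tensor [T.Braided] [α.hom.IsMonoidal] {M N : RepGa11 k} {i j : ℤ} {m : M.V}
    (hm : m ∈ deligne M (2 * i)) {n : N.V} (hn : n ∈ deligne N (2 * j)) :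
    grIso α (M ⊗ N) (SRep.lin (restrictHom (Functor.LaxMonoidal.μ T M N))
      ((grIso α M).symm (GrEv.mk i m hm) ⊗ₜ[k] (grIso α N).symm (GrEv.mk j n hn) :
        (T.obj M).V ⊗[k] (T.obj N).V)) = GrEv.mk (i + j) (m ⊗ₜ[k] n : M.V ⊗[k] N.V)
          (tmul_mem_deligne hm hn) := by
  have hv := symm_mk_mem_weightSpace α M hm
  have hw := symm_mk_mem_weightSpace α N hn
  have hv' := (grIso α M).apply_symm_apply (GrEv.mk i m hm)
  have hw' := (grIso α N).apply_symm_apply (GrEv.mk j n hn)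
  generalize (grIso α M).symm (GrEv.mk i m hm) = v at hv hv' ⊢
  generalize (grIso α N).symm (GrEv.mk j n hn) = w at hw hw' ⊢
  rw [grIso_of_mem_weightSpace α M hv, GrEv.mk_eq_mk_iff] at hv'
  rw [grIso_of_mem_weightSpace α N hw, GrEv.mk_eq_mk_iff] at hw'
  have hvw := lin_mem_weightSpace (Functor.LaxMonoidal.μ T M N) (tmul_mem_weightSpace hv hw)
  refine (grIso_of_mem_weightSpace α (M ⊗ N) hvw).trans ((GrEv.mk_eq_mk_iff _ _).2 ?_)
  have h1 := (negligible_comparison_tensor α M N).mem_deligne (tmul_mem_deligne_restrict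
    (weightSpace_le_deligne _ _ hv) (weightSpace_le_deligne _ _ hw))
  have h2 := tmul_mem_deligne_left hv'
    (lin_mem_deligne (comparison α N) _ _ (weightSpace_le_deligne _ _ hw))
  have h3 := tmul_mem_deligne_right hm hw'
  -- the difference of the two sides is the sum of three terms in the step `2 (i + j) - 1`
  have h4 := Submodule.add_mem _ h1 (Submodule.add_mem _ h2 h3)
  rw [TensorProduct.sub_tmul, TensorProduct.tmul_sub, sub_add_sub_cancel] at h4
  have h5 := sub_add_sub_cancel
    (SRep.lin (restrictTensor (T.obj M) (T.obj N) ≫ restrictHom (Functor.LaxMonoidal.μ T M N) ≫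
      comparison α (M ⊗ N)) (v ⊗ₜ[k] w : (T.obj M).V ⊗[k] (T.obj N).V) : M.V ⊗[k] N.V)
    (SRep.lin (comparison α M) v ⊗ₜ[k] SRep.lin (comparison α N) w) (m ⊗ₜ[k] n)
  exact h5 ▸ h4

end GrFunctor

/-! ### The structure of a module over `𝔬𝔰𝔭(1|2)` -/

section Transport

variable {k : Type u} [Field k]

/-- The transport of a module structure over a Lie superalgebra along an isomorphism of
superspaces. -/
noncomputable def LieSuperalgebra.Action.transport {L : LieSuperalgebra k} {V W : Type u}
    [AddCommGroup V] [Module k V] [AddCommGroup W] [Module k W] {ε : Module.End k V}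
    {ε' : Module.End k W} (A : L.Action V ε) (e : V ≃ₗ[k] W) (h : e.conj ε = ε') :
    L.Action W ε' where
  ev := e.conj.toLinearMap ∘ₗ A.ev
  od := e.conj.toLinearMap ∘ₗ A.od
  ev_parity a := by
    subst h
    exact (e.conj_comp _ _).symm.trans ((congr_arg e.conj (A.ev_parity a)).trans (e.conj_comp _ _))
  od_parity a := by
    subst h
    exact (e.conj_comp _ _).symm.trans ((congr_arg e.conj (A.od_parity a)).trans
      ((map_neg e.conj _).trans (congr_arg _ (e.conj_comp _ _))))
  ev_lie a b := (congr_arg e.conj (A.ev_lie a b)).trans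
    ((map_sub e.conj _ _).trans (congr_arg₂ _ (e.conj_comp _ _) (e.conj_comp _ _)))
  od_act a x := (congr_arg e.conj (A.od_act a x)).trans
    ((map_sub e.conj _ _).trans (congr_arg₂ _ (e.conj_comp _ _) (e.conj_comp _ _)))
  ev_bracket x y := (congr_arg e.conj (A.ev_bracket x y)).trans
    ((map_add e.conj _ _).trans (congr_arg₂ _ (e.conj_comp _ _) (e.conj_comp _ _)))

variable [CharZero k]

/-- A module structure over `𝔬𝔰𝔭(1|2)` on the superspace underlying a representation with the same
action of `h` and `X` is the given one. -/
theorem action_eq_of_eq (V : RepOSp12 k) (s : (osp12 k).Action V.V V.parity)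
    (hh : s.ev (ospH k) = V.action.ev (ospH k)) (hx : s.od (ospX k) = V.action.od (ospX k)) :
    s = V.action := by
  have hX : ∀ v, V.action.od (ospX k) v = xOp (restrictObj V) v := fun v => (xOp_restrict V v).symm
  have h1 : ∀ v : V.V, s.ev (ospH k) v = s.od (ospY k) (s.od (ospX k) v) +
      s.od (ospX k) (s.od (ospY k) v) := fun v => by
    rw [← (osp_relations k).2.2, s.ev_bracket]; rfl
  have h2 : ∀ v : V.V, (2 : k) • s.od (ospY k) v = s.ev (ospH k) (s.od (ospY k) v) -
      s.od (ospY k) (s.ev (ospH k) v) := fun v => by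
    have := LinearMap.congr_fun (s.od_act (ospH k) (ospY k)) v
    rw [(osp_relations k).2.1, map_smul] at this
    exact this
  rw [hx, hh] at h1
  rw [hh] at h2
  let y : Module.End k (restrictObj V).V := s.od (ospY k)
  have hxy : ∀ v, xOp (restrictObj V) (y v) = hOp V v - y (xOp (restrictObj V) v) := fun v =>
    eq_sub_of_add_eq' ((h1 v).trans
      (congr_arg₂ (· + ·) (congr_arg (s.od (ospY k)) (hX v)) (hX _))).symm
  have hhy : ∀ v, hOp V (y v) = y (hOp V v) + (2 : k) • y v := fun v =>
    (eq_add_of_sub_eq' (h2 v).symm)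
  have hD : y - yOp V = 0 := eq_zero_of_anticommutes _
    (fun v => by
      simp only [LinearMap.sub_apply, map_sub, hxy, xOp_yOp]
      abel)
    (fun v => by
      simp only [LinearMap.sub_apply, map_sub, hhy, hOp_yOp]
      module)
  exact osp_action_ext hx (sub_eq_zero.1 hD)

end Transport

section Structure

variable {k : Type u} [Field k] [CharZero k] {T : RepGa11 k ⥤ RepOSp12 k}
  (α : T ⋙ restrict ⋙ SemisimpleQuotient.proj ≅
    (SemisimpleQuotient.proj : RepGa11 k ⥤ SemisimpleQuotient (RepGa11 k)))

theorem conj_grIso_parity (M : RepGa11 k) :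
    (show (T.obj M).V ≃ₗ[k] GrEv M from grIso α M).conj (T.obj M).parity = grParity M :=
  LinearMap.ext fun a => (grIso_parity α M ((grIso α M).symm a)).trans
    (congr_arg (grParity M) ((grIso α M).apply_symm_apply a))

/-- The module structure over `𝔬𝔰𝔭(1|2)` on the even part of the associated graded, transported from
`T.obj M`. -/
noncomputable def grAction (M : RepGa11 k) : (osp12 k).Action (GrEv M) (grParity M) :=
  (T.obj M).action.transport (grIso α M) (conj_grIso_parity α M)

theorem isGrStructure_grAction (M : RepGa11 k) : IsGrStructure M (grAction α M) :=
  ⟨LinearMap.ext fun a => (grIso_hOp α M ((grIso α M).symm a)).trans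
      (congr_arg (grH M) ((grIso α M).apply_symm_apply a)),
    LinearMap.ext fun a => (congr_arg (grIso α M) (xOp_restrict (T.obj M) _).symm).trans
      ((grIso_xOp α M ((grIso α M).symm a)).trans
        (congr_arg (grX M) ((grIso α M).apply_symm_apply a)))⟩

/-- The module structure on `GrEv M` is determined by the actions of `h` and `X`. -/
theorem IsGrStructure.eq_grAction {M : RepGa11 k} {s : (osp12 k).Action (GrEv M) (grParity M)}
    (hs : IsGrStructure M s) : s = grAction α M := by
  let e : (T.obj M).V ≃ₗ[k] GrEv M := grIso α M
  have hsymm : ∀ A : Module.End k (T.obj M).V, e.symm.conj (e.conj A) = A := fun A =>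
    LinearMap.ext fun v => by
      simp only [LinearEquiv.conj_apply_apply, LinearEquiv.symm_symm, LinearEquiv.symm_apply_apply]
  have hsymm' : ∀ A : Module.End k (GrEv M), e.conj (e.symm.conj A) = A := fun A =>
    LinearMap.ext fun v => by
      simp only [LinearEquiv.conj_apply_apply, LinearEquiv.symm_symm, LinearEquiv.apply_symm_apply]
  have hp : e.symm.conj (grParity M) = (T.obj M).parity := by
    rw [← conj_grIso_parity α M]
    exact hsymm _
  have h := isGrStructure_grAction α M
  have key : s.transport e.symm hp = (T.obj M).action := by
    refine action_eq_of_eq _ _ ?_ ?_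
    · refine Eq.trans ?_ (hsymm _)
      exact congr_arg e.symm.conj (hs.1.trans h.1.symm)
    · refine Eq.trans ?_ (hsymm _)
      exact congr_arg e.symm.conj (hs.2.trans h.2.symm)
  refine LieSuperalgebra.Action.ext (LinearMap.ext fun a => ?_) (LinearMap.ext fun a => ?_)
  · refine (hsymm' _).symm.trans ?_
    exact congr_arg e.conj (LinearMap.congr_fun (congr_arg LieSuperalgebra.Action.ev key) a)
  · refine (hsymm' _).symm.trans ?_
    exact congr_arg e.conj (LinearMap.congr_fun (congr_arg LieSuperalgebra.Action.od key) a)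

theorem grIso_ev (M : RepGa11 k) (a : (osp12 k).even) (v : (T.obj M).V) :
    grIso α M ((T.obj M).action.ev a v) = (grAction α M).ev a (grIso α M v) :=
  congr_arg (fun w : (T.obj M).V => grIso α M ((T.obj M).action.ev a w))
    ((grIso α M).symm_apply_apply v).symm

theorem grIso_od (M : RepGa11 k) (a : (osp12 k).odd) (v : (T.obj M).V) :
    grIso α M ((T.obj M).action.od a v) = (grAction α M).od a (grIso α M v) :=
  congr_arg (fun w : (T.obj M).V => grIso α M ((T.obj M).action.od a w))
    ((grIso α M).symm_apply_apply v).symm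

end Structure

theorem lemma3p6 (k : Type u) [Field k] [IsAlgClosed k] [CharZero k] :
    -- `deligne M` is the unique Deligne filtration of `M`
    (∀ (M : RepGa11 k) (F : ℤ → Submodule k M.V), IsDeligneFiltration M F ↔ F = deligne M) ∧
    -- the even part of the associated graded has a unique `𝔬𝔰𝔭(1|2)`-structure
    (∀ M : RepGa11 k, ∃! s : (osp12 k).Action (GrEv M) (grParity M), IsGrStructure M s) ∧
    -- these structures define a `k`-linear symmetric monoidal functor `T` to `Rep(OSp(1|2))`
    ∃ (T : RepGa11 k ⥤ RepOSp12 k) (_ : T.Braided)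
      (e : ∀ M : RepGa11 k, (T.obj M).V ≃ₗ[k] GrEv M),
      T.Additive ∧ T.Linear k ∧
      -- `T M` is `GrEv M` as a superspace and as an `𝔬𝔰𝔭(1|2)`-module
      (∀ M v, e M ((T.obj M).parity v) = grParity M (e M v)) ∧
      (∀ M (s : (osp12 k).Action (GrEv M) (grParity M)), IsGrStructure M s →
        (∀ a v, e M ((T.obj M).action.ev a v) = s.ev a (e M v)) ∧
        (∀ a v, e M ((T.obj M).action.od a v) = s.od a (e M v))) ∧
      -- `T f` is the map of associated graded spaces induced by `f`
      (∀ (M N : RepGa11 k) (f : M ⟶ N) (v : (T.obj M).V),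
        e N (SRep.lin (T.map f) v) = grHom f (e M v)) ∧
      -- the tensor structure of `T` takes the classes of `m` and `n` to the class of `m ⊗ n`
      (∀ (M N : RepGa11 k) (i j : ℤ) (m : M.V) (hm : m ∈ deligne M (2 * i)) (n : N.V)
        (hn : n ∈ deligne N (2 * j)),
        ∃ hmn : (m ⊗ₜ[k] n : M.V ⊗[k] N.V) ∈ deligne (M ⊗ N) (2 * (i + j)),
          e (M ⊗ N) (SRep.lin (Functor.LaxMonoidal.μ T M N)
            ((e M).symm (GrEv.mk i m hm) ⊗ₜ[k] (e N).symm (GrEv.mk j n hn))) =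
              GrEv.mk (i + j) (m ⊗ₜ[k] n : M.V ⊗[k] N.V) hmn) ∧
      -- `T` is isomorphic, as a symmetric monoidal functor, to the semisimplification functor,
      -- where `Rep(OSp(1|2))` is identified with the semisimplification of `Rep(𝔾ₐ^(1|1))`
      -- through the restriction functor
      (restrict ⋙ SemisimpleQuotient.proj : RepOSp12 k ⥤ _).IsEquivalence ∧
      ∃ α : T ⋙ restrict ⋙ SemisimpleQuotient.proj ≅
          (SemisimpleQuotient.proj : RepGa11 k ⥤ SemisimpleQuotient (RepGa11 k)),
        α.hom.IsMonoidal := by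
  obtain ⟨T, _, α, hα⟩ := exists_factorization (k := k)
  refine ⟨fun M F => isDeligneFiltration_iff M F, fun M => ⟨grAction α M,
    isGrStructure_grAction α M, fun s hs => hs.eq_grAction α⟩, T, inferInstance,
    fun M => grIso α M, functor_additive α, functor_linear α, grIso_parity α,
    fun M s hs => ?_, fun M N f v => grIso_naturality α f v,
    fun M N i j m hm n hn => ⟨tmul_mem_deligne hm hn, grIso_tensor α hm hn⟩,
    inferInstance, α, hα⟩
  obtain rfl := hs.eq_grAction α
  exact ⟨grIso_ev α M, grIso_od α M⟩
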